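/- For an even integer $k\ge 2$ let $p_0,\dots,p_k$ be the normalized Kravchuk polynomials, given by $p_0(x)=1$, $p_1(x)=x/\sqrt{k}$ and $x\,p_i(x)=\sqrt{(i+1)(k-i)}\,p_{i+1}(x)+\sqrt{i(k-i+1)}\,p_{i-1}(x)$. For $\mathcal I\subseteq[d]$ with $|\mathcal I|=k$ put $x(\mathcal I)=\sum_{i\in\mathcal I}x_i$ and $$h_{\mathcal I}(x)=\bigl(p_0(x(\mathcal I)),p_2(x(\mathcal I)),\dots,p_k(x(\mathcal I))\bigr)\in\mathbb R^{q},\qquad q=1+k/2 .$$ **Layer-wise RedEx training.** Let $L=\lceil\log_2 k\rceil$, $\lambda=1/\sqrt m$, $M_1=\frac12+\frac1{\sqrt{2-2/k}}$, and $M_2=\dots=M_L=2^{3k}(3k)^k$. For $t=1,\dots,L$ draw a fresh sample $x_{t,1},\dots,x_{t,m}$ ($m\ge1$), all $Lm$ points being i.i.d. uniform on $\{\pm1\}^d$. Put $\Psi_0(x)=(\sqrt2,x)\in\mathbb R^{d+1}$. Given $\Psi_{t-1}$, choose $n_t\le m$, a matrix $V^t$ with $n_t$ pairwise orthogonal rows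 and $\|V^t\|_{\rm fr}^2\le M_t$, and matrices $P^t_1,\dots,P^t_q\in\mathbb R^{n_t\times n_t}$ of spectral norm at most $1$, which together minimize, among all such choices (including that of $n_t$), $$\frac1m\sum_{i=1}^m\sum_{j=1}^q\Bigl(\bigl\langle P_j,(V\Psi_{t-1}(x_{t,i}))(V\Psi_{t-1}(x_{t,i}))^\top\bigr\rangle-h_{\mathcal I}(x_{t,i})_j\Bigr)^2+\lambda\Bigl(\|V^\top V\|_{\rm fr}^2+\sum_{j=1}^q\|V^\top P_jV\|_{\rm fr}^2\Bigr),$$ and put $\Psi_t(x)=(V^t\Psi_{t-1}(x))(V^t\Psi_{t-1}(x))^\top$, viewed as a vector in $\mathbb R^{n_t^2}$. The output hypothesis is $h(x)=\bigl(\langle P^L_1,\Psi_L(x)\rangle,\dots,\langle P^L_q,\Psi_L(x)\rangle\bigr)$. **Theorem.** There is an absolute constant $C>0$ such that for all $0<a\le b$ there are $C'>0$ and $d_0$ with the following property. Let $d\ge d_0$, let $k$ be even with $$a\,\frac{\sqrt{\log d}}{(\log\log d)^2}\le k\le b\,\frac{\sqrt{\log d}}{(\log\log d)^2},$$ let $\mathcal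 I\subseteq[d]$ with $|\mathcal I|=k$, and let $m\ge1$. Then for every value of the samples the minimizers in all layers exist, and for every $\delta\in(0,1)$, with probability at least $1-\delta$ over the samples, every hypothesis $h$ that the training can output (whichever minimizers are chosen) satisfies $$\mathbb E_{x\sim\{\pm1\}^d}\,\|h(x)-h_{\mathcal I}(x)\|^2\;\le\;\frac{d^4\,2^{C k^2\log_2^2 k}}{\delta\,m^{1/4}},$$ and moreover $\dfrac{d^4\,2^{C k^2\log_2^2 k}}{\delta\,m^{1/4}}\le\dfrac{C'd^5}{\delta\,m^{1/4}}$. -/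

import Mathlib

open scoped Matrix

noncomputable section

namespace RedEx

/-! ### Matrix norms -/

/-- The squared Frobenius norm of a matrix. -/
def frSq {α β : Type} [Fintype α] [Fintype β] (A : Matrix α β ℝ) : ℝ :=
  ∑ i, ∑ j, A i j ^ 2

/-- The spectral norm of a square matrix: its operator norm for the Euclidean norm. -/
def spNorm {n : ℕ} (A : Matrix (Fin n) (Fin n) ℝ) : ℝ :=
  ‖Matrix.toEuclideanCLM (n := Fin n) (𝕜 := ℝ) A‖

/-- The inner product `⟨A, B⟩ = Tr(Bᵀ A)` of matrices. -/
def matInner {n : ℕ} (A B : Matrix (Fin n) (Fin n) ℝ) : ℝ :=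
  (Bᵀ * A).trace

/-! ### One layer -/

/-- The extractor-expander `Ψ_V(x) = (V x)^{⊗ 2} = (V x)(V x)ᵀ`. -/
def expand {ι : Type} [Fintype ι] {n : ℕ} (V : Matrix (Fin n) ι ℝ) (x : ι → ℝ) :
    Matrix (Fin n) (Fin n) ℝ :=
  Matrix.vecMulVec (V *ᵥ x) (V *ᵥ x)

/-- The reduced linear map `Ψ_P(X) = (⟨P_1, X⟩, …, ⟨P_q, X⟩)`. -/
def reduce {n q : ℕ} (P : Fin q → Matrix (Fin n) (Fin n) ℝ) (X : Matrix (Fin n) (Fin n) ℝ) :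
    Fin q → ℝ :=
  fun j => matInner (P j) X

/-- The constraints on one layer trained on `m` examples with width parameter `M`:
`V` has `n ≤ m` pairwise orthogonal rows, `‖V‖²_fr ≤ M`, and `‖P_j‖_sp ≤ 1` for all `j`. -/
structure IsFeasible {ι : Type} [Fintype ι] {n q : ℕ} (m : ℕ) (M : ℝ)
    (V : Matrix (Fin n) ι ℝ) (P : Fin q → Matrix (Fin n) (Fin n) ℝ) : Prop where
  rows_le : n ≤ m
  orthogonal : ∀ a b : Fin n, a ≠ b → V a ⬝ᵥ V b = 0
  width : frSq V ≤ M
  spectral : ∀ j, spNorm (P j) ≤ 1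

/-- The regularizer `‖Vᵀ V‖²_fr + ∑ j, ‖Vᵀ P_j V‖²_fr`. -/
def regularizer {ι : Type} [Fintype ι] {n q : ℕ} (V : Matrix (Fin n) ι ℝ)
    (P : Fin q → Matrix (Fin n) (Fin n) ℝ) : ℝ :=
  frSq (Vᵀ * V) + ∑ j, frSq (Vᵀ * P j * V)

/-- The regularized empirical loss of one layer on the data set `S`. -/
def objective {ι Y : Type} [Fintype ι] {n q m : ℕ} (loss : (Fin q → ℝ) → Y → ℝ) (lam : ℝ)
    (S : Fin m → (ι → ℝ) × Y) (V : Matrix (Fin n) ι ℝ)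
    (P : Fin q → Matrix (Fin n) (Fin n) ℝ) : ℝ :=
  (1 / (m : ℝ)) * ∑ i, loss (reduce P (expand V (S i).1)) (S i).2 + lam * regularizer V P

/-- `(V, P)` minimizes the regularized empirical loss among all feasible pairs, the number of
rows of the competing extractors being free as well. -/
def IsLayerMinimizer {ι Y : Type} [Fintype ι] {n q m : ℕ} (loss : (Fin q → ℝ) → Y → ℝ)
    (M lam : ℝ) (S : Fin m → (ι → ℝ) × Y) (V : Matrix (Fin n) ι ℝ)
    (P : Fin q → Matrix (Fin n) (Fin n) ℝ) : Prop :=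
  IsFeasible m M V P ∧
    ∀ (n' : ℕ) (V' : Matrix (Fin n') ι ℝ) (P' : Fin q → Matrix (Fin n') (Fin n') ℝ),
      IsFeasible m M V' P' → objective loss lam S V P ≤ objective loss lam S V' P'

/-! ### Several layers -/

/-- The coordinates of the representation after `t` layers: `d + 1` of them for `t = 0`, and the
entries of an `n_t × n_t` matrix after the `t`-th layer. Layers are numbered from `0` here. -/
def RepIdx (d : ℕ) (n : ℕ → ℕ) : ℕ → Type
  | 0 => Fin (d + 1)
  | t + 1 => Fin (n t) × Fin (n t)

instance (d : ℕ) (n : ℕ → ℕ) : (t : ℕ) → Fintype (RepIdx d n t)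
  | 0 => inferInstanceAs (Fintype (Fin (d + 1)))
  | t + 1 => inferInstanceAs (Fintype (Fin (n t) × Fin (n t)))

/-- The parameters of a multi-layer RedEx with `d` inputs and `q` outputs. Only the layers with
index below the number of layers are ever used. -/
structure Net (d q : ℕ) where
  n : ℕ → ℕ
  V : ∀ t, Matrix (Fin (n t)) (RepIdx d n t) ℝ
  P : ∀ t, Fin q → Matrix (Fin (n t)) (Fin (n t)) ℝ

/-- The representation after `t` layers: `(c, x)` for `t = 0`, and then
`Ψ_{V^t} ∘ ⋯ ∘ Ψ_{V^1}` applied to it, each matrix being viewed as a vector. -/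
def Net.features {d q : ℕ} (N : Net d q) (c : ℝ) (x : Fin d → ℝ) :
    (t : ℕ) → RepIdx d N.n t → ℝ
  | 0 => Fin.cons (α := fun _ => ℝ) c x
  | t + 1 => fun p => expand (N.V t) (N.features c x t) p.1 p.2

/-- The output hypothesis `Ψ_{P^L} ∘ Ψ_{V^L} ∘ ⋯ ∘ Ψ_{V^1}` for `L ≥ 1` layers. -/
def Net.output {d q : ℕ} (N : Net d q) (c : ℝ) (L : ℕ) (x : Fin d → ℝ) : Fin q → ℝ :=
  reduce (N.P (L - 1)) (expand (N.V (L - 1)) (N.features c x (L - 1)))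

/-- `N` is a possible result of layer-wise training with `L` layers, in which the `t`-th layer is
trained on its own sample `S t`: each layer minimizes its regularized empirical loss, given the
representation computed by the previous layers. -/
def IsTrained {d q m L : ℕ} {Y : Type} (loss : (Fin q → ℝ) → Y → ℝ) (M lam : Fin L → ℝ) (c : ℝ)
    (S : Fin L → Fin m → (Fin d → ℝ) × Y) (N : Net d q) : Prop :=
  ∀ t : Fin L, IsLayerMinimizer loss (M t) (lam t)
    (fun i => (N.features c (S t i).1 t, (S t i).2)) (N.V t) (N.P t)

/-! ### The learning problem -/

/-- The (normalized) Kravchuk polynomials: `p_0 = 1`, `p_1 = x / √k` and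
`x p_i = √((i+1)(k-i)) p_{i+1} + √(i(k-i+1)) p_{i-1}`. -/
def kravchuk (k : ℕ) : ℕ → Polynomial ℝ
  | 0 => 1
  | 1 => Polynomial.C (1 / √(k : ℝ)) * Polynomial.X
  | i + 2 =>
      Polynomial.C (1 / √(((i : ℝ) + 2) * ((k : ℝ) - ((i : ℝ) + 1)))) *
        (Polynomial.X * kravchuk k (i + 1) -
          Polynomial.C (√(((i : ℝ) + 1) * ((k : ℝ) - ((i : ℝ) + 1) + 1))) * kravchuk k i)

/-- The target `h_I(x) = (p_0(x(I)), p_2(x(I)), …, p_k(x(I)))` where `x(I) = ∑ i ∈ I, x i`. -/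
def target {d : ℕ} (k : ℕ) (I : Finset (Fin d)) (x : Fin d → ℝ) : Fin (k / 2 + 1) → ℝ :=
  fun j => (kravchuk k (2 * (j : ℕ))).eval (∑ i ∈ I, x i)

/-- The square loss `‖ŷ - y‖²` (Euclidean norm). -/
def squareLoss {q : ℕ} (yhat y : Fin q → ℝ) : ℝ :=
  ∑ j, (yhat j - y j) ^ 2

/-- The cube `{±1}^d`. -/
abbrev Cube (d : ℕ) : Type := Fin d → ℤˣ

instance : MeasurableSingletonClass ℤˣ where
  measurableSet_singleton u :=
    ⟨{(u : ℤ)}, MeasurableSet.singleton _, by ext v; simp [Units.ext_iff]⟩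

/-- A point of the cube as a real vector. -/
def Cube.toReal {d : ℕ} (x : Cube d) : Fin d → ℝ := fun i => ((x i : ℤ) : ℝ)

/-- The uniform distribution on the cube. -/
def cubeMeasure (d : ℕ) : MeasureTheory.Measure (Cube d) :=
  ProbabilityTheory.uniformOn Set.univ

/-- The law of `L` independent samples, each of `m` i.i.d. uniform points of the cube. -/
def sampleMeasure (d L m : ℕ) : MeasureTheory.Measure (Fin L → Fin m → Cube d) :=
  MeasureTheory.Measure.pi fun _ => MeasureTheory.Measure.pi fun _ => cubeMeasure d

/-- The labelled samples: each `x` comes with the label `h_I(x)`. -/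
def labelled {d L m : ℕ} (k : ℕ) (I : Finset (Fin d)) (S : Fin L → Fin m → Cube d) :
    Fin L → Fin m → (Fin d → ℝ) × (Fin (k / 2 + 1) → ℝ) :=
  fun t i => ((S t i).toReal, target k I (S t i).toReal)

/-- The population square loss of a hypothesis `h` with respect to the target `h_I`. -/
def populationLoss {d : ℕ} (k : ℕ) (I : Finset (Fin d))
    (h : (Fin d → ℝ) → Fin (k / 2 + 1) → ℝ) : ℝ :=
  ∫ x : Cube d, squareLoss (h x.toReal) (target k I x.toReal) ∂(cubeMeasure d)

/-- The number of layers `⌈log₂ k⌉`. -/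
def numLayers (k : ℕ) : ℕ := Nat.clog 2 k

/-- The width parameters: `1/2 + 1/√(2 - 2/k)` for the first layer and `2^{3k} (3k)^k` for the
others. -/
def widths (k : ℕ) (t : Fin (numLayers k)) : ℝ :=
  if (t : ℕ) = 0 then 1 / 2 + 1 / √(2 - 2 / (k : ℝ)) else 2 ^ (3 * k) * (3 * (k : ℝ)) ^ k

/-- `N` is a possible result of training on the samples `S` labelled by `h_I`, with the square
loss, the widths above, `λ_t = 1/√m` and `c = √2`. -/
def IsTrainedOn {d m : ℕ} (k : ℕ) (I : Finset (Fin d)) (S : Fin (numLayers k) → Fin m → Cube d)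
    (N : Net d (k / 2 + 1)) : Prop :=
  IsTrained squareLoss (widths k) (fun _ => 1 / √(m : ℝ)) (√2) (labelled k I S) N

/-- The growth rate `√(log d) / (log log d)²`. -/
def sparsityScale (d : ℕ) : ℝ :=
  √(Real.log d) / Real.log (Real.log d) ^ 2

/-- The bound `d⁴ · 2^{C k² log² k} / (δ m^{1/4})`. -/
def lossBound (C : ℝ) (d k m : ℕ) (δ : ℝ) : ℝ :=
  (d : ℝ) ^ 4 * (2 : ℝ) ^ (C * (k : ℝ) ^ 2 * Real.logb 2 k ^ 2) / (δ * (m : ℝ) ^ (1 / 4 : ℝ))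

end RedEx

end

open scoped Matrix

noncomputable section

namespace RedEx

/-! ### Minimizers exist -/

/-! The training is greedy: every layer is fitted to all targets at once. The point is that it
learns those targets which are within its reach, undisturbed by the others, and in a form on which
the next layer can build.

What is propagated is a first-order expansion (`IsApprox`): the features are a function of the
coordinates in `I`, plus a term linear in `x` whose coefficients depend only on the coordinates in
`I` and have total norm at most `√s`, plus an error `s`. A bounded quadratic map preserves this
shape, since the square of the linear term is again of order `s` (`IsApprox.quadratic`). This also
yields uniform convergence: up to `O(s)`, every output of a layer lies in the span of the `2 ^ k *
(d + 1)` functions `1{x|I = y}` and `1{x|I = y} x i`, so finitely many empirical means control all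
hypotheses at once (`IsRepresentative.abs_sub_le`).

High targets do not disturb low ones. On the cube, `p_i(x(I))` is a multiple of the `i`-th
elementary symmetric polynomial (`elemSym_eq_kravchuk`), hence orthogonal to every polynomial of
degree below `i`. Comparing the minimizer with a competitor that computes the low targets and
outputs zero for the high ones therefore bounds the loss on the low targets by the competitor's
loss, the regularizer and an empirical correlation whose expectation is zero
(`IsLayerMinimizer.empMean_le_of_eq_zero`, `empMean_target_mul_le`). The competitor exists because
targets of index at most `2 N` are combinations of products of targets of index at most `N`
(`target_eq_sum_mul`), and the latter are linear functionals of norm at most `2 ^ k` of the zeroth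
order features (`exists_frobenius_representative`). So each layer doubles the range of learned
indices (`layer_step`) and `⌈log₂ k⌉` layers suffice; a layer multiplies the error by `budget k ^
9`.

The first layer needs another argument, since its input `(√2, x)` is not close to a function of the
coordinates in `I`. Its width `1/2 + 1/√(2 - 2/k)` leaves no slack for computing `p_0` and `p_2`. An
extractor of this width whose forms have nearly the right Fourier coefficients must nearly vanish
off the plane spanned by the constant and the sum over `I` (`sum_norm_deviation_le`). This starts
the induction.

Samples are good with high probability by a variance bound and Markov's inequality. If `δ * m ^
(1/4) < d ^ 3`, the bound holds for another reason: the loss of any feasible network is bounded in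
terms of `k` alone, by sub-Gaussian moments of linear forms (`trained_populationLoss_le`). Otherwise
the induction applies. In the given range of `k`, `budget k ^ (9 * numLayers k + 20) = exp O(k² log²
k)` is at most `d`, so all losses depending on `k` are absorbed by one factor `d`. -/

lemma frSq_nonneg {α β : Type} [Fintype α] [Fintype β] (A : Matrix α β ℝ) : 0 ≤ frSq A :=
  Finset.sum_nonneg fun _ _ => Finset.sum_nonneg fun _ _ => sq_nonneg _

lemma continuous_spNorm {n : ℕ} : Continuous (spNorm (n := n)) := by
  have h : Continuous (fun A : Matrix (Fin n) (Fin n) ℝ =>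
      Matrix.toEuclideanCLM (n := Fin n) (𝕜 := ℝ) A) :=
    LinearMap.continuous_of_finiteDimensional
      ((Matrix.toEuclideanCLM (n := Fin n) (𝕜 := ℝ)).toAlgEquiv.toLinearMap)
  exact h.norm

lemma mulVec_norm_le_spNorm {n : ℕ} (A : Matrix (Fin n) (Fin n) ℝ) (u : EuclideanSpace ℝ (Fin n)) :
    ‖WithLp.toLp 2 (A *ᵥ u.ofLp)‖ ≤ spNorm A * ‖u‖ := by
  have := (Matrix.toEuclideanCLM (n := Fin n) (𝕜 := ℝ) A).le_opNorm u
  rwa [← WithLp.toLp_ofLp (p := 2) u, Matrix.toEuclideanCLM_toLp, WithLp.toLp_ofLp] at this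

lemma abs_dotProduct_le {ι : Type} [Fintype ι] (u v : ι → ℝ) :
    |u ⬝ᵥ v| ≤ ‖WithLp.toLp 2 u‖ * ‖WithLp.toLp 2 v‖ := by
  have := abs_real_inner_le_norm (WithLp.toLp 2 v : EuclideanSpace ℝ ι) (WithLp.toLp 2 u)
  rw [EuclideanSpace.inner_eq_star_dotProduct] at this
  simpa [mul_comm] using this

lemma abs_entry_le_spNorm {n : ℕ} (A : Matrix (Fin n) (Fin n) ℝ) (i j : Fin n) :
    |A i j| ≤ spNorm A := by
  have h1 := mulVec_norm_le_spNorm A (EuclideanSpace.single j 1)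
  have h2 := PiLp.norm_apply_le (WithLp.toLp 2 (A *ᵥ (EuclideanSpace.single j (1:ℝ)).ofLp)) i
  simp at h1 h2
  exact h2.trans h1

lemma spNorm_zero {n : ℕ} : spNorm (0 : Matrix (Fin n) (Fin n) ℝ) = 0 := by
  simp [spNorm]

/-- The width bounds the entries of `V`, the spectral norm bounds those of each `P j`, and all
constraints are closed. The number of rows is fixed here, and it only takes the finitely many values
up to `m`. -/
lemma isCompact_feasible {ι : Type} [Fintype ι] (n q m : ℕ) (M : ℝ) :
    IsCompact {p : Matrix (Fin n) ι ℝ × (Fin q → Matrix (Fin n) (Fin n) ℝ) |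
      IsFeasible m M p.1 p.2} := by
  have hK : IsCompact ((Set.univ.pi fun _ : Fin n => Set.univ.pi fun _ : ι =>
      Set.Icc (-√M) (√M)) ×ˢ (Set.univ.pi fun _ : Fin q => Set.univ.pi fun _ : Fin n =>
      Set.univ.pi fun _ : Fin n => Set.Icc (-1 : ℝ) 1) :
      Set (Matrix (Fin n) ι ℝ × (Fin q → Matrix (Fin n) (Fin n) ℝ))) :=
    (isCompact_univ_pi fun _ => isCompact_univ_pi fun _ => isCompact_Icc).prod
      (isCompact_univ_pi fun _ => isCompact_univ_pi fun _ => isCompact_univ_pi fun _ =>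
        isCompact_Icc)
  refine hK.of_isClosed_subset ?_ ?_
  · have : {p : Matrix (Fin n) ι ℝ × (Fin q → Matrix (Fin n) (Fin n) ℝ) |
        IsFeasible m M p.1 p.2} = {p | n ≤ m} ∩ {p | ∀ a b : Fin n, a ≠ b → p.1 a ⬝ᵥ p.1 b = 0} ∩
        {p | frSq p.1 ≤ M} ∩ {p | ∀ j, spNorm (p.2 j) ≤ 1} := by
      ext p
      exact ⟨fun h => ⟨⟨⟨h.1, h.2⟩, h.3⟩, h.4⟩, fun h => ⟨h.1.1.1, h.1.1.2, h.1.2, h.2⟩⟩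
    rw [this]
    refine ((isClosed_const.inter ?_).inter ?_).inter ?_
    · simp only [Set.ofPred_forall]
      refine isClosed_iInter fun a => isClosed_iInter fun b => isClosed_iInter fun _ => ?_
      refine isClosed_eq ?_ continuous_const
      simp only [dotProduct]
      fun_prop
    · refine isClosed_le ?_ continuous_const
      simp only [frSq]
      fun_prop
    · simp only [Set.ofPred_forall]
      refine isClosed_iInter fun j => isClosed_le ?_ continuous_const
      exact continuous_spNorm.comp (by fun_prop)
  · rintro ⟨V, P⟩ h
    refine ⟨fun i _ j _ => ?_, fun a _ i _ j _ => ?_⟩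
    · refine (abs_le (a := V i j)).1 ?_
      refine Real.abs_le_sqrt (le_trans ?_ h.width)
      refine le_trans ?_ (Finset.single_le_sum (f := fun i => ∑ j, V i j ^ 2)
        (fun _ _ => Finset.sum_nonneg fun _ _ => sq_nonneg _) (Finset.mem_univ i))
      exact Finset.single_le_sum (f := fun j => V i j ^ 2) (fun _ _ => sq_nonneg _)
        (Finset.mem_univ j)
    · refine (abs_le (a := P a i j)).1 ?_
      exact (abs_entry_le_spNorm _ _ _).trans (h.spectral a)

lemma continuous_squareLoss {q : ℕ} (y : Fin q → ℝ) :
    Continuous fun z : Fin q → ℝ => squareLoss z y := by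
  unfold squareLoss
  fun_prop

lemma continuous_objective {ι Y : Type} [Fintype ι] {n q m : ℕ}
    {loss : (Fin q → ℝ) → Y → ℝ} (hloss : ∀ y, Continuous fun z => loss z y) (lam : ℝ)
    (S : Fin m → (ι → ℝ) × Y) :
    Continuous fun p : Matrix (Fin n) ι ℝ × (Fin q → Matrix (Fin n) (Fin n) ℝ) =>
      objective loss lam S p.1 p.2 := by
  unfold objective
  refine (continuous_const.mul (continuous_finsetSum _ fun i _ => ?_)).add
    (continuous_const.mul ?_)
  · refine (hloss _).comp (continuous_pi fun j => ?_)
    simp only [reduce, matInner, expand]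
    fun_prop
  · simp only [regularizer, frSq]
    fun_prop

lemma isFeasible_zero {ι : Type} [Fintype ι] {n q m : ℕ} {M : ℝ} (hM : 0 ≤ M) (hn : n ≤ m) :
    IsFeasible m M (0 : Matrix (Fin n) ι ℝ) (0 : Fin q → Matrix (Fin n) (Fin n) ℝ) where
  rows_le := hn
  orthogonal a b _ := by simp [dotProduct]
  width := by simpa [frSq] using hM
  spectral j := by simp [spNorm_zero]

/-- One layer has a minimizer. -/
lemma exists_layerMinimizer {ι Y : Type} [Fintype ι] {q m : ℕ} {loss : (Fin q → ℝ) → Y → ℝ}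
    (hloss : ∀ y, Continuous fun z => loss z y) {M : ℝ} (hM : 0 ≤ M) (lam : ℝ)
    (S : Fin m → (ι → ℝ) × Y) :
    ∃ (n : ℕ) (V : Matrix (Fin n) ι ℝ) (P : Fin q → Matrix (Fin n) (Fin n) ℝ),
      IsLayerMinimizer loss M lam S V P := by
  have h : ∀ n ∈ Finset.range (m + 1),
      ∃ p : Matrix (Fin n) ι ℝ × (Fin q → Matrix (Fin n) (Fin n) ℝ), IsFeasible m M p.1 p.2 ∧
        ∀ p' : Matrix (Fin n) ι ℝ × (Fin q → Matrix (Fin n) (Fin n) ℝ),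
          IsFeasible m M p'.1 p'.2 →
            objective loss lam S p.1 p.2 ≤ objective loss lam S p'.1 p'.2 := by
    intro n hn
    obtain ⟨p, hp, hmin⟩ := (isCompact_feasible n q m M (ι := ι)).exists_isMinOn
      ⟨(0, 0), isFeasible_zero hM (by simpa [Nat.lt_succ_iff] using hn)⟩
      (continuous_objective hloss lam S).continuousOn
    exact ⟨p, hp, fun p' hp' => hmin hp'⟩
  choose p hp hmin using h
  obtain ⟨⟨n, hn⟩, -, hle⟩ := Finset.exists_min_image (Finset.range (m + 1)).attach
    (fun n => objective loss lam S (p n.1 n.2).1 (p n.1 n.2).2) (by simp)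
  refine ⟨n, (p n hn).1, (p n hn).2, hp n hn, fun n' V' P' h' => ?_⟩
  have hn' : n' ∈ Finset.range (m + 1) := by
    simpa [Nat.lt_succ_iff] using h'.rows_le
  exact (hle ⟨n', hn'⟩ (Finset.mem_attach _ _)).trans (hmin n' hn' (V', P') h')

/-- The shape of a representation: `d + 1` coordinates, or an `n × n` matrix. -/
def ShapeIdx (d : ℕ) : Option ℕ → Type
  | none => Fin (d + 1)
  | some n => Fin n × Fin n

instance (d : ℕ) : (o : Option ℕ) → Fintype (ShapeIdx d o)
  | none => inferInstanceAs (Fintype (Fin (d + 1)))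
  | some n => inferInstanceAs (Fintype (Fin n × Fin n))

/-- The parameters of one layer on a representation indexed by `ι`. -/
structure LayerParams (ι : Type) (q : ℕ) where
  n : ℕ
  V : Matrix (Fin n) ι ℝ
  P : Fin q → Matrix (Fin n) (Fin n) ℝ

/-- A representation of the inputs. -/
structure Rep (d : ℕ) where
  shape : Option ℕ
  feat : (Fin d → ℝ) → ShapeIdx d shape → ℝ

section Build

variable {d q : ℕ} (choice : (t : ℕ) → (r : Rep d) → LayerParams (ShapeIdx d r.shape) q) (c : ℝ)

/-- The representations obtained when each layer is chosen given the previous representation. -/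
def repSeq : ℕ → Rep d
  | 0 => ⟨none, fun x => Fin.cons (α := fun _ => ℝ) c x⟩
  | t + 1 => ⟨some (choice t (repSeq t)).n,
      fun x p => expand (choice t (repSeq t)).V ((repSeq t).feat x) p.1 p.2⟩

/-- The number of rows chosen at each layer. -/
def seqRows (t : ℕ) : ℕ := (choice t (repSeq choice c t)).n

/-- The network whose layers are chosen one after the other. -/
def seqNet : Net d q where
  n := seqRows choice c
  -- The types `RepIdx` and `ShapeIdx` of the index sets agree definitionally only after `t` is
  -- split into zero and successor.
  V := fun t => match t with
    | 0 => (choice 0 (repSeq choice c 0)).V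
    | t + 1 => (choice (t + 1) (repSeq choice c (t + 1))).V
  P := fun t => (choice t (repSeq choice c t)).P

/-- Restricted to successors because only there both sides have definitionally equal index types; at
time zero the two representations are equal by unfolding. -/
lemma seqNet_features_succ (x : Fin d → ℝ) (t : ℕ) :
    (seqNet choice c).features c x (t + 1) = (repSeq choice c (t + 1)).feat x := by
  induction t with
  | zero => rfl
  | succ t ih =>
    change (fun p : Fin _ × Fin _ => expand ((seqNet choice c).V (t + 1))
      ((seqNet choice c).features c x (t + 1)) p.1 p.2) = _
    rw [ih]
    rfl

end Build

/-- Layer-wise training has a possible result. -/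
lemma exists_isTrained {d q m L : ℕ} {Y : Type} {loss : (Fin q → ℝ) → Y → ℝ}
    (hloss : ∀ y, Continuous fun z => loss z y) {M : Fin L → ℝ} (hM : ∀ t, 0 ≤ M t)
    (lam : Fin L → ℝ) (c : ℝ) (S : Fin L → Fin m → (Fin d → ℝ) × Y) :
    ∃ N : Net d q, IsTrained loss M lam c S N := by
  have h : ∀ (t : ℕ) (r : Rep d), ∃ l : LayerParams (ShapeIdx d r.shape) q, ∀ ht : t < L,
      IsLayerMinimizer loss (M ⟨t, ht⟩) (lam ⟨t, ht⟩)
        (fun i => (r.feat (S ⟨t, ht⟩ i).1, (S ⟨t, ht⟩ i).2)) l.V l.P := by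
    intro t r
    by_cases ht : t < L
    · obtain ⟨n, V, P, h⟩ := exists_layerMinimizer hloss (hM ⟨t, ht⟩) (lam ⟨t, ht⟩)
        (fun i => (r.feat (S ⟨t, ht⟩ i).1, (S ⟨t, ht⟩ i).2))
      exact ⟨⟨n, V, P⟩, fun _ => h⟩
    -- Beyond the last layer nothing is required, and a layer without rows serves as a default
    -- value.
    · exact ⟨⟨0, 0, 0⟩, fun h => absurd h ht⟩
  choose choice hchoice using h
  refine ⟨seqNet choice c, ?_⟩
  rintro ⟨t, ht⟩
  cases t with
  | zero => exact hchoice 0 (repSeq choice c 0) ht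
  | succ t =>
    have := hchoice (t + 1) (repSeq choice c (t + 1)) ht
    simp only [seqNet_features_succ]
    exact this

/-! ### First-order expansions around functions of the relevant coordinates -/

/-- `φ x` depends only on the coordinates of `x` in `I`. -/
def DependsOnly {d : ℕ} {α : Type} (I : Finset (Fin d)) (φ : Cube d → α) : Prop :=
  ∀ x x' : Cube d, (∀ i ∈ I, x i = x' i) → φ x = φ x'

lemma Cube.abs_toReal {d : ℕ} (x : Cube d) (i : Fin d) : |x.toReal i| = 1 := by
  rcases Int.units_eq_one_or (x i) with h | h <;> simp [Cube.toReal, h]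

lemma Cube.toReal_mul_self {d : ℕ} (x : Cube d) (i : Fin d) : x.toReal i * x.toReal i = 1 := by
  rw [← abs_mul_abs_self, x.abs_toReal, one_mul]

/-- `Φ x` is `Φ₀ x + ∑ i, x i • Φ₁ x i` up to an error `s`, where `Φ₀` and `Φ₁` depend only on
the coordinates in `I`, `Φ₀` is bounded by `r` and `Φ₁` is of order `√s`. -/
structure IsApprox {d : ℕ} {E : Type} [NormedAddCommGroup E] [NormedSpace ℝ E]
    (I : Finset (Fin d)) (Φ Φ₀ : Cube d → E) (Φ₁ : Cube d → Fin d → E) (r s : ℝ) : Prop where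
  base : DependsOnly I Φ₀
  linear : DependsOnly I Φ₁
  norm_base : ∀ x, ‖Φ₀ x‖ ≤ r
  norm_linear : ∀ x, (∑ i, ‖Φ₁ x i‖) ^ 2 ≤ s
  approx : ∀ x, ‖Φ x - Φ₀ x - ∑ i, x.toReal i • Φ₁ x i‖ ≤ s

section

variable {d : ℕ} {E F : Type} [NormedAddCommGroup E] [NormedSpace ℝ E] [NormedAddCommGroup F]
  [NormedSpace ℝ F] {I : Finset (Fin d)} {Φ Φ₀ : Cube d → E} {Φ₁ : Cube d → Fin d → E} {r s : ℝ}

lemma IsApprox.nonneg (h : IsApprox I Φ Φ₀ Φ₁ r s) : 0 ≤ s :=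
  (sq_nonneg _).trans (h.norm_linear 1)

lemma IsApprox.norm_correction_le (h : IsApprox I Φ Φ₀ Φ₁ r s) (x : Cube d) :
    ‖∑ i, x.toReal i • Φ₁ x i‖ ≤ √s := by
  refine (norm_sum_le _ _).trans ?_
  simp only [norm_smul, Real.norm_eq_abs, Cube.abs_toReal, one_mul]
  exact Real.le_sqrt_of_sq_le (h.norm_linear x)

lemma IsApprox.norm_sub_le (h : IsApprox I Φ Φ₀ Φ₁ r s) (hs : s ≤ 1) (x : Cube d) :
    ‖Φ x - Φ₀ x‖ ≤ 2 * √s := by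
  have h1 := h.approx x
  have h2 := h.norm_correction_le x
  have h3 : s ≤ √s := by
    rw [← Real.sqrt_sq h.nonneg]
    exact Real.sqrt_le_sqrt (by nlinarith [h.nonneg, Real.sqrt_sq h.nonneg])
  calc ‖Φ x - Φ₀ x‖ = ‖(Φ x - Φ₀ x - ∑ i, x.toReal i • Φ₁ x i) + ∑ i, x.toReal i • Φ₁ x i‖ := by
        rw [sub_add_cancel]
    _ ≤ s + √s := (norm_add_le _ _).trans (add_le_add h1 h2)
    _ ≤ 2 * √s := by linarith

/-- First-order expansions are preserved by bounded quadratic maps. -/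
lemma IsApprox.quadratic (h : IsApprox I Φ Φ₀ Φ₁ r s) (hs : s ≤ 1) (hr : 1 ≤ r)
    (B : E →ₗ[ℝ] E →ₗ[ℝ] F) {κ : ℝ} (hκ : 1 ≤ κ) (hB : ∀ u v, ‖B u v‖ ≤ κ * ‖u‖ * ‖v‖) :
    IsApprox I (fun x => B (Φ x) (Φ x)) (fun x => B (Φ₀ x) (Φ₀ x))
      (fun x i => B (Φ₀ x) (Φ₁ x i) + B (Φ₁ x i) (Φ₀ x)) (κ * r ^ 2) (6 * κ ^ 2 * r ^ 2 * s) where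
  base x x' hx := by simp only [h.base x x' hx]
  linear x x' hx := by simp only [h.base x x' hx, h.linear x x' hx]
  norm_base x := by
    refine (hB _ _).trans ?_
    rw [mul_assoc, ← sq]
    have := h.norm_base x
    gcongr
  norm_linear x := by
    have h0 := h.nonneg
    have h1 : ∀ i, ‖B (Φ₀ x) (Φ₁ x i) + B (Φ₁ x i) (Φ₀ x)‖ ≤ 2 * κ * r * ‖Φ₁ x i‖ := by
      intro i
      have a1 := hB (Φ₀ x) (Φ₁ x i)
      have a2 := hB (Φ₁ x i) (Φ₀ x)
      have a3 : κ * ‖Φ₀ x‖ * ‖Φ₁ x i‖ ≤ κ * r * ‖Φ₁ x i‖ := by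
        have := h.norm_base x
        gcongr
      have a4 := norm_add_le (B (Φ₀ x) (Φ₁ x i)) (B (Φ₁ x i) (Φ₀ x))
      linarith
    calc (∑ i, ‖B (Φ₀ x) (Φ₁ x i) + B (Φ₁ x i) (Φ₀ x)‖) ^ 2
        ≤ (∑ i, 2 * κ * r * ‖Φ₁ x i‖) ^ 2 := by
          gcongr with i
          exact h1 i
      _ = 4 * κ ^ 2 * r ^ 2 * (∑ i, ‖Φ₁ x i‖) ^ 2 := by rw [← Finset.mul_sum]; ring
      _ ≤ 4 * κ ^ 2 * r ^ 2 * s := by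
          have := h.norm_linear x
          gcongr
      _ ≤ 6 * κ ^ 2 * r ^ 2 * s := by gcongr; norm_num
  approx x := by
    have h0 := h.nonneg
    set u := ∑ i, x.toReal i • Φ₁ x i with hu
    set w := Φ x - Φ₀ x - u with hw
    have hΦ : Φ x = Φ₀ x + (u + w) := by rw [hw]; abel
    have hsum : ∑ i, x.toReal i • (B (Φ₀ x) (Φ₁ x i) + B (Φ₁ x i) (Φ₀ x)) =
        B (Φ₀ x) u + B u (Φ₀ x) := by
      rw [hu]
      simp [Finset.sum_add_distrib, smul_add, map_sum, LinearMap.sum_apply]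
    have hu1 : ‖u‖ ^ 2 ≤ s := by
      have := h.norm_correction_le x
      calc ‖u‖ ^ 2 ≤ √s ^ 2 := by gcongr
        _ = s := Real.sq_sqrt h0
    have hu2 : ‖u‖ ≤ 1 := by
      have := norm_nonneg u
      nlinarith
    have hw1 : ‖w‖ ≤ s := h.approx x
    have hb := h.norm_base x
    -- With `Φ = Φ₀ + u + w`, the terms `B Φ₀ u` and `B u Φ₀` form the new linear part. Six terms
    -- remain: `B u u` is of order `s` since `‖u‖² ≤ s`, and the others contain `w`, which is of
    -- order `s`. Each is at most `κ² r² s`, whence the factor 6.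
    have key : B (Φ x) (Φ x) - B (Φ₀ x) (Φ₀ x) -
        ∑ i, x.toReal i • (B (Φ₀ x) (Φ₁ x i) + B (Φ₁ x i) (Φ₀ x)) =
        B u u + B (Φ₀ x) w + B w (Φ₀ x) + B u w + B w u + B w w := by
      rw [hsum, hΦ]
      simp only [map_add, LinearMap.add_apply]
      abel
    rw [key]
    have e1 : ‖B u u‖ ≤ κ * s := by
      refine (hB _ _).trans ?_
      rw [mul_assoc, ← sq]; gcongr
    have e2 : ‖B (Φ₀ x) w‖ ≤ κ * r * s := (hB _ _).trans (by gcongr)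
    have e3 : ‖B w (Φ₀ x)‖ ≤ κ * s * r := (hB _ _).trans (by gcongr)
    have e4 : ‖B u w‖ ≤ κ * 1 * s := (hB _ _).trans (by gcongr)
    have e5 : ‖B w u‖ ≤ κ * s * 1 := (hB _ _).trans (by gcongr)
    have e6 : ‖B w w‖ ≤ κ * s * 1 := (hB _ _).trans (by gcongr; exact hw1.trans hs)
    have t1 := norm_add_le (B u u + B (Φ₀ x) w + B w (Φ₀ x) + B u w + B w u) (B w w)
    have t2 := norm_add_le (B u u + B (Φ₀ x) w + B w (Φ₀ x) + B u w) (B w u)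
    have t3 := norm_add_le (B u u + B (Φ₀ x) w + B w (Φ₀ x)) (B u w)
    have t4 := norm_add_le (B u u + B (Φ₀ x) w) (B w (Φ₀ x))
    have t5 := norm_add_le (B u u) (B (Φ₀ x) w)
    have f1 : κ * s ≤ κ * s * r := by nlinarith [mul_nonneg (zero_le_one.trans hκ) h0]
    have f2 : κ * s * r ≤ κ ^ 2 * r ^ 2 * s := by
      have : 1 ≤ κ * r := by nlinarith
      nlinarith [mul_nonneg (mul_nonneg (zero_le_one.trans hκ) h0) (zero_le_one.trans hr)]
    linarith

end

/-! ### The bilinear maps of a layer -/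

section

variable {ι : Type} [Fintype ι] {n : ℕ}

lemma norm_toLp_sq {ι : Type} [Fintype ι] (v : ι → ℝ) :
    ‖(WithLp.toLp 2 v : EuclideanSpace ℝ ι)‖ ^ 2 = ∑ i, v i ^ 2 := by
  simp [EuclideanSpace.norm_sq_eq]

lemma norm_toLp_mulVec_sq_le (V : Matrix (Fin n) ι ℝ) (u : EuclideanSpace ℝ ι) :
    ‖(WithLp.toLp 2 (V *ᵥ u.ofLp) : EuclideanSpace ℝ (Fin n))‖ ^ 2 ≤ frSq V * ‖u‖ ^ 2 := by
  rw [norm_toLp_sq, frSq, Finset.sum_mul]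
  gcongr with i
  have := abs_dotProduct_le (V i) u.ofLp
  rw [← norm_toLp_sq, ← mul_pow, ← sq_abs]
  exact pow_le_pow_left₀ (abs_nonneg _) this 2

lemma norm_toLp_mulVec_le {M : ℝ} {V : Matrix (Fin n) ι ℝ} (hV : frSq V ≤ M)
    (u : EuclideanSpace ℝ ι) :
    ‖(WithLp.toLp 2 (V *ᵥ u.ofLp) : EuclideanSpace ℝ (Fin n))‖ ≤ √M * ‖u‖ := by
  have hM : 0 ≤ M := (frSq_nonneg V).trans hV
  refine le_of_sq_le_sq ?_ (by positivity)
  rw [mul_pow, Real.sq_sqrt hM]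
  exact (norm_toLp_mulVec_sq_le V u).trans (by gcongr)

lemma norm_toLp_mul (u v : EuclideanSpace ℝ (Fin n)) :
    ‖(WithLp.toLp 2 (fun p : Fin n × Fin n => u.ofLp p.1 * v.ofLp p.2) :
      EuclideanSpace ℝ (Fin n × Fin n))‖ = ‖u‖ * ‖v‖ := by
  refine (sq_eq_sq₀ (norm_nonneg _) (by positivity)).1 ?_
  rw [norm_toLp_sq, mul_pow, ← WithLp.toLp_ofLp (p := 2) u, ← WithLp.toLp_ofLp (p := 2) v,
    norm_toLp_sq, norm_toLp_sq, Fintype.sum_prod_type, Finset.sum_mul_sum]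
  simp [mul_pow]

/-- The bilinear map `(u, v) ↦ u vᵀ`. -/
def outerBilin (n : ℕ) : EuclideanSpace ℝ (Fin n) →ₗ[ℝ] EuclideanSpace ℝ (Fin n) →ₗ[ℝ]
    EuclideanSpace ℝ (Fin n × Fin n) :=
  LinearMap.mk₂ ℝ (fun u v => WithLp.toLp 2 fun p : Fin n × Fin n => u.ofLp p.1 * v.ofLp p.2)
    (by intros; ext p; simp [add_mul]) (by intros; ext p; simp [mul_assoc])
    (by intros; ext p; simp [mul_add]) (by intros; ext p; simp [mul_left_comm])

lemma norm_outerBilin (u v : EuclideanSpace ℝ (Fin n)) : ‖outerBilin n u v‖ = ‖u‖ * ‖v‖ :=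
  norm_toLp_mul u v

/-- The linear map of a matrix between Euclidean spaces. -/
def euclLin (V : Matrix (Fin n) ι ℝ) : EuclideanSpace ℝ ι →ₗ[ℝ] EuclideanSpace ℝ (Fin n) where
  toFun u := WithLp.toLp 2 (V *ᵥ u.ofLp)
  map_add' u v := by ext; simp [Matrix.mulVec_add]
  map_smul' c u := by ext; simp [Matrix.mulVec_smul]

lemma norm_euclLin_le {M : ℝ} {V : Matrix (Fin n) ι ℝ} (hV : frSq V ≤ M)
    (u : EuclideanSpace ℝ ι) : ‖euclLin V u‖ ≤ √M * ‖u‖ :=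
  norm_toLp_mulVec_le hV u

/-- The bilinear map `(u, v) ↦ ⟨u, P v⟩`. -/
def formBilin (P : Matrix (Fin n) (Fin n) ℝ) :
    EuclideanSpace ℝ (Fin n) →ₗ[ℝ] EuclideanSpace ℝ (Fin n) →ₗ[ℝ] ℝ :=
  LinearMap.mk₂ ℝ (fun u v => u.ofLp ⬝ᵥ (P *ᵥ v.ofLp))
    (by intros; simp [add_dotProduct]) (by intros; simp [smul_dotProduct])
    (by intros; simp [Matrix.mulVec_add, dotProduct_add])
    (by intros; simp [Matrix.mulVec_smul, dotProduct_smul])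

lemma norm_formBilin_le {P : Matrix (Fin n) (Fin n) ℝ} (hP : spNorm P ≤ 1)
    (u v : EuclideanSpace ℝ (Fin n)) : ‖formBilin P u v‖ ≤ ‖u‖ * ‖v‖ := by
  refine (abs_dotProduct_le (u.ofLp) (P *ᵥ v.ofLp)).trans ?_
  have := mulVec_norm_le_spNorm P v
  rw [WithLp.toLp_ofLp]
  gcongr
  exact this.trans (by nlinarith [norm_nonneg v])

/-- Turns the outputs of a layer into bounded bilinear forms, to which `IsApprox.quadratic` applies.
-/
lemma reduce_expand {q : ℕ} (P : Fin q → Matrix (Fin n) (Fin n) ℝ) (V : Matrix (Fin n) ι ℝ)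
    (u : EuclideanSpace ℝ ι) (j : Fin q) :
    reduce P (expand V u.ofLp) j = formBilin (P j) (euclLin V u) (euclLin V u) := by
  simp only [reduce, matInner, expand, formBilin, LinearMap.mk₂_apply, euclLin, LinearMap.coe_mk,
    AddHom.coe_mk, Matrix.transpose_vecMulVec]
  rw [Matrix.vecMulVec_mul, Matrix.trace_vecMulVec, Matrix.dotProduct_mulVec, dotProduct_comm]

/-- Composition of a bilinear map with a linear map in both arguments bounds. -/
lemma norm_compl₁₂_le {F : Type} [NormedAddCommGroup F] [NormedSpace ℝ F]
    {B : EuclideanSpace ℝ (Fin n) →ₗ[ℝ] EuclideanSpace ℝ (Fin n) →ₗ[ℝ] F}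
    (hB : ∀ u v, ‖B u v‖ ≤ ‖u‖ * ‖v‖) {M : ℝ} {V : Matrix (Fin n) ι ℝ} (hV : frSq V ≤ M)
    (u v : EuclideanSpace ℝ ι) :
    ‖B.compl₁₂ (euclLin V) (euclLin V) u v‖ ≤ M * ‖u‖ * ‖v‖ := by
  have hM : 0 ≤ M := (frSq_nonneg V).trans hV
  calc ‖B (euclLin V u) (euclLin V v)‖ ≤ ‖euclLin V u‖ * ‖euclLin V v‖ := hB _ _
    _ ≤ (√M * ‖u‖) * (√M * ‖v‖) := by
        gcongr <;> exact norm_euclLin_le hV _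
    _ = (√M * √M) * ‖u‖ * ‖v‖ := by ring
    _ = M * ‖u‖ * ‖v‖ := by rw [Real.mul_self_sqrt hM]

end

/-! ### Averages over the cube -/

/-- The average of a function on the cube. -/
def avg {d : ℕ} (f : Cube d → ℝ) : ℝ := ((2 : ℝ) ^ d)⁻¹ * ∑ x, f x

lemma avg_add {d : ℕ} (f g : Cube d → ℝ) : avg (fun x => f x + g x) = avg f + avg g := by
  simp [avg, Finset.sum_add_distrib, mul_add]

lemma avg_sub {d : ℕ} (f g : Cube d → ℝ) : avg (fun x => f x - g x) = avg f - avg g := by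
  simp [avg, mul_sub]

lemma avg_const_mul {d : ℕ} (c : ℝ) (f : Cube d → ℝ) : avg (fun x => c * f x) = c * avg f := by
  simp only [avg, ← Finset.mul_sum]; ring

lemma avg_sum {d : ℕ} {κ : Type} (s : Finset κ) (f : κ → Cube d → ℝ) :
    avg (fun x => ∑ p ∈ s, f p x) = ∑ p ∈ s, avg (f p) := by
  simp only [avg, ← Finset.mul_sum]
  rw [Finset.sum_comm]

lemma avg_mono {d : ℕ} {f g : Cube d → ℝ} (h : ∀ x, f x ≤ g x) : avg f ≤ avg g := by
  unfold avg
  gcongr with x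
  exact h x

lemma card_cube (d : ℕ) : Fintype.card (Cube d) = 2 ^ d := by
  simp [Cube]

lemma avg_const {d : ℕ} (c : ℝ) : avg (fun _ : Cube d => c) = c := by
  simp only [avg, Finset.sum_const, Finset.card_univ, card_cube, nsmul_eq_mul]
  push_cast
  field_simp

lemma avg_le_of_le {d : ℕ} {f : Cube d → ℝ} {c : ℝ} (h : ∀ x, f x ≤ c) : avg f ≤ c :=
  (avg_mono h).trans_eq (avg_const c)

lemma avg_nonneg {d : ℕ} {f : Cube d → ℝ} (h : ∀ x, 0 ≤ f x) : 0 ≤ avg f :=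
  (avg_const (d := d) 0).symm.trans_le (avg_mono h)

lemma avg_mul_sq_le {d : ℕ} (f g : Cube d → ℝ) :
    avg (fun x => f x * g x) ^ 2 ≤ avg (fun x => f x ^ 2) * avg (fun x => g x ^ 2) := by
  have := Finset.sum_mul_sq_le_sq_mul_sq Finset.univ f g
  simp only [avg]
  rw [mul_pow, sq, mul_mul_mul_comm]
  gcongr

/-- Flipping the sign of one coordinate. -/
def flipAt {d : ℕ} (i : Fin d) : Equiv.Perm (Cube d) where
  toFun x := Function.update x i (-x i)
  invFun x := Function.update x i (-x i)
  left_inv x := by simp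
  right_inv x := by simp

lemma flipAt_toReal_self {d : ℕ} (i : Fin d) (x : Cube d) :
    (flipAt i x).toReal i = -x.toReal i := by
  simp [flipAt, Cube.toReal]

lemma flipAt_toReal_of_ne {d : ℕ} {i j : Fin d} (h : j ≠ i) (x : Cube d) :
    (flipAt i x).toReal j = x.toReal j := by
  simp [flipAt, Cube.toReal, h]

lemma avg_eq_zero_of_flip {d : ℕ} (i : Fin d) {f : Cube d → ℝ}
    (h : ∀ x, f (flipAt i x) = -f x) : avg f = 0 := by
  have : ∑ x, f x = -∑ x, f x := by
    rw [← Finset.sum_neg_distrib, ← Equiv.sum_comp (flipAt i)]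
    exact Finset.sum_congr rfl fun x _ => h x
  have h0 : ∑ x, f x = 0 := by linarith
  simp [avg, h0]

/-- A monomial of total degree less than `|S|` misses some coordinate of `S`; flipping the sign of
that coordinate changes the sign of the integrand. -/
lemma avg_prod_mul_monomial {d : ℕ} (S : Finset (Fin d)) (m : Fin d →₀ ℕ)
    (h : (m.sum fun _ e => e) < S.card) :
    avg (fun x : Cube d => (∏ a ∈ S, x.toReal a) * ∏ i, x.toReal i ^ m i) = 0 := by
  obtain ⟨i, hi, hm⟩ : ∃ i ∈ S, m i = 0 := by
    by_contra! hne
    have h1 : S.card ≤ ∑ i ∈ S, m i := by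
      rw [Finset.card_eq_sum_ones]
      exact Finset.sum_le_sum fun i hi => Nat.one_le_iff_ne_zero.2 (hne i hi)
    have h2 : ∑ i ∈ S, m i ≤ ∑ i, m i :=
      Finset.sum_le_sum_of_subset (Finset.subset_univ S)
    have h3 : (m.sum fun _ e => e) = ∑ i, m i := Finsupp.sum_fintype _ _ (by simp)
    omega
  refine avg_eq_zero_of_flip i fun x => ?_
  rw [← Finset.mul_prod_erase _ _ hi, ← Finset.mul_prod_erase _ _ hi, flipAt_toReal_self]
  have h1 : ∏ a ∈ S.erase i, (flipAt i x).toReal a = ∏ a ∈ S.erase i, x.toReal a :=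
    Finset.prod_congr rfl fun a ha => flipAt_toReal_of_ne (Finset.ne_of_mem_erase ha) x
  have h2 : ∏ a, (flipAt i x).toReal a ^ m a = ∏ a, x.toReal a ^ m a := by
    refine Finset.prod_congr rfl fun a _ => ?_
    by_cases ha : a = i
    · subst ha; simp [hm]
    · rw [flipAt_toReal_of_ne ha]
  rw [h1, h2]
  ring

/-- `f` is given on the cube by a polynomial of degree at most `r`. -/
def HasDegreeLE {d : ℕ} (r : ℕ) (f : Cube d → ℝ) : Prop :=
  ∃ p : MvPolynomial (Fin d) ℝ, p.totalDegree ≤ r ∧ ∀ x : Cube d, f x = p.eval x.toReal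

lemma HasDegreeLE.mul {d r s : ℕ} {f g : Cube d → ℝ} (hf : HasDegreeLE r f)
    (hg : HasDegreeLE s g) : HasDegreeLE (r + s) fun x => f x * g x := by
  obtain ⟨p, hp, hf⟩ := hf
  obtain ⟨q, hq, hg⟩ := hg
  exact ⟨p * q, (MvPolynomial.totalDegree_mul _ _).trans (by omega), fun x => by simp [hf, hg]⟩

lemma HasDegreeLE.const {d : ℕ} (r : ℕ) (c : ℝ) : HasDegreeLE r fun _ : Cube d => c :=
  ⟨MvPolynomial.C c, by simp, fun x => by simp⟩

lemma HasDegreeLE.const_mul {d r : ℕ} (c : ℝ) {f : Cube d → ℝ} (hf : HasDegreeLE r f) :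
    HasDegreeLE r fun x => c * f x := by
  simpa using (HasDegreeLE.const 0 c).mul hf

lemma HasDegreeLE.sum {d r : ℕ} {κ : Type} (s : Finset κ) {f : κ → Cube d → ℝ}
    (hf : ∀ p ∈ s, HasDegreeLE r (f p)) : HasDegreeLE r fun x => ∑ p ∈ s, f p x := by
  choose! p hp hf using hf
  refine ⟨∑ i ∈ s, p i, MvPolynomial.totalDegree_finsetSum_le hp, fun x => ?_⟩
  rw [map_sum]
  exact Finset.sum_congr rfl fun i hi => hf i hi x

lemma HasDegreeLE.coord {d : ℕ} (i : Fin d) : HasDegreeLE 1 fun x : Cube d => x.toReal i :=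
  ⟨MvPolynomial.X i, by simp, fun x => by simp⟩

lemma avg_prod_mul_eq_zero {d r : ℕ} {S : Finset (Fin d)} (hS : r < S.card) {f : Cube d → ℝ}
    (hf : HasDegreeLE r f) : avg (fun x : Cube d => (∏ a ∈ S, x.toReal a) * f x) = 0 := by
  obtain ⟨p, hp, hf⟩ := hf
  simp only [hf, MvPolynomial.eval_eq', Finset.mul_sum]
  rw [avg_sum]
  refine Finset.sum_eq_zero fun m hm => ?_
  have := avg_prod_mul_monomial S m
    (((MvPolynomial.le_totalDegree hm).trans hp).trans_lt hS)
  calc avg (fun x : Cube d => (∏ a ∈ S, x.toReal a) * (p.coeff m * ∏ i, x.toReal i ^ m i))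
      = p.coeff m * avg (fun x : Cube d => (∏ a ∈ S, x.toReal a) * ∏ i, x.toReal i ^ m i) := by
        rw [← avg_const_mul]; congr 1; ext x; ring
    _ = 0 := by rw [this, mul_zero]

/-! ### Kravchuk polynomials on the cube -/

section Kravchuk

open Polynomial

/-- The generating polynomial of the elementary symmetric functions of the coordinates in `I`. -/
def symGen {d : ℕ} (I : Finset (Fin d)) (x : Fin d → ℝ) : ℝ[X] := ∏ a ∈ I, (1 + C (x a) * X)

lemma symGen_coeff {d : ℕ} (I : Finset (Fin d)) (x : Fin d → ℝ) (i : ℕ) :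
    (symGen I x).coeff i = ∑ S ∈ I.powersetCard i, ∏ a ∈ S, x a := by
  have h : ∀ S : Finset (Fin d), (∏ a ∈ S, (C (x a) * X : ℝ[X])) =
      C (∏ a ∈ S, x a) * X ^ S.card := by
    intro S
    rw [Finset.prod_mul_distrib, Finset.prod_const, map_prod]
  rw [symGen, Finset.prod_one_add, finsetSum_coeff]
  simp only [h, coeff_C_mul, coeff_X_pow]
  rw [Finset.powersetCard_eq_filter, Finset.sum_filter]
  refine Finset.sum_congr rfl fun S _ => ?_
  by_cases hS : S.card = i
  · simp [hS]
  · simp [hS, Ne.symm hS]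

/-- Since `x a² = 1`, the factor `1 - X²` equals `(1 + x a X)(1 - x a X)`. Multiplied by it, the
logarithmic derivative `∑ x a / (1 + x a X)` becomes `∑ (x a - X)`. Comparing coefficients gives the
three-term recurrence of the elementary symmetric functions. -/
lemma symGen_derivative {d : ℕ} (I : Finset (Fin d)) (x : Cube d) :
    (1 - X ^ 2) * derivative (symGen I x.toReal) =
      (C (∑ i ∈ I, x.toReal i) - C (I.card : ℝ) * X) * symGen I x.toReal := by
  classical
  induction I using Finset.induction_on with
  | empty => simp [symGen]
  | insert a I ha ih =>
    have hx : C (x.toReal a) * C (x.toReal a) = (1 : ℝ[X]) := by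
      rw [← C_mul, x.toReal_mul_self, C_1]
    have hG : symGen (insert a I) x.toReal = (1 + C (x.toReal a) * X) * symGen I x.toReal :=
      Finset.prod_insert ha
    rw [hG, derivative_mul, Finset.sum_insert ha, Finset.card_insert_of_notMem ha]
    simp only [derivative_add, derivative_one, derivative_C_mul, derivative_X, zero_add, mul_one,
      C_add, Nat.cast_add, Nat.cast_one, C_1]
    linear_combination (1 + C (x.toReal a) * X) * ih - X * symGen I x.toReal * hx

/-- The `i`-th elementary symmetric function of the coordinates in `I`. -/
def elemSym {d : ℕ} (I : Finset (Fin d)) (i : ℕ) (x : Fin d → ℝ) : ℝ :=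
  ∑ S ∈ I.powersetCard i, ∏ a ∈ S, x a

lemma elemSym_zero {d : ℕ} (I : Finset (Fin d)) (x : Fin d → ℝ) : elemSym I 0 x = 1 := by
  simp [elemSym]

lemma elemSym_one {d : ℕ} (I : Finset (Fin d)) (x : Fin d → ℝ) :
    elemSym I 1 x = ∑ i ∈ I, x i := by
  simp [elemSym, Finset.powersetCard_one]

lemma elemSym_succ_succ {d : ℕ} (I : Finset (Fin d)) (x : Cube d) (i : ℕ) :
    ((i : ℝ) + 2) * elemSym I (i + 2) x.toReal =
      (∑ i ∈ I, x.toReal i) * elemSym I (i + 1) x.toReal -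
        ((I.card : ℝ) - i) * elemSym I i x.toReal := by
  have h := congrArg (fun p : ℝ[X] => p.coeff (i + 1)) (symGen_derivative I x)
  simp only [sub_mul, one_mul, coeff_sub, mul_assoc, coeff_C_mul, coeff_X_mul,
    coeff_derivative, symGen_coeff, coeff_X_pow_mul'] at h
  simp only [elemSym]
  rcases i with _ | i
  · simp at h ⊢
    linarith
  · push_cast at h ⊢
    linarith

/-- Both identities come from `(i + 1) C(k, i + 1) = (k - i) C(k, i)`. They match the normalization
of the Kravchuk recurrence with that of the elementary symmetric functions. -/
lemma sqrt_choose_mul {k i : ℕ} (hi : i < k) :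
    √(k.choose (i + 1) : ℝ) * √(((i : ℝ) + 1) * ((k : ℝ) - i)) =
      √(k.choose i : ℝ) * ((k : ℝ) - i) ∧
    √(k.choose i : ℝ) * √(((i : ℝ) + 1) * ((k : ℝ) - i)) =
      √(k.choose (i + 1) : ℝ) * ((i : ℝ) + 1) := by
  have hk : (0 : ℝ) < (k : ℝ) - i := by rw [sub_pos]; exact_mod_cast hi
  have h : (k.choose (i + 1) : ℝ) * ((i : ℝ) + 1) = (k.choose i : ℝ) * ((k : ℝ) - i) := by
    have := Nat.choose_succ_right_eq k i
    rw [← Nat.cast_sub hi.le]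
    exact_mod_cast this
  constructor
  · rw [← Real.sqrt_mul (by positivity), ← mul_assoc, h, mul_assoc,
      Real.sqrt_mul (by positivity), Real.sqrt_mul_self hk.le]
  · rw [← Real.sqrt_mul (by positivity), show (k.choose i : ℝ) * (((i : ℝ) + 1) * ((k : ℝ) - i)) =
      k.choose (i + 1) * (((i : ℝ) + 1) * ((i : ℝ) + 1)) by linear_combination -((i : ℝ) + 1) * h,
      Real.sqrt_mul (by positivity), Real.sqrt_mul_self (by positivity)]

/-- The elementary symmetric functions are multiples of the Kravchuk polynomials. -/
lemma elemSym_eq_kravchuk {d : ℕ} (I : Finset (Fin d)) (x : Cube d) (i : ℕ) :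
    i ≤ I.card → elemSym I i x.toReal =
      √(I.card.choose i : ℝ) * (kravchuk I.card i).eval (∑ i ∈ I, x.toReal i) := by
  induction i using Nat.twoStepInduction with
  | zero => intro _; simp [elemSym_zero, kravchuk]
  | one =>
    intro h
    have : √(I.card : ℝ) ≠ 0 := by
      rw [Real.sqrt_ne_zero']; exact_mod_cast h
    simp only [elemSym_one, kravchuk, Nat.choose_one_right, eval_mul, eval_C, eval_X]
    field_simp
  | more i ih0 ih1 =>
    intro h
    have e := elemSym_succ_succ I x i
    rw [ih0 (by omega), ih1 (by omega)] at e
    set z := ∑ i ∈ I, x.toReal i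
    set k := I.card
    obtain ⟨-, a1⟩ := sqrt_choose_mul (show i + 1 < k by omega)
    obtain ⟨a2, -⟩ := sqrt_choose_mul (show i < k by omega)
    have hk : (0 : ℝ) < (k : ℝ) - ((i : ℝ) + 1) := by
      rw [sub_pos]; exact_mod_cast (show i + 1 < k by omega)
    have hs : √(((i : ℝ) + 2) * ((k : ℝ) - ((i : ℝ) + 1))) ≠ 0 := by
      rw [Real.sqrt_ne_zero']; positivity
    have a1' : √(k.choose (i + 1) : ℝ) * √(((i : ℝ) + 2) * ((k : ℝ) - ((i : ℝ) + 1))) =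
        √(k.choose (i + 2) : ℝ) * ((i : ℝ) + 2) := by
      have : ((i : ℝ) + 2) = ((i + 1 : ℕ) : ℝ) + 1 := by push_cast; ring
      rw [this]
      simpa using a1
    simp only [kravchuk, eval_mul, eval_C, eval_X, eval_sub]
    rw [show (k : ℝ) - ((i : ℝ) + 1) + 1 = k - i by ring]
    set s := √(((i : ℝ) + 2) * ((k : ℝ) - ((i : ℝ) + 1)))
    set u := √(((i : ℝ) + 1) * ((k : ℝ) - i))
    have hi : (i : ℝ) + 2 ≠ 0 := by positivity
    refine mul_left_cancel₀ hi (e.trans ?_)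
    have h2 : √(k.choose (i + 2) : ℝ) = √(k.choose (i + 1) : ℝ) * s / ((i : ℝ) + 2) := by
      rw [a1']; field_simp
    rw [h2]
    field_simp
    linear_combination (eval z (kravchuk k i)) * a2

variable {d k : ℕ} {I : Finset (Fin d)}

lemma target_eq_elemSym (hI : I.card = k) (x : Cube d) (j : Fin (k / 2 + 1)) :
    target k I x.toReal j =
      (√(k.choose (2 * (j : ℕ)) : ℝ))⁻¹ * elemSym I (2 * (j : ℕ)) x.toReal := by
  subst hI
  have hj : 2 * (j : ℕ) ≤ I.card := by have := j.2; omega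
  have hpos : √(I.card.choose (2 * (j : ℕ)) : ℝ) ≠ 0 := by
    rw [Real.sqrt_ne_zero']; exact_mod_cast Nat.choose_pos hj
  rw [elemSym_eq_kravchuk I x _ hj, target]
  field_simp

lemma abs_elemSym_le (x : Cube d) (i : ℕ) : |elemSym I i x.toReal| ≤ I.card.choose i := by
  refine (Finset.abs_sum_le_sum_abs _ _).trans ?_
  simp [Finset.abs_prod, Cube.abs_toReal, Finset.card_powersetCard]

lemma target_sq_le (hI : I.card = k) (x : Cube d) (j : Fin (k / 2 + 1)) :
    target k I x.toReal j ^ 2 ≤ 2 ^ k := by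
  have hj : 2 * (j : ℕ) ≤ k := by have := j.2; omega
  have hpos : (0 : ℝ) < k.choose (2 * (j : ℕ)) := by exact_mod_cast Nat.choose_pos hj
  have h := abs_elemSym_le (I := I) x (2 * (j : ℕ))
  rw [target_eq_elemSym hI, mul_pow, inv_pow, Real.sq_sqrt hpos.le, ← sq_abs, inv_mul_le_iff₀ hpos]
  rw [hI] at h
  calc (|elemSym I (2 * (j : ℕ)) x.toReal| ^ 2 : ℝ) ≤ (k.choose (2 * (j : ℕ)) : ℝ) ^ 2 := by gcongr
    _ = (k.choose (2 * (j : ℕ)) : ℝ) * k.choose (2 * (j : ℕ)) := sq _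
    _ ≤ (k.choose (2 * (j : ℕ)) : ℝ) * 2 ^ k := by
        gcongr
        exact_mod_cast Nat.choose_le_two_pow _ _

lemma target_abs_le (hI : I.card = k) (x : Cube d) (j : Fin (k / 2 + 1)) :
    |target k I x.toReal j| ≤ 2 ^ k := by
  have h := target_sq_le hI x j
  have h1 : (1 : ℝ) ≤ 2 ^ k := one_le_pow₀ (by norm_num)
  refine abs_le_of_sq_le_sq (h.trans ?_) (by positivity)
  nlinarith

/-- The target is a combination of products over sets of size exactly `2 j`, so it is orthogonal to
all polynomials of lower degree in all `d` coordinates, and not only to functions of `x(I)`. This is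
why a layer gains nothing in expectation from targets of a degree it cannot reach. -/
lemma avg_target_mul_eq_zero (hI : I.card = k) (j : Fin (k / 2 + 1)) {r : ℕ}
    (hr : r < 2 * (j : ℕ)) {f : Cube d → ℝ} (hf : HasDegreeLE r f) :
    avg (fun x => target k I x.toReal j * f x) = 0 := by
  simp only [target_eq_elemSym hI, elemSym, mul_assoc, Finset.sum_mul]
  rw [avg_const_mul, avg_sum, Finset.sum_eq_zero, mul_zero]
  intro S hS
  exact avg_prod_mul_eq_zero (by rw [(Finset.mem_powersetCard.1 hS).2]; exact hr) hf

lemma target_dependsOnly : DependsOnly I fun x => target k I x.toReal := by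
  intro x x' h
  have : ∑ i ∈ I, x.toReal i = ∑ i ∈ I, x'.toReal i :=
    Finset.sum_congr rfl fun i hi => by simp [Cube.toReal, h i hi]
  unfold target
  simp only [this]

end Kravchuk

/-! ### Expanding a Kravchuk polynomial into products of Kravchuk polynomials -/

/-- `F` is a linear combination of the `g i` with `P i`, with coefficients of `ℓ¹` norm at most
`B`. -/
def SpanLE {κ : Type} [Fintype κ] (g : κ → ℝ → ℝ) (P : κ → Prop) (B : ℝ) (F : ℝ → ℝ) : Prop :=
  ∃ β : κ → ℝ, (∀ i, β i ≠ 0 → P i) ∧ ∑ i, |β i| ≤ B ∧ ∀ z, F z = ∑ i, β i * g i z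

section SpanLE

variable {κ κ' : Type} [Fintype κ] [Fintype κ'] {g : κ → ℝ → ℝ} {g' : κ' → ℝ → ℝ}
  {P : κ → Prop} {P' : κ' → Prop} {B B' : ℝ} {F F' : ℝ → ℝ}

lemma SpanLE.single {i : κ} (hi : P i) : SpanLE g P 1 (g i) := by
  classical
  refine ⟨Pi.single i 1, fun j hj => ?_, ?_, fun z => ?_⟩
  · have : j = i := by
      by_contra h
      exact hj (by simp [h])
    exact this ▸ hi
  · rw [Finset.sum_eq_single i] <;> simp +contextual
  · rw [Finset.sum_eq_single i] <;> simp +contextual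

lemma SpanLE.mono (h : SpanLE g P B F) (hB : B ≤ B') : SpanLE g P B' F := by
  obtain ⟨β, h1, h2, h3⟩ := h
  exact ⟨β, h1, h2.trans hB, h3⟩

lemma SpanLE.add (h : SpanLE g P B F) (h' : SpanLE g P B' F') :
    SpanLE g P (B + B') fun z => F z + F' z := by
  obtain ⟨β, h1, h2, h3⟩ := h
  obtain ⟨β', h1', h2', h3'⟩ := h'
  refine ⟨fun i => β i + β' i, fun i hi => ?_, ?_, fun z => ?_⟩
  · by_contra hP
    have a1 : β i = 0 := by by_contra h; exact hP (h1 i h)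
    have a2 : β' i = 0 := by by_contra h; exact hP (h1' i h)
    exact hi (by simp [a1, a2])
  · refine (Finset.sum_le_sum fun i _ => abs_add_le _ _).trans ?_
    rw [Finset.sum_add_distrib]
    exact add_le_add h2 h2'
  · simp only [h3, h3', add_mul, Finset.sum_add_distrib]

lemma SpanLE.const_mul (c : ℝ) (h : SpanLE g P B F) :
    SpanLE g P (|c| * B) fun z => c * F z := by
  obtain ⟨β, h1, h2, h3⟩ := h
  refine ⟨fun i => c * β i, fun i hi => h1 i (right_ne_zero_of_mul hi), ?_, fun z => ?_⟩
  · simp only [abs_mul, ← Finset.mul_sum]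
    gcongr
  · simp only [h3, mul_assoc, Finset.mul_sum]

lemma SpanLE.mul_left (f : ℝ → ℝ) (h : SpanLE g P B F) :
    SpanLE (fun i z => f z * g i z) P B fun z => f z * F z := by
  obtain ⟨β, h1, h2, h3⟩ := h
  refine ⟨β, h1, h2, fun z => ?_⟩
  simp only [h3, Finset.mul_sum, mul_left_comm]

lemma SpanLE.trans (h : SpanLE g P B F) (hB' : 0 ≤ B') (h' : ∀ i, P i → SpanLE g' P' B' (g i)) :
    SpanLE g' P' (B * B') F := by
  classical
  obtain ⟨β, h1, h2, h3⟩ := h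
  choose! γ a1 a2 a3 using h'
  refine ⟨fun j => ∑ i, β i * γ i j, fun j hj => ?_, ?_, fun z => ?_⟩
  · obtain ⟨i, -, hi⟩ := Finset.exists_ne_zero_of_sum_ne_zero hj
    exact a1 i (h1 i (left_ne_zero_of_mul hi)) j (right_ne_zero_of_mul hi)
  · calc ∑ j, |∑ i, β i * γ i j| ≤ ∑ j, ∑ i, |β i| * |γ i j| := by
          refine Finset.sum_le_sum fun j _ => (Finset.abs_sum_le_sum_abs _ _).trans ?_
          simp only [abs_mul, le_refl]
      _ = ∑ i, |β i| * ∑ j, |γ i j| := by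
          rw [Finset.sum_comm]; simp only [Finset.mul_sum]
      _ ≤ ∑ i, |β i| * B' := by
          refine Finset.sum_le_sum fun i _ => ?_
          by_cases hi : β i = 0
          · simp [hi]
          · exact mul_le_mul_of_nonneg_left (a2 i (h1 i hi)) (abs_nonneg _)
      _ ≤ B * B' := by
          rw [← Finset.sum_mul]; gcongr
  · rw [h3]
    simp only [Finset.sum_mul]
    rw [Finset.sum_comm]
    refine Finset.sum_congr rfl fun i _ => ?_
    by_cases hi : β i = 0
    · simp [hi]
    · rw [a3 i (h1 i hi), Finset.mul_sum]
      simp only [mul_assoc]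

lemma SpanLE.mul (h : SpanLE g P B F) (h' : SpanLE g' P' B' F') :
    SpanLE (fun (p : κ × κ') z => g p.1 z * g' p.2 z) (fun p => P p.1 ∧ P' p.2) (B * B')
      fun z => F z * F' z := by
  obtain ⟨β, h1, h2, h3⟩ := h
  obtain ⟨β', h1', h2', h3'⟩ := h'
  refine ⟨fun p => β p.1 * β' p.2, fun p hp => ⟨h1 _ (left_ne_zero_of_mul hp),
    h1' _ (right_ne_zero_of_mul hp)⟩, ?_, fun z => ?_⟩
  · have h0 : 0 ≤ ∑ i, |β i| := Finset.sum_nonneg fun _ _ => abs_nonneg _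
    have h0' : 0 ≤ ∑ i, |β' i| := Finset.sum_nonneg fun _ _ => abs_nonneg _
    simp only [abs_mul]
    rw [Fintype.sum_prod_type]
    simp only [← Finset.mul_sum, ← Finset.sum_mul]
    gcongr
    exact h0.trans h2
  · simp only [h3, h3', Finset.sum_mul_sum]
    rw [Fintype.sum_prod_type]
    exact Finset.sum_congr rfl fun i _ => Finset.sum_congr rfl fun j _ => by ring

end SpanLE

lemma sqrt_mul_le_half {a b ρ : ℝ} (ha : 0 ≤ a) (hb : 0 ≤ b) (h : a + b = ρ) :
    √(a * b) ≤ ρ / 2 := by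
  refine Real.sqrt_le_iff.2 ⟨by linarith, ?_⟩
  subst h
  nlinarith [sq_nonneg (a - b)]

/-- The values of the Kravchuk polynomials of index at most `k`. -/
def kravVal (k : ℕ) (i : Fin (k + 1)) (z : ℝ) : ℝ := (kravchuk k i).eval z

/-- The monomials, scaled by `k + 1`. -/
def scaledMonomial (k : ℕ) (i : Fin (k + 1)) (z : ℝ) : ℝ := (z / (k + 1)) ^ (i : ℕ)

lemma kravchuk_eval_succ_succ (k i : ℕ) (z : ℝ) :
    (kravchuk k (i + 2)).eval z = (√(((i : ℝ) + 2) * ((k : ℝ) - ((i : ℝ) + 1))))⁻¹ *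
      (z * (kravchuk k (i + 1)).eval z +
        -√(((i : ℝ) + 1) * ((k : ℝ) - i)) * (kravchuk k i).eval z) := by
  simp only [kravchuk, Polynomial.eval_mul, Polynomial.eval_C, Polynomial.eval_X,
    Polynomial.eval_sub, one_div]
  rw [show (k : ℝ) - ((i : ℝ) + 1) + 1 = k - i by ring]
  ring

/-- The two coefficients of the recurrence for `z p_i` are geometric means of numbers with sum `k +
1`, hence each is at most `(k + 1) / 2`. So multiplication by `z / (k + 1)` does not increase the
`ℓ¹` norm of coefficients, and it flips the parity of indices. -/
lemma spanLE_mul_kravVal {k r : ℕ} (hr : r < k) (i : Fin (k + 1))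
    (hi : (i : ℕ) ≤ r ∧ (i : ℕ) % 2 = r % 2) :
    SpanLE (kravVal k) (fun i => (i : ℕ) ≤ r + 1 ∧ (i : ℕ) % 2 = (r + 1) % 2) 1
      fun z => z / (k + 1) * kravVal k i z := by
  obtain ⟨i, hik⟩ := i
  simp only at hi
  have hρ : (0 : ℝ) < (k : ℝ) + 1 := by positivity
  rcases i with _ | i
  · have hk : 0 < k := by omega
    have h := (SpanLE.single (g := kravVal k)
      (P := fun i => (i : ℕ) ≤ r + 1 ∧ (i : ℕ) % 2 = (r + 1) % 2)
      (i := ⟨1, by omega⟩) ⟨by simp, by simp; omega⟩).const_mul (√k / (k + 1))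
    have hk' : √(k : ℝ) ≠ 0 := by rw [Real.sqrt_ne_zero']; exact_mod_cast hk
    have e : (fun z => √k / (k + 1) * kravVal k ⟨1, by omega⟩ z) =
        fun z => z / (k + 1) * kravVal k ⟨0, hik⟩ z := by
      ext z
      simp only [kravVal, kravchuk, Polynomial.eval_mul, Polynomial.eval_C, Polynomial.eval_X,
        Polynomial.eval_one]
      field_simp
    rw [e] at h
    refine h.mono ?_
    rw [abs_of_nonneg (by positivity), mul_one, div_le_one hρ]
    have : (1 : ℝ) ≤ k := by exact_mod_cast hk
    exact Real.sqrt_le_iff.2 ⟨hρ.le, by nlinarith⟩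
  · have hk : (0 : ℝ) < (k : ℝ) - ((i : ℝ) + 1) := by
      rw [sub_pos]; exact_mod_cast (show i + 1 < k by omega)
    set s := √(((i : ℝ) + 2) * ((k : ℝ) - ((i : ℝ) + 1))) with hs
    set u := √(((i : ℝ) + 1) * ((k : ℝ) - i)) with hu
    have hs0 : s ≠ 0 := by rw [hs, Real.sqrt_ne_zero']; positivity
    have h1 := (SpanLE.single (g := kravVal k)
      (P := fun i => (i : ℕ) ≤ r + 1 ∧ (i : ℕ) % 2 = (r + 1) % 2)
      (i := ⟨i + 2, by omega⟩) ⟨by simp; omega, by simp; omega⟩).const_mul (s / (k + 1))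
    have h2 := (SpanLE.single (g := kravVal k)
      (P := fun i => (i : ℕ) ≤ r + 1 ∧ (i : ℕ) % 2 = (r + 1) % 2)
      (i := ⟨i, by omega⟩) ⟨by simp; omega, by simp; omega⟩).const_mul (u / (k + 1))
    have h := h1.add h2
    have e : (fun z => s / (k + 1) * kravVal k ⟨i + 2, by omega⟩ z +
        u / (k + 1) * kravVal k ⟨i, by omega⟩ z) =
        fun z => z / (k + 1) * kravVal k ⟨i + 1, hik⟩ z := by
      ext z
      simp only [kravVal, kravchuk_eval_succ_succ]
      rw [← hs, ← hu]
      field_simp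
      ring
    rw [e] at h
    refine h.mono ?_
    have b1 : s ≤ ((k : ℝ) + 1) / 2 := sqrt_mul_le_half (by positivity) hk.le (by ring)
    have b2 : u ≤ ((k : ℝ) + 1) / 2 :=
      sqrt_mul_le_half (by positivity) (by linarith) (by ring)
    have p1 : 0 ≤ s := Real.sqrt_nonneg _
    have p2 : 0 ≤ u := Real.sqrt_nonneg _
    rw [abs_of_nonneg (by positivity), abs_of_nonneg (by positivity), mul_one, mul_one,
      ← add_div, div_le_one hρ]
    linarith

/-- Repeated multiplication by `z / (k + 1)`, starting from `p_0 = 1`. The parity statement is what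
keeps odd Kravchuk polynomials, which are not among the targets, out of the expansion. -/
lemma spanLE_scaledMonomial {k : ℕ} (r : ℕ) (hr : r < k + 1) :
    SpanLE (kravVal k) (fun i => (i : ℕ) ≤ r ∧ (i : ℕ) % 2 = r % 2) 1
      (scaledMonomial k ⟨r, hr⟩) := by
  induction r with
  | zero =>
    have h := SpanLE.single (g := kravVal k) (P := fun i => (i : ℕ) ≤ 0 ∧ (i : ℕ) % 2 = 0 % 2)
      (i := ⟨0, hr⟩) ⟨by simp, by simp⟩
    have e : scaledMonomial k ⟨0, hr⟩ = kravVal k ⟨0, hr⟩ := by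
      ext z; simp [scaledMonomial, kravVal, kravchuk]
    rwa [e]
  | succ r ih =>
    have h := ((ih (by omega)).mul_left fun z => z / (k + 1)).trans zero_le_one
      (spanLE_mul_kravVal (show r < k by omega))
    have e : scaledMonomial k ⟨r + 1, hr⟩ =
        fun z => z / (k + 1) * scaledMonomial k ⟨r, by omega⟩ z := by
      ext z; simp only [scaledMonomial]; rw [pow_succ']
    rw [e]
    simpa using h

/-- In the recurrence, multiplication by `z` costs a factor `k + 1` in the scaled monomials, the
coefficient of `p_i` is at most `(k + 1) / 2`, and the divisor is at least 1; this is compatible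
with growth by `2 (k + 1)` per index. -/
lemma spanLE_kravVal {k : ℕ} (i : ℕ) : ∀ hi : i < k + 1,
    SpanLE (scaledMonomial k) (fun r => (r : ℕ) ≤ i ∧ (r : ℕ) % 2 = i % 2)
      ((2 * ((k : ℝ) + 1)) ^ i) (kravVal k ⟨i, hi⟩) := by
  have hρ : (0 : ℝ) < (k : ℝ) + 1 := by positivity
  induction i using Nat.twoStepInduction with
  | zero =>
    intro hi
    have h := SpanLE.single (g := scaledMonomial k)
      (P := fun i => (i : ℕ) ≤ 0 ∧ (i : ℕ) % 2 = 0 % 2) (i := ⟨0, hi⟩) ⟨by simp, by simp⟩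
    have e : kravVal k ⟨0, hi⟩ = scaledMonomial k ⟨0, hi⟩ := by
      ext z; simp [scaledMonomial, kravVal, kravchuk]
    rw [e]
    simpa using h
  | one =>
    intro hi
    have hk : (1 : ℝ) ≤ k := by exact_mod_cast (show 1 ≤ k by omega)
    have hk' : 1 ≤ √(k : ℝ) := Real.one_le_sqrt.2 hk
    have h := (SpanLE.single (g := scaledMonomial k)
      (P := fun i => (i : ℕ) ≤ 1 ∧ (i : ℕ) % 2 = 1 % 2) (i := ⟨1, hi⟩)
      ⟨by simp, by simp⟩).const_mul ((k + 1) / √k)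
    have e : kravVal k ⟨1, hi⟩ = fun z => (k + 1) / √k * scaledMonomial k ⟨1, hi⟩ z := by
      ext z
      simp only [scaledMonomial, kravVal, kravchuk, Polynomial.eval_mul, Polynomial.eval_C,
        Polynomial.eval_X, pow_one]
      field_simp
    rw [e]
    refine h.mono ?_
    rw [abs_of_nonneg (by positivity), mul_one, pow_one]
    exact (div_le_self hρ.le hk').trans (by linarith)
  | more i ih0 ih1 =>
    intro hi
    have hk : (1 : ℝ) ≤ (k : ℝ) - ((i : ℝ) + 1) := by
      rw [le_sub_iff_add_le']; exact_mod_cast (show i + 1 + 1 ≤ k by omega)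
    have hs1 : 1 ≤ √(((i : ℝ) + 2) * ((k : ℝ) - ((i : ℝ) + 1))) := by
      rw [Real.one_le_sqrt]; nlinarith
    have hu1 : √(((i : ℝ) + 1) * ((k : ℝ) - i)) ≤ ((k : ℝ) + 1) / 2 :=
      sqrt_mul_le_half (by positivity) (by linarith) (by ring)
    have hu0 : 0 ≤ √(((i : ℝ) + 1) * ((k : ℝ) - i)) := Real.sqrt_nonneg _
    have e : kravVal k ⟨i + 2, hi⟩ = fun z => (√(((i : ℝ) + 2) * ((k : ℝ) - ((i : ℝ) + 1))))⁻¹ *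
      (z * kravVal k ⟨i + 1, by omega⟩ z +
        -√(((i : ℝ) + 1) * ((k : ℝ) - i)) * kravVal k ⟨i, by omega⟩ z) := by
      ext z; exact kravchuk_eval_succ_succ k i z
    set s := √(((i : ℝ) + 2) * ((k : ℝ) - ((i : ℝ) + 1)))
    set u := √(((i : ℝ) + 1) * ((k : ℝ) - i))
    have h1 : SpanLE (scaledMonomial k)
        (fun r => (r : ℕ) ≤ i + 2 ∧ (r : ℕ) % 2 = (i + 2) % 2)
        ((2 * ((k : ℝ) + 1)) ^ (i + 1) * ((k : ℝ) + 1))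
        (fun z => z * kravVal k ⟨i + 1, by omega⟩ z) := by
      refine ((ih1 (by omega)).mul_left fun z => z).trans hρ.le fun r hr => ?_
      have h := (SpanLE.single (g := scaledMonomial k)
        (P := fun r => (r : ℕ) ≤ i + 2 ∧ (r : ℕ) % 2 = (i + 2) % 2)
        (i := ⟨r + 1, by omega⟩) ⟨by simp; omega, by simp; omega⟩).const_mul ((k : ℝ) + 1)
      have e : (fun z => z * scaledMonomial k r z) =
          fun z => ((k : ℝ) + 1) * scaledMonomial k ⟨r + 1, by omega⟩ z := by
        ext z
        simp only [scaledMonomial]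
        rw [pow_succ]
        field_simp
      rw [e]
      refine h.mono ?_
      rw [abs_of_pos hρ, mul_one]
    have h2 : SpanLE (scaledMonomial k)
        (fun r => (r : ℕ) ≤ i + 2 ∧ (r : ℕ) % 2 = (i + 2) % 2)
        ((2 * ((k : ℝ) + 1)) ^ i) (kravVal k ⟨i, by omega⟩) := by
      obtain ⟨β, b1, b2, b3⟩ := ih0 (by omega)
      exact ⟨β, fun r hr => by have := b1 r hr; omega, b2, b3⟩
    rw [e]
    refine ((h1.add (h2.const_mul (-u))).const_mul s⁻¹).mono ?_
    rw [abs_neg, abs_of_nonneg hu0, abs_of_nonneg (inv_nonneg.2 (by linarith))]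
    set ρ := (k : ℝ) + 1
    have hY : 0 ≤ (2 * ρ) ^ i := by positivity
    have hρ1 : 1 ≤ ρ := by simp [ρ]
    calc s⁻¹ * ((2 * ρ) ^ (i + 1) * ρ + u * (2 * ρ) ^ i)
        ≤ 1 * ((2 * ρ) ^ (i + 1) * ρ + ρ / 2 * (2 * ρ) ^ i) := by
          gcongr
          exact inv_le_one_of_one_le₀ hs1
      _ = (2 * ρ) ^ i * (2 * ρ ^ 2 + ρ / 2) := by ring
      _ ≤ (2 * ρ) ^ i * (4 * ρ ^ 2) := by gcongr; nlinarith
      _ = (2 * ρ) ^ (i + 2) := by ring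

/-- A normalized Kravchuk polynomial of even index at most `4 N` is a combination of products of
two of them, of even indices at most `2 N`. -/
lemma target_eq_sum_mul {d k : ℕ} {I : Finset (Fin d)} (N : ℕ) (j : Fin (k / 2 + 1))
    (hj : (j : ℕ) ≤ 2 * N) :
    ∃ c : Fin (k / 2 + 1) → Fin (k / 2 + 1) → ℝ,
      (∀ a b, c a b ≠ 0 → (a : ℕ) ≤ N ∧ (b : ℕ) ≤ N) ∧
      ∑ a, ∑ b, |c a b| ≤ (2 * ((k : ℝ) + 1)) ^ k ∧
      ∀ x : Fin d → ℝ, target k I x j = ∑ a, ∑ b, c a b * (target k I x a * target k I x b) := by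
  have hjk : 2 * (j : ℕ) < k + 1 := by have := j.2; omega
  set T : Fin (k / 2 + 1) → ℝ → ℝ := fun a z => (kravchuk k (2 * (a : ℕ))).eval z with hT
  have hmono : ∀ (a : ℕ) (ha : 2 * a < k + 1), a ≤ N →
      SpanLE T (fun a => (a : ℕ) ≤ N) 1 (scaledMonomial k ⟨2 * a, ha⟩) := by
    intro a ha haN
    have h := (spanLE_scaledMonomial (2 * a) ha).trans (g' := T) (P' := fun a => (a : ℕ) ≤ N)
      zero_le_one fun i hi => by
        have h := SpanLE.single (g := T) (P := fun a => (a : ℕ) ≤ N)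
          (i := ⟨(i : ℕ) / 2, by omega⟩) (by simp; omega)
        have e : T ⟨(i : ℕ) / 2, by omega⟩ = kravVal k i := by
          ext z
          simp only [hT, kravVal]
          rw [show 2 * ((i : ℕ) / 2) = i by omega]
        rwa [e] at h
    simpa using h
  have h := (spanLE_kravVal (2 * (j : ℕ)) hjk).trans (zero_le_one (α := ℝ))
    (g' := fun (p : Fin (k / 2 + 1) × Fin (k / 2 + 1)) z => T p.1 z * T p.2 z)
    (P' := fun p => (p.1 : ℕ) ≤ N ∧ (p.2 : ℕ) ≤ N) fun r hr => by
      -- The exponent `r` is even and at most `4 N`, so `r = 2 a + 2 b` with `a = min (r / 2) N` and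
      -- `b` at most `N`; each of the two monomials expands into targets of index at most `N`.
      have h := (hmono (min ((r : ℕ) / 2) N) (by omega) (by omega)).mul
        (hmono ((r : ℕ) / 2 - min ((r : ℕ) / 2) N) (by omega) (by omega))
      have e : (fun z => scaledMonomial k ⟨2 * min ((r : ℕ) / 2) N, by omega⟩ z *
          scaledMonomial k ⟨2 * ((r : ℕ) / 2 - min ((r : ℕ) / 2) N), by omega⟩ z) =
          scaledMonomial k r := by
        ext z
        simp only [scaledMonomial]
        rw [← pow_add]
        congr 1
        omega
      rw [e] at h
      simpa using h
  obtain ⟨β, h1, h2, h3⟩ := h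
  refine ⟨fun a b => β (a, b), fun a b hab => h1 _ hab, ?_, fun x => ?_⟩
  · rw [← Fintype.sum_prod_type' (fun a b => |β (a, b)|)]
    refine h2.trans ?_
    rw [mul_one]
    have : (0 : ℝ) ≤ k := by positivity
    exact pow_le_pow_right₀ (by linarith) (by omega)
  · rw [← Fintype.sum_prod_type' (fun a b => β (a, b) * (target k I x a * target k I x b))]
    exact h3 _

/-! ### Comparing a minimizer with a competitor -/

section

variable {ι : Type} [Fintype ι] {n q m : ℕ}

lemma trace_mul_transpose (V : Matrix (Fin n) ι ℝ) : (V * Vᵀ).trace = frSq V := by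
  simp [Matrix.trace, Matrix.mul_apply, frSq, sq]

lemma spNorm_conj_unitary (U : Matrix.unitaryGroup (Fin n) ℝ) (P : Matrix (Fin n) (Fin n) ℝ) :
    spNorm (star (U : Matrix (Fin n) (Fin n) ℝ) * P * (U : Matrix (Fin n) (Fin n) ℝ)) = spNorm P := by
  have hU : Matrix.toEuclideanCLM (n := Fin n) (𝕜 := ℝ) (U : Matrix (Fin n) (Fin n) ℝ) ∈
      unitary (EuclideanSpace ℝ (Fin n) →L[ℝ] EuclideanSpace ℝ (Fin n)) :=
    Unitary.map_mem (Matrix.toEuclideanCLM (n := Fin n) (𝕜 := ℝ)) U.2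
  have hU' := Unitary.star_mem hU
  rw [spNorm, map_mul, map_mul, map_star]
  rw [CStarRing.norm_mul_mem_unitary _ hU, CStarRing.norm_mem_unitary_mul _ hU']
  rfl

/-- The rows of an extractor can be rotated so as to become orthogonal. -/
lemma exists_orthogonal_rows {M : ℝ} (hn : n ≤ m) (V : Matrix (Fin n) ι ℝ)
    (P : Fin q → Matrix (Fin n) (Fin n) ℝ) (hV : frSq V ≤ M) (hP : ∀ j, spNorm (P j) ≤ 1) :
    ∃ (V' : Matrix (Fin n) ι ℝ) (P' : Fin q → Matrix (Fin n) (Fin n) ℝ),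
      IsFeasible m M V' P' ∧
        ∀ u : EuclideanSpace ℝ ι, reduce P' (expand V' u.ofLp) = reduce P (expand V u.ofLp) := by
  have hA : (V * Vᵀ).IsHermitian := by
    rw [Matrix.IsHermitian, Matrix.conjTranspose_eq_transpose_of_trivial, Matrix.transpose_mul,
      Matrix.transpose_transpose]
  -- Conjugating by the eigenvectors of `V Vᵀ` makes the Gram matrix of the rows diagonal. It
  -- changes neither the width, which is the trace of that matrix, nor the spectral norms, nor the
  -- outputs.
  set U := hA.eigenvectorUnitary
  set Um : Matrix (Fin n) (Fin n) ℝ := (U : Matrix (Fin n) (Fin n) ℝ) with hUm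
  have hUU : Um * star Um = 1 := Unitary.mul_star_self_of_mem U.2
  have hUt : star Um = Umᵀ := by
    rw [Matrix.star_eq_conjTranspose, Matrix.conjTranspose_eq_transpose_of_trivial]
  have hdiag : (star Um * V) * (star Um * V)ᵀ = Matrix.diagonal hA.eigenvalues := by
    have := hA.conjStarAlgAut_star_eigenvectorUnitary
    rw [Unitary.conjStarAlgAut_apply] at this
    simp only [Unitary.coe_star, star_star] at this
    rw [Matrix.transpose_mul, hUt, Matrix.transpose_transpose, ← Matrix.mul_assoc,
      Matrix.mul_assoc _ V, ← hUt]
    refine Eq.trans this ?_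
    congr 1
  refine ⟨star Um * V, fun j => star Um * P j * Um, ⟨hn, fun a b hab => ?_, ?_, fun j => ?_⟩,
    fun u => ?_⟩
  · have := congrFun (congrFun hdiag a) b
    rw [Matrix.diagonal_apply_ne _ hab, Matrix.mul_apply] at this
    simpa [dotProduct] using this
  · rw [← trace_mul_transpose, Matrix.transpose_mul, Matrix.trace_mul_comm, hUt,
      Matrix.transpose_transpose, Matrix.mul_assoc, ← Matrix.mul_assoc Um, ← hUt, hUU,
      Matrix.one_mul, Matrix.trace_mul_comm, trace_mul_transpose]
    exact hV
  · rw [hUm, spNorm_conj_unitary]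
    exact hP j
  · ext j
    rw [reduce_expand, reduce_expand]
    simp only [formBilin, euclLin, LinearMap.mk₂_apply, LinearMap.coe_mk, AddHom.coe_mk]
    simp only [← Matrix.mulVec_mulVec]
    rw [Matrix.dotProduct_mulVec, hUt, Matrix.vecMul_transpose, Matrix.mulVec_mulVec, ← hUt, hUU,
      Matrix.one_mulVec]

lemma sum_norm_euclLin_single [DecidableEq ι] (V : Matrix (Fin n) ι ℝ) :
    ∑ a, ‖euclLin V (EuclideanSpace.single a 1)‖ ^ 2 = frSq V := by
  rw [frSq, Finset.sum_comm]
  refine Finset.sum_congr rfl fun a _ => ?_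
  rw [euclLin, LinearMap.coe_mk, AddHom.coe_mk, norm_toLp_sq]
  simp

lemma transpose_mul_mul_apply [DecidableEq ι] (V : Matrix (Fin n) ι ℝ) (P : Matrix (Fin n) (Fin n) ℝ) (a b : ι) :
    (Vᵀ * P * V) a b = formBilin P (euclLin V (EuclideanSpace.single a 1))
      (euclLin V (EuclideanSpace.single b 1)) := by
  simp only [formBilin, euclLin, LinearMap.mk₂_apply, LinearMap.coe_mk, AddHom.coe_mk,
    EuclideanSpace.single]
  rw [Matrix.mul_assoc, Matrix.mul_apply]
  simp [dotProduct, Matrix.mulVec, Matrix.mul_apply]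

/-- An entry of `Vᵀ P V` is the form `P` evaluated at two columns of `V`, hence at most the product
of their norms. -/
lemma frSq_transpose_mul_mul_le {M : ℝ} {V : Matrix (Fin n) ι ℝ} (hV : frSq V ≤ M)
    {P : Matrix (Fin n) (Fin n) ℝ} (hP : spNorm P ≤ 1) : frSq (Vᵀ * P * V) ≤ M ^ 2 := by
  classical
  calc frSq (Vᵀ * P * V) ≤ ∑ a, ∑ b, ‖euclLin V (EuclideanSpace.single a 1)‖ ^ 2 *
        ‖euclLin V (EuclideanSpace.single b 1)‖ ^ 2 := by
        unfold frSq
        gcongr with a _ b _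
        rw [transpose_mul_mul_apply, ← mul_pow, ← sq_abs]
        exact pow_le_pow_left₀ (abs_nonneg _) (norm_formBilin_le hP _ _) 2
    _ = frSq V ^ 2 := by
        rw [← Finset.sum_mul_sum, sum_norm_euclLin_single, sq]
    _ ≤ M ^ 2 := pow_le_pow_left₀ (frSq_nonneg V) hV 2

lemma spNorm_one_le : spNorm (1 : Matrix (Fin n) (Fin n) ℝ) ≤ 1 := by
  rw [spNorm, map_one]
  exact ContinuousLinearMap.norm_id_le

lemma regularizer_le {M : ℝ} {V : Matrix (Fin n) ι ℝ} {P : Fin q → Matrix (Fin n) (Fin n) ℝ}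
    (h : IsFeasible m M V P) : regularizer V P ≤ (1 + q) * M ^ 2 := by
  have h1 : frSq (Vᵀ * V) ≤ M ^ 2 := by
    simpa using frSq_transpose_mul_mul_le h.width (spNorm_one_le (n := n))
  have h2 : ∑ j, frSq (Vᵀ * P j * V) ≤ ∑ _j : Fin q, M ^ 2 :=
    Finset.sum_le_sum fun j _ => frSq_transpose_mul_mul_le h.width (h.spectral j)
  simp only [Finset.sum_const, Finset.card_univ, Fintype.card_fin, nsmul_eq_mul] at h2
  unfold regularizer
  linarith

lemma regularizer_nonneg (V : Matrix (Fin n) ι ℝ) (P : Fin q → Matrix (Fin n) (Fin n) ℝ) :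
    0 ≤ regularizer V P :=
  add_nonneg (frSq_nonneg _) (Finset.sum_nonneg fun _ _ => frSq_nonneg _)

/-- The average over a sample. -/
def empMean {d m : ℕ} (s : Fin m → Cube d) (f : Cube d → ℝ) : ℝ :=
  1 / (m : ℝ) * ∑ i, f (s i)

lemma empMean_mono {d m : ℕ} (s : Fin m → Cube d) {f g : Cube d → ℝ} (h : ∀ x, f x ≤ g x) :
    empMean s f ≤ empMean s g := by
  unfold empMean
  gcongr with i
  exact h _

lemma empMean_sum {d m : ℕ} (s : Fin m → Cube d) {κ : Type} (t : Finset κ)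
    (f : κ → Cube d → ℝ) :
    empMean s (fun x => ∑ p ∈ t, f p x) = ∑ p ∈ t, empMean s (f p) := by
  simp only [empMean, ← Finset.mul_sum]
  rw [Finset.sum_comm]

lemma empMean_add {d m : ℕ} (s : Fin m → Cube d) (f g : Cube d → ℝ) :
    empMean s (fun x => f x + g x) = empMean s f + empMean s g := by
  simp [empMean, Finset.sum_add_distrib, mul_add]

lemma empMean_const_mul {d m : ℕ} (s : Fin m → Cube d) (c : ℝ) (f : Cube d → ℝ) :
    empMean s (fun x => c * f x) = c * empMean s f := by
  simp only [empMean, ← Finset.mul_sum]; ring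

lemma empMean_const {d m : ℕ} (hm : m ≠ 0) (s : Fin m → Cube d) (c : ℝ) :
    empMean s (fun _ => c) = c := by
  have : (m : ℝ) ≠ 0 := by exact_mod_cast hm
  simp [empMean]
  field_simp

lemma empMean_nonneg {d m : ℕ} (s : Fin m → Cube d) {f : Cube d → ℝ} (h : ∀ x, 0 ≤ f x) :
    0 ≤ empMean s f :=
  mul_nonneg (by positivity) (Finset.sum_nonneg fun _ _ => h _)

/-- A minimizer has an empirical loss which is not much larger than that of any competitor. -/
lemma IsLayerMinimizer.empMean_le {d n₀ : ℕ} {M lam : ℝ} (hlam : 0 ≤ lam)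
    {Ψ : Cube d → EuclideanSpace ℝ ι} {y : Cube d → Fin q → ℝ} {s : Fin m → Cube d}
    {V : Matrix (Fin n) ι ℝ} {P : Fin q → Matrix (Fin n) (Fin n) ℝ}
    (h : IsLayerMinimizer squareLoss M lam (fun i => ((Ψ (s i)).ofLp, y (s i))) V P)
    (hn₀ : n₀ ≤ m) {V₀ : Matrix (Fin n₀) ι ℝ} {P₀ : Fin q → Matrix (Fin n₀) (Fin n₀) ℝ}
    (hV₀ : frSq V₀ ≤ M) (hP₀ : ∀ j, spNorm (P₀ j) ≤ 1) :
    ∑ j, empMean s (fun x => (reduce P (expand V (Ψ x).ofLp) j - y x j) ^ 2) ≤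
      ∑ j, empMean s (fun x => (reduce P₀ (expand V₀ (Ψ x).ofLp) j - y x j) ^ 2) +
        lam * ((1 + q) * M ^ 2) := by
  obtain ⟨V', P', hf, heq⟩ := exists_orthogonal_rows hn₀ V₀ P₀ hV₀ hP₀
  have h1 := h.2 n₀ V' P' hf
  have h2 := mul_le_mul_of_nonneg_left (regularizer_le hf) hlam
  have h3 := mul_nonneg hlam (regularizer_nonneg V P)
  simp only [objective, heq] at h1
  rw [← empMean_sum, ← empMean_sum]
  simp only [empMean]
  simp only [squareLoss] at h1
  linarith

/-- If the competitor vanishes outside `J`, then the minimizer is good on `J`, up to the empirical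
correlation with the target outside `J`. -/
lemma IsLayerMinimizer.empMean_le_of_eq_zero {d n₀ : ℕ} {M lam : ℝ} (hlam : 0 ≤ lam)
    {Ψ : Cube d → EuclideanSpace ℝ ι} {y : Cube d → Fin q → ℝ} {s : Fin m → Cube d}
    {V : Matrix (Fin n) ι ℝ} {P : Fin q → Matrix (Fin n) (Fin n) ℝ}
    (h : IsLayerMinimizer squareLoss M lam (fun i => ((Ψ (s i)).ofLp, y (s i))) V P)
    (hn₀ : n₀ ≤ m) {V₀ : Matrix (Fin n₀) ι ℝ} {P₀ : Fin q → Matrix (Fin n₀) (Fin n₀) ℝ}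
    (hV₀ : frSq V₀ ≤ M) (hP₀ : ∀ j, spNorm (P₀ j) ≤ 1) (J : Finset (Fin q))
    (hJ : ∀ j ∉ J, P₀ j = 0) :
    ∑ j ∈ J, empMean s (fun x => (reduce P (expand V (Ψ x).ofLp) j - y x j) ^ 2) ≤
      ∑ j ∈ J, empMean s (fun x => (reduce P₀ (expand V₀ (Ψ x).ofLp) j - y x j) ^ 2) +
        lam * ((1 + q) * M ^ 2) +
        2 * ∑ j ∈ Jᶜ, empMean s (fun x => y x j * reduce P (expand V (Ψ x).ofLp) j) := by
  have h1 := h.empMean_le hlam hn₀ hV₀ hP₀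
  rw [← Finset.sum_add_sum_compl J, ← Finset.sum_add_sum_compl J (fun j =>
    empMean s (fun x => (reduce P₀ (expand V₀ (Ψ x).ofLp) j - y x j) ^ 2))] at h1
  -- Outside `J` the competitor pays `y²`, while the minimizer pays `(f - y)² ≥ y² - 2 y f`; it can
  -- be better there only through its correlation with the target.
  have h2 : ∑ j ∈ Jᶜ, empMean s (fun x => (reduce P₀ (expand V₀ (Ψ x).ofLp) j - y x j) ^ 2) ≤
      ∑ j ∈ Jᶜ, empMean s (fun x => (reduce P (expand V (Ψ x).ofLp) j - y x j) ^ 2) +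
      2 * ∑ j ∈ Jᶜ, empMean s (fun x => y x j * reduce P (expand V (Ψ x).ofLp) j) := by
    rw [Finset.mul_sum, ← Finset.sum_add_distrib]
    refine Finset.sum_le_sum fun j hj => ?_
    rw [← empMean_const_mul, ← empMean_add]
    refine empMean_mono s fun x => ?_
    have : reduce P₀ (expand V₀ (Ψ x).ofLp) j = 0 := by
      simp [reduce, matInner, hJ j (Finset.mem_compl.1 hj)]
    rw [this]
    nlinarith [sq_nonneg (reduce P (expand V (Ψ x).ofLp) j)]
  linarith

end

/-! ### Samples that represent the relevant coordinates well -/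

section

variable {d k m : ℕ} {I : Finset (Fin d)}

/-- The indicator of the points which restrict to `y` on `I`. -/
def restrInd (I : Finset (Fin d)) (y : I → ℤˣ) (x : Cube d) : ℝ :=
  if (fun i : I => x i) = y then 1 else 0

/-- An extension of `y` to the cube. -/
def extend (I : Finset (Fin d)) (y : I → ℤˣ) : Cube d :=
  fun i => if h : i ∈ I then y ⟨i, h⟩ else 1

lemma DependsOnly.eq_extend {α : Type} {φ : Cube d → α} (h : DependsOnly I φ) (x : Cube d) :
    φ (extend I fun i => x i) = φ x :=
  h _ _ fun i hi => by simp [extend, hi]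

lemma sum_restrInd (x : Cube d) (c : (I → ℤˣ) → ℝ) :
    ∑ y, restrInd I y x * c y = c fun i => x i := by
  simp [restrInd]

lemma card_restr (hI : I.card = k) : Fintype.card (I → ℤˣ) = 2 ^ k := by
  simp [hI]

lemma avg_restrInd (hI : I.card = k) (y : I → ℤˣ) : avg (restrInd I y) = ((2 : ℝ) ^ k)⁻¹ := by
  have h1 : ∀ y, avg (restrInd I y) = avg (restrInd I 1) := by
    intro y
    simp only [avg]
    -- Multiplication by an extension of `y` is a bijection of the cube that carries the points
    -- restricting to `1` onto those restricting to `y`.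
    rw [← Equiv.sum_comp (Equiv.mulRight (extend I y))]
    congr 1
    refine Finset.sum_congr rfl fun x _ => ?_
    have : ((fun i : I => (x * extend I y) i) = y) ↔ (fun i : I => x i) = 1 := by
      simp [funext_iff, extend]
    simp only [restrInd, Equiv.coe_mulRight, this]
  have h2 : ∑ y, avg (restrInd I y) = 1 := by
    rw [← avg_sum, ← avg_const (d := d) 1]
    congr 1
    ext x
    simpa using sum_restrInd x (fun _ => (1 : ℝ))
  simp only [h1, Finset.sum_const, Finset.card_univ, card_restr hI, nsmul_eq_mul] at h2
  rw [h1]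
  push_cast at h2
  exact eq_inv_of_mul_eq_one_right h2

/-- The value `1` or a coordinate. -/
def affineCoord (o : Option (Fin d)) (x : Cube d) : ℝ := o.elim 1 x.toReal

/-- On the sample `s`, the means of the functions `1{x|I = y}` and `1{x|I = y} x i` are
`τ`-close to their expectations. -/
def IsRepresentative (I : Finset (Fin d)) (s : Fin m → Cube d) (τ : ℝ) : Prop :=
  ∀ (y : I → ℤˣ) (o : Option (Fin d)),
    |empMean s (fun x => restrInd I y x * affineCoord o x) -
      avg (fun x => restrInd I y x * affineCoord o x)| ≤ τ

/-- The functions in question are combinations of the `2 ^ k * (d + 1)` functions of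
`IsRepresentative`, and the absolute values of the coefficients sum to at most `B` for each of the
`2 ^ k` patterns on `I`. As nothing is assumed about the choice of `φ₀` and `φ₁`, they may depend on
the sample. -/
lemma IsRepresentative.abs_sub_le {s : Fin m → Cube d} {τ : ℝ} (hs : IsRepresentative I s τ)
    (hI : I.card = k) {φ₀ : Cube d → ℝ} {φ₁ : Cube d → Fin d → ℝ} (h₀ : DependsOnly I φ₀)
    (h₁ : DependsOnly I φ₁) {B : ℝ} (hB : ∀ x, |φ₀ x| + ∑ i, |φ₁ x i| ≤ B) :
    |empMean s (fun x => φ₀ x + ∑ i, x.toReal i * φ₁ x i) -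
      avg (fun x => φ₀ x + ∑ i, x.toReal i * φ₁ x i)| ≤ 2 ^ k * B * τ := by
  have hτ : 0 ≤ τ := (abs_nonneg _).trans (hs 1 none)
  set c : (I → ℤˣ) → Option (Fin d) → ℝ := fun y o => o.elim (φ₀ (extend I y)) (φ₁ (extend I y))
  have hrep : (fun x : Cube d => φ₀ x + ∑ i, x.toReal i * φ₁ x i) =
      fun x => ∑ y, ∑ o, c y o * (restrInd I y x * affineCoord o x) := by
    ext x
    have : ∀ y, ∑ o, c y o * (restrInd I y x * affineCoord o x) =
        restrInd I y x * ∑ o, c y o * affineCoord o x := by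
      intro y
      rw [Finset.mul_sum]
      exact Finset.sum_congr rfl fun o _ => by ring
    simp only [this]
    rw [sum_restrInd x (fun y => ∑ o, c y o * affineCoord o x)]
    simp only [Fintype.sum_option, c, affineCoord, Option.elim, h₀.eq_extend, h₁.eq_extend, mul_one,
      mul_comm]
  rw [hrep, empMean_sum, avg_sum, ← Finset.sum_sub_distrib]
  calc |∑ y, (empMean s (fun x => ∑ o, c y o * (restrInd I y x * affineCoord o x)) -
        avg (fun x => ∑ o, c y o * (restrInd I y x * affineCoord o x)))|
      ≤ ∑ y, ∑ o, |c y o| * τ := by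
        refine (Finset.abs_sum_le_sum_abs _ _).trans (Finset.sum_le_sum fun y _ => ?_)
        rw [empMean_sum, avg_sum, ← Finset.sum_sub_distrib]
        refine (Finset.abs_sum_le_sum_abs _ _).trans (Finset.sum_le_sum fun o _ => ?_)
        rw [empMean_const_mul, avg_const_mul, ← mul_sub, abs_mul]
        exact mul_le_mul_of_nonneg_left (hs y o) (abs_nonneg _)
    _ ≤ ∑ _y : I → ℤˣ, B * τ := by
        refine Finset.sum_le_sum fun y _ => ?_
        rw [← Finset.sum_mul, Fintype.sum_option]
        exact mul_le_mul_of_nonneg_right (hB _) hτ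
    _ = 2 ^ k * B * τ := by
        rw [Finset.sum_const, Finset.card_univ, card_restr hI, nsmul_eq_mul]
        push_cast; ring

/-- A pattern on `I` has probability `2 ^ (-k)`, hence frequency at least `2 ^ (-(k + 1))` in a
representative sample. A nonnegative function of the pattern is bounded everywhere by its empirical
mean divided by that frequency. -/
lemma IsRepresentative.le_of_empMean_le {s : Fin m → Cube d} {τ : ℝ}
    (hs : IsRepresentative I s τ) (hI : I.card = k) (hτ : τ ≤ ((2 : ℝ) ^ (k + 1))⁻¹)
    {f : Cube d → ℝ} (hf : DependsOnly I f) (h0 : ∀ x, 0 ≤ f x) {e : ℝ} (he : empMean s f ≤ e)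
    (x : Cube d) : f x ≤ 2 ^ (k + 1) * e := by
  have h1 : empMean s (fun z => f x * restrInd I (fun i => x i) z) ≤ empMean s f := by
    refine empMean_mono s fun z => ?_
    unfold restrInd
    split_ifs with hz
    · rw [mul_one, hf x z fun i hi => (congrFun hz ⟨i, hi⟩).symm]
    · rw [mul_zero]; exact h0 z
  rw [empMean_const_mul] at h1
  have h2 := hs (fun i => x i) none
  simp only [affineCoord, Option.elim, mul_one] at h2
  change |empMean s (restrInd I _) - avg (restrInd I _)| ≤ τ at h2
  rw [avg_restrInd hI] at h2
  change f x * empMean s (restrInd I _) ≤ _ at h1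
  have h3 := (abs_le.1 h2).1
  have h4 : ((2 : ℝ) ^ (k + 1))⁻¹ = ((2 : ℝ) ^ k)⁻¹ / 2 := by
    rw [pow_succ, mul_inv]; ring
  have h5 : ((2 : ℝ) ^ (k + 1))⁻¹ ≤ empMean s (restrInd I fun i => x i) := by linarith
  have h6 : f x * ((2 : ℝ) ^ (k + 1))⁻¹ ≤ e :=
    (mul_le_mul_of_nonneg_left h5 (h0 x)).trans (h1.trans he)
  rwa [mul_inv_le_iff₀ (by positivity), mul_comm] at h6

/-- The analogue of `IsRepresentative.le_of_empMean_le` for the true distribution, used for the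
first layer. -/
lemma DependsOnly.le_of_avg_le (hI : I.card = k) {f : Cube d → ℝ} (hf : DependsOnly I f)
    (h0 : ∀ x, 0 ≤ f x) {e : ℝ} (he : avg f ≤ e) (x : Cube d) : f x ≤ 2 ^ k * e := by
  have h1 : avg (fun z => f x * restrInd I (fun i => x i) z) ≤ avg f := by
    refine avg_mono fun z => ?_
    unfold restrInd
    split_ifs with hz
    · rw [mul_one, hf x z fun i hi => (congrFun hz ⟨i, hi⟩).symm]
    · rw [mul_zero]; exact h0 z
  rw [avg_const_mul] at h1
  change f x * avg (restrInd I _) ≤ _ at h1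
  rw [avg_restrInd hI] at h1
  have := h1.trans he
  rwa [mul_inv_le_iff₀ (by positivity), mul_comm] at this

end

/-! ### Low-rank representatives of the output forms -/

lemma inner_outerBilin {n : ℕ} (u v u' v' : EuclideanSpace ℝ (Fin n)) :
    inner ℝ (outerBilin n u v) (outerBilin n u' v') = inner ℝ u u' * inner ℝ v v' := by
  simp only [PiLp.inner_apply, outerBilin, LinearMap.mk₂_apply, Fintype.sum_prod_type,
    Finset.sum_mul_sum]
  refine Finset.sum_congr rfl fun i _ => Finset.sum_congr rfl fun j _ => ?_
  simp
  ring

lemma formBilin_eq_inner {n : ℕ} (P : Matrix (Fin n) (Fin n) ℝ)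
    (u v : EuclideanSpace ℝ (Fin n)) :
    formBilin P u v = inner ℝ (WithLp.toLp 2 (Pᵀ *ᵥ u.ofLp) : EuclideanSpace ℝ (Fin n)) v := by
  rw [EuclideanSpace.inner_eq_star_dotProduct]
  simp only [formBilin, LinearMap.mk₂_apply, star_trivial]
  rw [Matrix.dotProduct_mulVec, Matrix.mulVec_transpose, dotProduct_comm]

lemma norm_transpose_mulVec_le {n : ℕ} {P : Matrix (Fin n) (Fin n) ℝ} (hP : spNorm P ≤ 1)
    (u : EuclideanSpace ℝ (Fin n)) :
    ‖(WithLp.toLp 2 (Pᵀ *ᵥ u.ofLp) : EuclideanSpace ℝ (Fin n))‖ ≤ ‖u‖ := by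
  -- Testing the form with `v = Pᵀ u` gives `‖v‖² ≤ ‖u‖ ‖v‖`.
  set v : EuclideanSpace ℝ (Fin n) := WithLp.toLp 2 (Pᵀ *ᵥ u.ofLp) with hv
  have h1 := norm_formBilin_le hP u v
  rw [formBilin_eq_inner, ← hv, real_inner_self_eq_norm_sq, Real.norm_of_nonneg (by positivity)]
    at h1
  by_contra! h
  have := norm_nonneg u
  nlinarith

/-- On a function of the coordinates in `I`, a quadratic form is represented by a matrix of
bounded Frobenius norm. -/
lemma exists_frobenius_representative {d k n : ℕ} {I : Finset (Fin d)} (hI : I.card = k)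
    {g : Cube d → EuclideanSpace ℝ (Fin n)} (hg : DependsOnly I g)
    {P : Matrix (Fin n) (Fin n) ℝ} (hP : spNorm P ≤ 1) :
    ∃ w : EuclideanSpace ℝ (Fin n × Fin n), ‖w‖ ≤ 2 ^ k ∧
      ∀ x, inner ℝ w (outerBilin n (g x) (g x)) = formBilin P (g x) (g x) := by
  set W := Submodule.span ℝ (Set.range fun y : I → ℤˣ => g (extend I y))
  have hfr : Module.finrank ℝ W ≤ 2 ^ k := by
    refine (finrank_range_le_card _).trans ?_
    rw [card_restr hI]
  set b := stdOrthonormalBasis ℝ W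
  -- With an orthonormal basis `b` of the span of the values of `g`, the tensor `∑ b_a ⊗ Pᵀ b_a`
  -- represents the form on that span. It has at most `2 ^ k` terms of norm at most 1, because `g`
  -- takes at most `2 ^ k` values; this bound is independent of `n`.
  refine ⟨∑ a, outerBilin n (b a) (WithLp.toLp 2 (Pᵀ *ᵥ (b a : EuclideanSpace ℝ (Fin n)).ofLp)),
    ?_, fun x => ?_⟩
  · have h1 : ∀ a, ‖(b a : EuclideanSpace ℝ (Fin n))‖ = 1 := fun a => b.orthonormal.1 a
    calc _ ≤ ∑ a, ‖outerBilin n (b a)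
          (WithLp.toLp 2 (Pᵀ *ᵥ (b a : EuclideanSpace ℝ (Fin n)).ofLp))‖ := norm_sum_le _ _
      _ ≤ ∑ _a : Fin (Module.finrank ℝ W), (1 : ℝ) := by
          refine Finset.sum_le_sum fun a _ => ?_
          rw [norm_outerBilin, h1, one_mul]
          exact (norm_transpose_mulVec_le hP _).trans (h1 a).le
      _ ≤ 2 ^ k := by
          simp only [Finset.sum_const, Finset.card_univ, Fintype.card_fin, nsmul_eq_mul, mul_one]
          exact_mod_cast hfr
  · have hx : g x ∈ W := by
      rw [← hg.eq_extend x]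
      exact Submodule.subset_span ⟨_, rfl⟩
    have hsum : g x = ∑ a, inner ℝ (b a : EuclideanSpace ℝ (Fin n)) (g x) •
        (b a : EuclideanSpace ℝ (Fin n)) := by
      have := congrArg (fun v : W => (v : EuclideanSpace ℝ (Fin n))) (b.sum_repr' ⟨g x, hx⟩)
      simp only [Submodule.coe_sum, Submodule.coe_smul, Submodule.coe_inner] at this
      exact this.symm
    rw [sum_inner]
    conv_rhs => rw [show formBilin P (g x) (g x) = formBilin P (∑ a,
      inner ℝ (b a : EuclideanSpace ℝ (Fin n)) (g x) • (b a : EuclideanSpace ℝ (Fin n))) (g x) by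
        rw [← hsum]]
    rw [map_sum, LinearMap.sum_apply]
    refine Finset.sum_congr rfl fun a _ => ?_
    rw [inner_outerBilin, map_smul, LinearMap.smul_apply, formBilin_eq_inner, smul_eq_mul]

/-! ### The competitor of a layer -/

lemma norm_le_sum_abs {ι : Type} [Fintype ι] (v : ι → ℝ) :
    ‖(WithLp.toLp 2 v : EuclideanSpace ℝ ι)‖ ≤ ∑ i, |v i| := by
  have h0 : 0 ≤ ∑ i, |v i| := Finset.sum_nonneg fun i _ => abs_nonneg (v i)
  refine (sq_le_sq₀ (norm_nonneg _) h0).1 ?_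
  rw [norm_toLp_sq, sq (∑ i, |v i|), Finset.sum_mul]
  refine Finset.sum_le_sum fun i hi => ?_
  rw [← sq_abs, sq]
  exact mul_le_mul_of_nonneg_left
    (Finset.single_le_sum (f := fun i => |v i|) (fun i _ => abs_nonneg (v i)) hi) (abs_nonneg _)

lemma spNorm_le_sum_abs {n : ℕ} (A : Matrix (Fin n) (Fin n) ℝ) :
    spNorm A ≤ ∑ i, ∑ j, |A i j| := by
  refine ContinuousLinearMap.opNorm_le_bound _
    (Finset.sum_nonneg fun _ _ => Finset.sum_nonneg fun _ _ => abs_nonneg _) fun u => ?_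
  rw [← WithLp.toLp_ofLp (p := 2) u, Matrix.toEuclideanCLM_toLp, WithLp.toLp_ofLp, Finset.sum_mul]
  refine (norm_le_sum_abs _).trans (Finset.sum_le_sum fun i _ => ?_)
  rw [Finset.sum_mul]
  change |∑ j, A i j * u.ofLp j| ≤ _
  refine (Finset.abs_sum_le_sum_abs _ _).trans (Finset.sum_le_sum fun j _ => ?_)
  rw [abs_mul]
  exact mul_le_mul_of_nonneg_left (PiLp.norm_apply_le u j) (abs_nonneg _)

/-- A layer can compute any combination of products of linear functionals of its input. -/
lemma exists_competitor {ι : Type} [Fintype ι] {q : ℕ} (w : Fin q → EuclideanSpace ℝ ι)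
    (c : Fin q → Fin q → Fin q → ℝ) {S B M : ℝ} (hS : 0 < S)
    (hc : ∀ j, ∑ a, ∑ b, |c j a b| ≤ S) (hw : ∀ a, ‖w a‖ ≤ B) (hM : S * (q * B ^ 2) ≤ M) :
    ∃ (V : Matrix (Fin q) ι ℝ) (P : Fin q → Matrix (Fin q) (Fin q) ℝ), frSq V ≤ M ∧
      (∀ j, spNorm (P j) ≤ 1) ∧ (∀ j, (∀ a b, c j a b = 0) → P j = 0) ∧
      ∀ (u : EuclideanSpace ℝ ι) (j : Fin q), reduce P (expand V u.ofLp) j =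
        ∑ a, ∑ b, c j a b * (inner ℝ (w a) u * inner ℝ (w b) u) := by
  -- Row `a` of the extractor is `√S w_a`, and `P j = c_j / S`: the scale `S` moves from the
  -- coefficients, where it would violate the spectral constraint, into the width.
  refine ⟨Matrix.of fun a i => √S * (w a).ofLp i, fun j => Matrix.of fun a b => c j a b / S, ?_, fun j => ?_,
    fun j hj => ?_, fun u j => ?_⟩
  · refine le_trans ?_ hM
    have h1 : ∀ a, ∑ i, (√S * (w a).ofLp i) ^ 2 ≤ S * B ^ 2 := by
      intro a
      simp only [mul_pow, Real.sq_sqrt hS.le, ← Finset.mul_sum]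
      rw [← norm_toLp_sq, WithLp.toLp_ofLp]
      have := hw a
      gcongr
    refine (Finset.sum_le_sum fun a _ => h1 a).trans (le_of_eq ?_)
    simp
    ring
  · refine (spNorm_le_sum_abs _).trans ?_
    simp only [Matrix.of_apply, abs_div, abs_of_pos hS, ← Finset.sum_div]
    rw [div_le_one hS]
    exact hc j
  · ext a b
    simp [hj]
  · rw [reduce_expand]
    have h1 : ∀ a, (euclLin (Matrix.of fun a i => √S * (w a).ofLp i) u).ofLp a = √S * inner ℝ (w a) u := by
      intro a
      rw [EuclideanSpace.inner_eq_star_dotProduct]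
      simp [euclLin, Matrix.mulVec, dotProduct, Finset.mul_sum, mul_comm, mul_left_comm]
    simp only [formBilin, LinearMap.mk₂_apply, dotProduct, Matrix.mulVec, h1, Matrix.of_apply,
      Finset.mul_sum]
    refine Finset.sum_congr rfl fun a _ => Finset.sum_congr rfl fun b _ => ?_
    have h2 : √S * √S = S := Real.mul_self_sqrt hS.le
    have h3 : √S ≠ 0 := (Real.sqrt_pos.2 hS).ne'
    field_simp
    rw [sq, h2]
    ring

/-! ### From one layer to the next -/

section

variable {d k m : ℕ} {I : Finset (Fin d)}

lemma DependsOnly.comp {α β : Type} {φ : Cube d → α} (h : DependsOnly I φ) (f : α → β) :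
    DependsOnly I fun x => f (φ x) :=
  fun x x' hx => congrArg f (h x x' hx)

/-- A hypothesis of low degree has a small empirical correlation with a target of high degree. -/
lemma empMean_target_mul_le (hI : I.card = k) (hm : m ≠ 0) {f F₀ : Cube d → ℝ}
    {F₁ : Cube d → Fin d → ℝ} {R s' τ : ℝ} (hf : IsApprox I f F₀ F₁ R s') (hs' : s' ≤ 1)
    {s : Fin m → Cube d} (hs : IsRepresentative I s τ) (j : Fin (k / 2 + 1)) {D : ℕ}
    (hdeg : HasDegreeLE D f) (hD : D < 2 * (j : ℕ)) :
    empMean s (fun x => target k I x.toReal j * f x) ≤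
      2 ^ k * (2 ^ k * (R + 1)) * τ + 2 * 2 ^ k * s' := by
  set h : Cube d → ℝ := fun x => target k I x.toReal j with hh
  -- The product of the target with the first-order part of `f`; since the target depends only on
  -- the coordinates in `I`, `G` has the form controlled by a representative sample.
  set G : Cube d → ℝ := fun x => h x * F₀ x + ∑ i, x.toReal i * (h x * F₁ x i) with hG
  have hT : ∀ x, |h x| ≤ 2 ^ k := fun x => target_abs_le hI x j
  have hs0 := hf.nonneg
  have hdiff : ∀ x, |h x * f x - G x| ≤ 2 ^ k * s' := by
    intro x
    have e : h x * f x - G x = h x * (f x - F₀ x - ∑ i, x.toReal i • F₁ x i) := by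
      simp only [hG, smul_eq_mul, mul_sub, Finset.mul_sum, mul_left_comm]
      ring
    rw [e, abs_mul]
    exact mul_le_mul (hT x) (hf.approx x) (abs_nonneg _) (by positivity)
  have hdep : DependsOnly I h := target_dependsOnly.comp fun y => y j
  have hB : ∀ x, |h x * F₀ x| + ∑ i, |h x * F₁ x i| ≤ 2 ^ k * (R + 1) := by
    intro x
    have h1 : ∑ i, |F₁ x i| ≤ 1 := by
      have h2 := hf.norm_linear x
      have h3 : 0 ≤ ∑ i, |F₁ x i| := Finset.sum_nonneg fun _ _ => abs_nonneg _
      simp only [Real.norm_eq_abs] at h2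
      nlinarith
    have h2 : |F₀ x| ≤ R := hf.norm_base x
    simp only [abs_mul, ← Finset.mul_sum, ← mul_add]
    have h3 : 0 ≤ ∑ i, |F₁ x i| := Finset.sum_nonneg fun _ _ => abs_nonneg _
    exact mul_le_mul (hT x) (by linarith) (by positivity) (by positivity)
  have hdev := hs.abs_sub_le hI (φ₀ := fun x => h x * F₀ x) (φ₁ := fun x i => h x * F₁ x i)
    (fun x x' hx => by simp only [hdep x x' hx, hf.base x x' hx])
    (fun x x' hx => by simp only [hdep x x' hx, hf.linear x x' hx]) hB
  have h1 : empMean s (fun x => h x * f x) ≤ empMean s G + 2 ^ k * s' := by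
    rw [← empMean_const hm s (2 ^ k * s'), ← empMean_add]
    exact empMean_mono s fun x => by linarith [(abs_le.1 (hdiff x)).2]
  have h2 : avg G ≤ avg (fun x => h x * f x) + 2 ^ k * s' := by
    rw [← avg_const (d := d) (2 ^ k * s'), ← avg_add]
    exact avg_mono fun x => by linarith [(abs_le.1 (hdiff x)).1]
  rw [avg_target_mul_eq_zero hI j hD hdeg] at h2
  have h3 := (abs_le.1 hdev).2
  change empMean s G - avg G ≤ _ at h3
  linarith

lemma abs_sum_mul_sub_le {q N : ℕ} {c : Fin q → Fin q → ℝ} {S ω H : ℝ} {u h : Fin q → ℝ}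
    (hc : ∀ a b, c a b ≠ 0 → (a : ℕ) ≤ N ∧ (b : ℕ) ≤ N) (hS : ∑ a, ∑ b, |c a b| ≤ S)
    (hω : ∀ a : Fin q, (a : ℕ) ≤ N → |u a - h a| ≤ ω) (hω0 : 0 ≤ ω) (hH : ∀ a, |h a| ≤ H)
    (hH0 : 0 ≤ H) :
    |∑ a, ∑ b, c a b * (u a * u b) - ∑ a, ∑ b, c a b * (h a * h b)| ≤ S * (ω * (2 * H + ω)) := by
  simp only [← Finset.sum_sub_distrib, ← mul_sub]
  calc |∑ a, ∑ b, c a b * (u a * u b - h a * h b)|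
      ≤ ∑ a, ∑ b, |c a b| * (ω * (2 * H + ω)) := by
        refine (Finset.abs_sum_le_sum_abs _ _).trans (Finset.sum_le_sum fun a _ => ?_)
        refine (Finset.abs_sum_le_sum_abs _ _).trans (Finset.sum_le_sum fun b _ => ?_)
        rw [abs_mul]
        by_cases hab : c a b = 0
        · simp [hab]
        obtain ⟨ha, hb⟩ := hc a b hab
        refine mul_le_mul_of_nonneg_left ?_ (abs_nonneg _)
        have e : u a * u b - h a * h b =
            (u a - h a) * h b + h a * (u b - h b) + (u a - h a) * (u b - h b) := by ring
        rw [e]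
        have a1 := hω a ha
        have a2 := hω b hb
        calc _ ≤ |u a - h a| * |h b| + |h a| * |u b - h b| + |u a - h a| * |u b - h b| := by
              rw [← abs_mul, ← abs_mul, ← abs_mul]
              exact abs_add_three _ _ _
          _ ≤ ω * H + H * ω + ω * ω := by
              have := hH a
              have := hH b
              gcongr
          _ = ω * (2 * H + ω) := by ring
    _ = (∑ a, ∑ b, |c a b|) * (ω * (2 * H + ω)) := by simp only [Finset.sum_mul]
    _ ≤ S * (ω * (2 * H + ω)) := by gcongr

set_option maxHeartbeats 1000000 in
/-- If the input of a layer has a first-order expansion from which the targets of index at most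
`N` can be read off, then the output forms of the trained layer are close to the targets of index
at most `2 N`. -/
theorem layer_step {ι : Type} [Fintype ι] {n N : ℕ} (hI : I.card = k) {Q r s τ lam M : ℝ}
    {Ψ Ψ₀ : Cube d → EuclideanSpace ℝ ι} {Ψ₁ : Cube d → Fin d → EuclideanSpace ℝ ι}
    (hΨ : IsApprox I Ψ Ψ₀ Ψ₁ r s) (hdeg : ∀ p, HasDegreeLE (2 * N) fun x => (Ψ x).ofLp p)
    {w : Fin (k / 2 + 1) → EuclideanSpace ℝ ι}
    (hw : ∀ a, ‖w a‖ ≤ 2 ^ k) (hwt : ∀ a : Fin (k / 2 + 1), (a : ℕ) ≤ N →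
      ∀ x, (inner ℝ (w a) (Ψ₀ x) - target k I x.toReal a) ^ 2 ≤ s)
    {S : Fin m → Cube d} (hS : IsRepresentative I S τ)
    {V : Matrix (Fin n) ι ℝ} {P : Fin (k / 2 + 1) → Matrix (Fin n) (Fin n) ℝ}
    (hmin : IsLayerMinimizer squareLoss M lam
      (fun i => ((Ψ (S i)).ofLp, target k I (S i).toReal)) V P)
    (hm : k / 2 + 1 ≤ m) (hr : 1 ≤ r) (hM : 1 ≤ M)
    (hMw : (2 * ((k : ℝ) + 1)) ^ k * ((k / 2 + 1 : ℕ) * (2 ^ k) ^ 2) ≤ M)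
    (hlam : 0 ≤ lam) (hlams : lam ≤ s) (hτs : τ ≤ s) (hτ : τ ≤ ((2 : ℝ) ^ (k + 1))⁻¹)
    (hs' : 6 * M ^ 2 * r ^ 2 * s ≤ 1)
    (hQ1 : (2 : ℝ) ^ k ≤ Q) (hQ2 : (2 * ((k : ℝ) + 1)) ^ k ≤ Q) (hQ3 : M ≤ Q) (hQ4 : r ≤ Q)
    (hQ5 : ((k / 2 + 1 : ℕ) : ℝ) ≤ Q) (hQ6 : 2000 ≤ Q)
    (j : Fin (k / 2 + 1)) (hj : (j : ℕ) ≤ 2 * N) (x : Cube d) :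
    (formBilin (P j) (euclLin V (Ψ₀ x)) (euclLin V (Ψ₀ x)) - target k I x.toReal j) ^ 2 ≤
      Q ^ 9 * s := by
  classical
  have hs0 : 0 ≤ s := hΨ.nonneg
  have hMr : 1 ≤ M ^ 2 * r ^ 2 := by
    rw [← mul_pow]
    exact one_le_pow₀ (by nlinarith)
  have hs1 : s ≤ 1 := by nlinarith
  have hm0 : m ≠ 0 := by omega
  have hτ0 : 0 ≤ τ := (abs_nonneg _).trans (hS 1 none)
  set s' := 6 * M ^ 2 * r ^ 2 * s with hs'def
  have hs'0 : 0 ≤ s' := by positivity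
  have hs'Q : s' ≤ 6 * Q ^ 4 * s := by
    have : M ^ 2 * r ^ 2 ≤ Q ^ 2 * Q ^ 2 := by gcongr
    calc s' = 6 * (M ^ 2 * r ^ 2) * s := by rw [hs'def]; ring
      _ ≤ 6 * (Q ^ 2 * Q ^ 2) * s := by gcongr
      _ = 6 * Q ^ 4 * s := by ring
  have hfeas := hmin.1
  set B := fun j => (formBilin (P j)).compl₁₂ (euclLin V) (euclLin V) with hB
  have happ : ∀ j, IsApprox I (fun x => B j (Ψ x) (Ψ x)) (fun x => B j (Ψ₀ x) (Ψ₀ x))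
      (fun x i => B j (Ψ₀ x) (Ψ₁ x i) + B j (Ψ₁ x i) (Ψ₀ x)) (M * r ^ 2) s' :=
    fun j => hΨ.quadratic hs1 hr (B j) hM
      (norm_compl₁₂_le (norm_formBilin_le (hfeas.spectral j)) hfeas.width)
  have hred : ∀ j x, reduce P (expand V (Ψ x).ofLp) j = B j (Ψ x) (Ψ x) :=
    fun j x => reduce_expand P V (Ψ x) j
  have hdegB : ∀ j, HasDegreeLE (4 * N) fun x => B j (Ψ x) (Ψ x) := by
    intro j
    have hlin : ∀ a, HasDegreeLE (2 * N) fun x => (euclLin V (Ψ x)).ofLp a := fun a =>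
      HasDegreeLE.sum _ fun p _ => (hdeg p).const_mul (V a p)
    have e : (fun x => B j (Ψ x) (Ψ x)) = fun x => ∑ a, (euclLin V (Ψ x)).ofLp a *
        ∑ b, P j a b * (euclLin V (Ψ x)).ofLp b := rfl
    rw [e, show 4 * N = 2 * N + 2 * N by ring]
    exact HasDegreeLE.sum _ fun a _ => (hlin a).mul
      (HasDegreeLE.sum _ fun b _ => (hlin b).const_mul (P j a b))
  -- the competitor
  choose c0 hc1 hc2 hc3 using fun (j : Fin (k / 2 + 1)) (hj : (j : ℕ) ≤ 2 * N) =>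
    target_eq_sum_mul (I := I) N j hj
  -- For targets beyond the reach of the layer all coefficients are zero, so that `P' j = 0`, as the
  -- comparison with the minimizer requires.
  set c : Fin (k / 2 + 1) → Fin (k / 2 + 1) → Fin (k / 2 + 1) → ℝ := fun j a b =>
    if h : (j : ℕ) ≤ 2 * N then c0 j h a b else 0 with hc
  set Cb := (2 * ((k : ℝ) + 1)) ^ k with hCb
  have hCb0 : 0 < Cb := by positivity
  obtain ⟨V', P', hV', hP', hP0, heq⟩ := exists_competitor w c hCb0
    (fun j => by
      by_cases h : (j : ℕ) ≤ 2 * N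
      · simpa [hc, h] using hc2 j h
      · simp [hc, h, hCb0.le]) hw hMw
  set J : Finset (Fin (k / 2 + 1)) := Finset.univ.filter fun j => (j : ℕ) ≤ 2 * N with hJ
  have hcomp := hmin.empMean_le_of_eq_zero (d := d) (s := S) (Ψ := Ψ)
    (y := fun x => target k I x.toReal) hlam hm hV' hP' J
    (fun j hj => hP0 j fun a b => by
      have : ¬ (j : ℕ) ≤ 2 * N := by simpa [hJ] using hj
      simp [hc, this])
  -- accuracy of the competitor
  have hw' : ∀ a : Fin (k / 2 + 1), (a : ℕ) ≤ N → ∀ x,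
      |inner ℝ (w a) (Ψ x) - target k I x.toReal a| ≤ 3 * 2 ^ k * √s := by
    intro a ha x
    have h1 : |inner ℝ (w a) (Ψ x - Ψ₀ x)| ≤ 2 ^ k * (2 * √s) :=
      (abs_real_inner_le_norm _ _).trans
        (mul_le_mul (hw a) (hΨ.norm_sub_le hs1 x) (norm_nonneg _) (by positivity))
    have h2 : |inner ℝ (w a) (Ψ₀ x) - target k I x.toReal a| ≤ √s :=
      Real.abs_le_sqrt (hwt a ha x)
    rw [inner_sub_right] at h1
    have h3 := abs_sub_le (inner ℝ (w a) (Ψ x)) (inner ℝ (w a) (Ψ₀ x)) (target k I x.toReal a)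
    have h4 : √s ≤ 2 ^ k * √s :=
      le_mul_of_one_le_left (Real.sqrt_nonneg _) (one_le_pow₀ (by norm_num))
    linarith
  have hcompj : ∀ j ∈ J, ∀ x, (reduce P' (expand V' (Ψ x).ofLp) j - target k I x.toReal j) ^ 2 ≤
      225 * Q ^ 6 * s := by
    intro j hjJ x
    have hj : (j : ℕ) ≤ 2 * N := by simpa [hJ] using hjJ
    have hcj : c j = c0 j hj := by ext a b; simp [hc, hj]
    have h1 := abs_sum_mul_sub_le (hc1 j hj) (hc2 j hj) (fun a ha => hw' a ha x)
      (by positivity) (fun a => target_abs_le hI x a) (by positivity)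
    rw [← hc3 j hj, ← hcj, ← heq] at h1
    have hsq : √s ≤ 1 := Real.sqrt_le_one.2 hs1
    have h2 : Cb * (3 * 2 ^ k * √s * (2 * 2 ^ k + 3 * 2 ^ k * √s)) ≤ 15 * Q ^ 3 * √s := by
      calc Cb * (3 * 2 ^ k * √s * (2 * 2 ^ k + 3 * 2 ^ k * √s))
          ≤ Q * (3 * Q * √s * (2 * Q + 3 * Q * 1)) := by gcongr
        _ = 15 * Q ^ 3 * √s := by ring
    rw [← sq_abs]
    calc |reduce P' (expand V' (Ψ x).ofLp) j - target k I x.toReal j| ^ 2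
        ≤ (15 * Q ^ 3 * √s) ^ 2 := pow_le_pow_left₀ (abs_nonneg _) (h1.trans h2) 2
      _ = 225 * Q ^ 6 * s := by rw [mul_pow, Real.sq_sqrt hs0]; ring
  have hQ0 : 0 ≤ Q := by linarith
  have hsum1 : ∑ j ∈ J, empMean S
      (fun x => (reduce P' (expand V' (Ψ x).ofLp) j - target k I x.toReal j) ^ 2) ≤
      Q * (225 * Q ^ 6 * s) := by
    calc _ ≤ ∑ j ∈ J, 225 * Q ^ 6 * s := by
          refine Finset.sum_le_sum fun j hj => ?_
          rw [← empMean_const hm0 S (225 * Q ^ 6 * s)]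
          exact empMean_mono S (hcompj j hj)
      _ = (J.card : ℝ) * (225 * Q ^ 6 * s) := by simp
      _ ≤ Q * (225 * Q ^ 6 * s) := by
          gcongr
          refine le_trans ?_ hQ5
          exact_mod_cast (Finset.card_le_univ J).trans (by simp)
  have hrest : ∑ j ∈ Jᶜ, empMean S
      (fun x => target k I x.toReal j * reduce P (expand V (Ψ x).ofLp) j) ≤
      Q * (14 * Q ^ 5 * s) := by
    calc _ ≤ ∑ j ∈ Jᶜ, 14 * Q ^ 5 * s := by
          refine Finset.sum_le_sum fun j hj => ?_
          have hjN : ¬ (j : ℕ) ≤ 2 * N := by simpa [hJ] using hj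
          simp only [hred]
          refine (empMean_target_mul_le hI hm0 (happ j) hs' hS j (hdegB j) (by omega)).trans ?_
          have h1 : M * r ^ 2 + 1 ≤ 2 * Q ^ 3 := by
            have : M * r ^ 2 ≤ Q * Q ^ 2 := by gcongr
            nlinarith [pow_le_pow_left₀ (by norm_num) hQ6 3]
          have h2 : (2 : ℝ) ^ k * (2 ^ k * (M * r ^ 2 + 1)) * τ ≤ Q * (Q * (2 * Q ^ 3)) * s := by
            have : 0 ≤ M * r ^ 2 + 1 := by positivity
            gcongr
          have h3 : 2 * 2 ^ k * s' ≤ 2 * Q * (6 * Q ^ 4 * s) := by gcongr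
          nlinarith
      _ = ((Jᶜ).card : ℝ) * (14 * Q ^ 5 * s) := by simp
      _ ≤ Q * (14 * Q ^ 5 * s) := by
          gcongr
          refine le_trans ?_ hQ5
          exact_mod_cast (Finset.card_le_univ Jᶜ).trans (by simp)
  have hreg : lam * ((1 + (k / 2 + 1 : ℕ)) * M ^ 2) ≤ s * ((Q + Q) * Q ^ 2) := by
    have : (1 : ℝ) ≤ Q := by linarith
    gcongr
  have hemp : empMean S (fun x => (B j (Ψ x) (Ψ x) - target k I x.toReal j) ^ 2) ≤
      255 * Q ^ 7 * s := by
    have h1 : empMean S (fun x => (B j (Ψ x) (Ψ x) - target k I x.toReal j) ^ 2) ≤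
        ∑ j ∈ J, empMean S
          (fun x => (reduce P (expand V (Ψ x).ofLp) j - target k I x.toReal j) ^ 2) := by
      simp only [← hred]
      exact Finset.single_le_sum (f := fun j => empMean S
        (fun x => (reduce P (expand V (Ψ x).ofLp) j - target k I x.toReal j) ^ 2))
        (fun j _ => empMean_nonneg S fun x => sq_nonneg _) (by simpa [hJ] using hj)
    have h3 : s * ((Q + Q) * Q ^ 2) ≤ 2 * Q ^ 7 * s := by
      have : Q ^ 3 ≤ Q ^ 7 := pow_le_pow_right₀ (by linarith) (by norm_num)
      nlinarith
    have h4 : 2 * (Q * (14 * Q ^ 5 * s)) ≤ 28 * Q ^ 7 * s := by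
      have : Q ^ 6 ≤ Q ^ 7 := pow_le_pow_right₀ (by linarith) (by norm_num)
      nlinarith
    have h5 : Q * (225 * Q ^ 6 * s) = 225 * Q ^ 7 * s := by ring
    linarith
  -- passing to the expansion
  have hdiff : ∀ x, (B j (Ψ x) (Ψ x) - B j (Ψ₀ x) (Ψ₀ x)) ^ 2 ≤ 4 * s' := by
    intro x
    have h1 := (happ j).norm_sub_le hs' x
    rw [← sq_abs]
    calc _ ≤ (2 * √s') ^ 2 := pow_le_pow_left₀ (abs_nonneg _) h1 2
      _ = 4 * s' := by rw [mul_pow, Real.sq_sqrt hs'0]; norm_num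
  have hemp0 : empMean S (fun x => (B j (Ψ₀ x) (Ψ₀ x) - target k I x.toReal j) ^ 2) ≤
      558 * Q ^ 7 * s := by
    calc _ ≤ empMean S (fun x => 2 * (B j (Ψ x) (Ψ x) - target k I x.toReal j) ^ 2 + 8 * s') := by
          refine empMean_mono S fun x => ?_
          have h1 := hdiff x
          nlinarith [sq_nonneg (B j (Ψ x) (Ψ x) - target k I x.toReal j +
            (B j (Ψ x) (Ψ x) - B j (Ψ₀ x) (Ψ₀ x)))]
      _ = 2 * empMean S (fun x => (B j (Ψ x) (Ψ x) - target k I x.toReal j) ^ 2) + 8 * s' := by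
          rw [empMean_add, empMean_const_mul, empMean_const hm0]
      _ ≤ 2 * (255 * Q ^ 7 * s) + 8 * (6 * Q ^ 7 * s) := by
          have : Q ^ 4 ≤ Q ^ 7 := pow_le_pow_right₀ (by linarith) (by norm_num)
          have h2 : 6 * Q ^ 4 * s ≤ 6 * Q ^ 7 * s := by gcongr
          linarith
      _ = 558 * Q ^ 7 * s := by ring
  have hdep : DependsOnly I fun x => (B j (Ψ₀ x) (Ψ₀ x) - target k I x.toReal j) ^ 2 := by
    intro x x' hx
    have h1 := hΨ.base x x' hx
    have h2 : target k I x.toReal = target k I x'.toReal := target_dependsOnly x x' hx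
    simp only [h1, h2]
  -- The zeroth order part depends only on the coordinates in `I`, so its small empirical loss
  -- becomes a pointwise bound, at the price of `2 ^ (k + 1)`.
  refine (hS.le_of_empMean_le hI hτ hdep (fun x => sq_nonneg _) hemp0 x).trans ?_
  calc (2 : ℝ) ^ (k + 1) * (558 * Q ^ 7 * s) = 2 ^ k * (2 * (558 * Q ^ 7 * s)) := by
        rw [pow_succ]; ring
    _ ≤ Q * (2 * (558 * Q ^ 7 * s)) := by gcongr
    _ = 1116 * (Q ^ 8 * s) := by ring
    _ ≤ Q * (Q ^ 8 * s) := by gcongr; linarith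
    _ = Q ^ 9 * s := by ring

end

/-! ### Rigidity of the first layer -/

section Rigidity

variable {d k : ℕ} {E : Type} [NormedAddCommGroup E] [InnerProductSpace ℝ E]

/-- The deviation of `v i` from the mean of the `v j`, `j ∈ I`, for `i ∈ I`, and `v i` itself
otherwise. -/
def deviation (I : Finset (Fin d)) (v : Fin d → E) (i : Fin d) : E :=
  if i ∈ I then v i - (I.card : ℝ)⁻¹ • ∑ j ∈ I, v j else v i

/-- The decomposition of a second moment into the square of the mean and the variance, for an
arbitrary bilinear form. -/
lemma sum_form_deviation {I : Finset (Fin d)} (hI : I.card = k) (hk : k ≠ 0) (v : Fin d → E)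
    (F : E →ₗ[ℝ] E →ₗ[ℝ] ℝ) :
    ∑ i ∈ I, F (v i) (v i) = (k : ℝ)⁻¹ * F (∑ i ∈ I, v i) (∑ i ∈ I, v i) +
      ∑ i ∈ I, F (deviation I v i) (deviation I v i) := by
  have hk' : (k : ℝ) ≠ 0 := by exact_mod_cast hk
  have h : ∑ i ∈ I, F (deviation I v i) (deviation I v i) =
      ∑ i ∈ I, F (v i - (k : ℝ)⁻¹ • ∑ j ∈ I, v j) (v i - (k : ℝ)⁻¹ • ∑ j ∈ I, v j) :=
    Finset.sum_congr rfl fun i hi => by simp [deviation, hi, hI]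
  rw [h]
  set σ := ∑ j ∈ I, v j with hσ
  have h1 : ∑ i ∈ I, F (v i) σ = F σ σ := by
    rw [show F σ = ∑ i ∈ I, F (v i) by rw [hσ, map_sum], LinearMap.sum_apply]
  have h2 : ∑ i ∈ I, F σ (v i) = F σ σ := by
    rw [← map_sum]
  simp only [map_sub, LinearMap.sub_apply, map_smul, LinearMap.smul_apply, smul_eq_mul,
    Finset.sum_sub_distrib, ← Finset.mul_sum, h1, h2, Finset.sum_const, hI, nsmul_eq_mul]
  field_simp
  ring

/-- An extractor whose width is the optimal one and which nearly computes the first two targets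
nearly vanishes on the directions which are orthogonal to the constant and to the sum of the
relevant coordinates. -/
lemma sum_norm_deviation_le {I : Finset (Fin d)} (hI : I.card = k) (hk : 7 ≤ k) {v : Fin d → E}
    {v₀ : E} {F₀ F₁ : E →ₗ[ℝ] E →ₗ[ℝ] ℝ} (hF₀ : ∀ u w, |F₀ u w| ≤ ‖u‖ * ‖w‖)
    (hF₁ : ∀ u w, |F₁ u w| ≤ ‖u‖ * ‖w‖) {κ η : ℝ} (hη : 0 ≤ η)
    (hwidth : ‖v₀‖ ^ 2 + ∑ i, ‖v i‖ ^ 2 ≤ 1 / 2 + κ)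
    (h1 : κ * ((k : ℝ) - 1) - k * η ≤
      ∑ i ∈ I, ∑ j ∈ I, F₁ (v i) (v j) - ∑ i ∈ I, F₁ (v i) (v i))
    (h2 : ∑ i ∈ I, ∑ j ∈ I, F₀ (v i) (v j) - ∑ i ∈ I, F₀ (v i) (v i) ≤ k * η)
    (h3 : 1 - η ≤ 2 * F₀ v₀ v₀ + ∑ i, F₀ (v i) (v i)) :
    ∑ i, ‖deviation I v i‖ ^ 2 ≤ 9 * η := by
  have hk0 : k ≠ 0 := by omega
  have hk7 : (7 : ℝ) ≤ k := by exact_mod_cast hk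
  set σ := ∑ i ∈ I, v i with hσ
  set β := ∑ i ∈ I, ‖deviation I v i‖ ^ 2 with hβ
  set γ := ∑ i ∈ Iᶜ, ‖v i‖ ^ 2 with hγ
  set α := (k : ℝ)⁻¹ * ‖σ‖ ^ 2 with hα
  have hβ0 : 0 ≤ β := Finset.sum_nonneg fun _ _ => sq_nonneg _
  have hγ0 : 0 ≤ γ := Finset.sum_nonneg fun _ _ => sq_nonneg _
  have hgoal : ∑ i, ‖deviation I v i‖ ^ 2 = β + γ := by
    rw [← Finset.sum_add_sum_compl I]
    congr 1
    exact Finset.sum_congr rfl fun i hi => by simp [deviation, Finset.mem_compl.1 hi]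
  have hinner : ∑ i ∈ I, ‖v i‖ ^ 2 = α + β := by
    have := sum_form_deviation hI hk0 v (innerₗ E)
    simpa only [innerₗ_apply_apply, real_inner_self_eq_norm_sq] using this
  have hsplit : ∑ i, ‖v i‖ ^ 2 = α + β + γ := by
    rw [← Finset.sum_add_sum_compl I, hinner]
  have hdouble : ∀ F : E →ₗ[ℝ] E →ₗ[ℝ] ℝ, ∑ i ∈ I, ∑ j ∈ I, F (v i) (v j) = F σ σ := by
    intro F
    rw [show F σ = ∑ i ∈ I, F (v i) by rw [hσ, map_sum], LinearMap.sum_apply]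
    exact Finset.sum_congr rfl fun i _ => by rw [hσ, map_sum]
  have hdev : ∀ F : E →ₗ[ℝ] E →ₗ[ℝ] ℝ, (∀ u w, |F u w| ≤ ‖u‖ * ‖w‖) →
      |∑ i ∈ I, F (deviation I v i) (deviation I v i)| ≤ β := fun F hF =>
    (Finset.abs_sum_le_sum_abs _ _).trans (Finset.sum_le_sum fun i _ => by
      rw [sq]; exact hF _ _)
  have e1 := sum_form_deviation hI hk0 v F₁
  have e0 := sum_form_deviation hI hk0 v F₀
  rw [← hσ] at e0 e1
  rw [hdouble] at h1 h2
  have d1 := abs_le.1 (hdev F₁ hF₁)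
  have d0 := abs_le.1 (hdev F₀ hF₀)
  have hα1 : F₁ σ σ ≤ k * α := by
    have := (abs_le.1 (hF₁ σ σ)).2
    rw [hα, ← mul_assoc, mul_inv_cancel₀ (by positivity), one_mul, sq]
    exact this
  set t1 := ∑ i ∈ I, F₁ (deviation I v i) (deviation I v i)
  set t0 := ∑ i ∈ I, F₀ (deviation I v i) (deviation I v i)
  have hki : (k : ℝ)⁻¹ * k = 1 := inv_mul_cancel₀ (by positivity)
  have hout : ∑ i ∈ Iᶜ, F₀ (v i) (v i) ≤ γ :=
    Finset.sum_le_sum fun i _ => by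
      rw [sq]; exact (abs_le.1 (hF₀ _ _)).2
  have hv0 : F₀ v₀ v₀ ≤ ‖v₀‖ ^ 2 := by rw [sq]; exact (abs_le.1 (hF₀ _ _)).2
  rw [← Finset.sum_add_sum_compl I] at h3
  set a1 := F₁ σ σ
  set a0 := F₀ σ σ
  set b1 := (k : ℝ)⁻¹ * a1 with hb1
  set b0 := (k : ℝ)⁻¹ * a0 with hb0
  have ha1 : a1 = k * b1 := by rw [hb1, ← mul_assoc, mul_comm (k : ℝ), hki, one_mul]
  have ha0 : a0 = k * b0 := by rw [hb0, ← mul_assoc, mul_comm (k : ℝ), hki, one_mul]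
  have hb1α : b1 ≤ α := by
    rw [ha1] at hα1
    exact le_of_mul_le_mul_left hα1 (by linarith)
  -- the lower bound for `α`
  have hA : κ - 7 / 6 * η - β / 6 ≤ α := by
    have h4 : κ * ((k : ℝ) - 1) - k * η ≤ ((k : ℝ) - 1) * α + β := by
      rw [e1, ha1] at h1
      nlinarith [mul_le_mul_of_nonneg_left hb1α (show (0 : ℝ) ≤ (k : ℝ) - 1 by linarith)]
    by_contra! hlt
    nlinarith [mul_lt_mul_of_pos_left hlt (show (0 : ℝ) < (k : ℝ) - 1 by linarith)]
  -- Here `b0 + t0` is the contribution of the coordinates in `I` to the constant coefficient of the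
  -- first form. As its coefficient at the second elementary symmetric function is at most about
  -- zero, `b0` is at most about `t0 / (k - 1)`; so the constant 1 must come from `v₀` and from
  -- coordinates outside `I`. The factor `7 / 6` is `k / (k - 1)` at `k = 7`.
  have hB : b0 + t0 ≤ 7 / 6 * (β + η) := by
    have h4 : ((k : ℝ) - 1) * b0 ≤ t0 + k * η := by
      rw [e0, ha0] at h2
      linarith
    by_contra! hlt
    nlinarith [mul_lt_mul_of_pos_left hlt (show (0 : ℝ) < (k : ℝ) - 1 by linarith)]
  -- Now `‖v₀‖² ≥ 1/2 - (13/12) η - (7/12) β - γ/2` and `α ≥ κ - (7/6) η - β/6`. Inserted into the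
  -- width bound `‖v₀‖² + α + β + γ ≤ 1/2 + κ`, these leave `β/4 + γ/2 ≤ (9/4) η`.
  rw [hgoal]
  rw [hsplit] at hwidth
  rw [e0] at h3
  linarith

end Rigidity

/-! ### Fourier coefficients of quadratic forms -/

section Fourier

variable {d k : ℕ}

lemma avg_prod_mul_prod (S T : Finset (Fin d)) :
    avg (fun x : Cube d => (∏ a ∈ S, x.toReal a) * ∏ a ∈ T, x.toReal a) =
      if S = T then 1 else 0 := by
  split_ifs with h
  · subst h
    rw [← avg_const (d := d) 1]
    congr 1
    ext x
    rw [← Finset.prod_mul_distrib]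
    exact Finset.prod_eq_one fun a _ => x.toReal_mul_self a
  · obtain ⟨i, hi⟩ : ∃ i, (i ∈ S ∧ i ∉ T) ∨ (i ∈ T ∧ i ∉ S) := by
      by_contra! hne
      exact h (Finset.ext fun i => ⟨(hne i).1, (hne i).2⟩)
    have hmem : ∀ (U : Finset (Fin d)), i ∈ U → ∀ x : Cube d,
        ∏ a ∈ U, (flipAt i x).toReal a = -∏ a ∈ U, x.toReal a := by
      intro U hU x
      rw [← Finset.mul_prod_erase _ _ hU, ← Finset.mul_prod_erase _ _ hU, flipAt_toReal_self,
        neg_mul]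
      congr 2
      exact Finset.prod_congr rfl fun a ha => flipAt_toReal_of_ne (Finset.ne_of_mem_erase ha) x
    have hnot : ∀ (U : Finset (Fin d)), i ∉ U → ∀ x : Cube d,
        ∏ a ∈ U, (flipAt i x).toReal a = ∏ a ∈ U, x.toReal a := fun U hU x =>
      Finset.prod_congr rfl fun a ha =>
        flipAt_toReal_of_ne (ne_of_mem_of_not_mem ha hU) x
    refine avg_eq_zero_of_flip i fun x => ?_
    rcases hi with ⟨h1, h2⟩ | ⟨h1, h2⟩
    · rw [hmem S h1, hnot T h2, neg_mul]
    · rw [hmem T h1, hnot S h2, mul_neg]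

lemma avg_prod_mul_elemSym (S I : Finset (Fin d)) (i : ℕ) :
    avg (fun x : Cube d => (∏ a ∈ S, x.toReal a) * elemSym I i x.toReal) =
      if S ∈ I.powersetCard i then 1 else 0 := by
  simp only [elemSym, Finset.mul_sum]
  rw [avg_sum]
  simp [avg_prod_mul_prod]

/-- The quadratic form `W` at `(√2, x)`. -/
def quadForm (W : Matrix (Fin (d + 1)) (Fin (d + 1)) ℝ) (x : Fin d → ℝ) : ℝ :=
  ∑ a, ∑ b, W a b * ((Fin.cons (√2) x : Fin (d + 1) → ℝ) a * (Fin.cons (√2) x : _ → ℝ) b)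

lemma quadForm_eq (W : Matrix (Fin (d + 1)) (Fin (d + 1)) ℝ) (x : Fin d → ℝ) :
    quadForm W x = 2 * W 0 0 + ∑ i : Fin d, √2 * (W 0 i.succ + W i.succ 0) * x i +
      ∑ i : Fin d, ∑ j : Fin d, W i.succ j.succ * (x i * x j) := by
  have h2 : √(2 : ℝ) * √2 = 2 := Real.mul_self_sqrt (by norm_num)
  simp only [quadForm, Fin.sum_univ_succ, Fin.cons_zero, Fin.cons_succ, h2,
    Finset.sum_add_distrib, mul_add, add_mul]
  have h3 : ∑ i : Fin d, W 0 i.succ * (√2 * x i) = ∑ i : Fin d, √2 * W 0 i.succ * x i :=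
    Finset.sum_congr rfl fun i _ => by ring
  have h4 : ∑ i : Fin d, W i.succ 0 * (x i * √2) = ∑ i : Fin d, √2 * W i.succ 0 * x i :=
    Finset.sum_congr rfl fun i _ => by ring
  rw [h3, h4]
  ring

lemma avg_quadForm_mul (W : Matrix (Fin (d + 1)) (Fin (d + 1)) ℝ) (φ : Cube d → ℝ) :
    avg (fun x => quadForm W x.toReal * φ x) = 2 * W 0 0 * avg φ +
      ∑ i : Fin d, √2 * (W 0 i.succ + W i.succ 0) * avg (fun x => x.toReal i * φ x) +
      ∑ i : Fin d, ∑ j : Fin d,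
        W i.succ j.succ * avg (fun x => x.toReal i * x.toReal j * φ x) := by
  simp only [quadForm_eq, add_mul, Finset.sum_mul]
  rw [avg_add, avg_add, avg_sum, avg_sum, avg_const_mul]
  congr 1
  · congr 1
    refine Finset.sum_congr rfl fun i _ => ?_
    rw [← avg_const_mul]
    congr 1; ext x; ring
  · refine Finset.sum_congr rfl fun i _ => ?_
    rw [avg_sum]
    refine Finset.sum_congr rfl fun j _ => ?_
    rw [← avg_const_mul]
    congr 1; ext x; ring

lemma coord_mul_coord {i j : Fin d} (x : Cube d) :
    x.toReal i * x.toReal j = ∏ a ∈ (if i = j then ∅ else {i, j} : Finset (Fin d)), x.toReal a := by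
  split_ifs with h
  · subst h; simp [x.toReal_mul_self]
  · rw [Finset.prod_pair h]

/-- The constant Fourier coefficient: only the squares contribute, and the factor 2 is the square of
the constant input `√2`. -/
lemma avg_quadForm (W : Matrix (Fin (d + 1)) (Fin (d + 1)) ℝ) :
    avg (fun x : Cube d => quadForm W x.toReal) = 2 * W 0 0 + ∑ i : Fin d, W i.succ i.succ := by
  have h := avg_quadForm_mul W (fun _ => ∏ a ∈ (∅ : Finset (Fin d)), (Cube.toReal (d := d) 1) a)
  have h1 : ∀ i : Fin d, avg (fun x : Cube d => x.toReal i) = 0 := fun i => by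
    have := avg_prod_mul_prod {i} (∅ : Finset (Fin d))
    simpa using this
  have h2 : ∀ i j : Fin d, avg (fun x : Cube d => x.toReal i * x.toReal j) =
      if i = j then 1 else 0 := fun i j => by
    have := avg_prod_mul_prod {i} ({j} : Finset (Fin d))
    simpa using this
  simpa [h1, h2, avg_const] using h

/-- Only the off-diagonal entries with both indices in `I` correlate with the second elementary
symmetric function. With `avg_quadForm` this supplies the linear information on which
`sum_norm_deviation_le` rests. -/
lemma avg_quadForm_mul_elemSym (W : Matrix (Fin (d + 1)) (Fin (d + 1)) ℝ) (I : Finset (Fin d)) :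
    avg (fun x : Cube d => quadForm W x.toReal * elemSym I 2 x.toReal) =
      ∑ i ∈ I, ∑ j ∈ I, W i.succ j.succ - ∑ i ∈ I, W i.succ i.succ := by
  rw [avg_quadForm_mul]
  have h0 : avg (fun x : Cube d => elemSym I 2 x.toReal) = 0 := by
    have := avg_prod_mul_elemSym ∅ I 2
    simpa using this
  have h1 : ∀ i : Fin d, avg (fun x : Cube d => x.toReal i * elemSym I 2 x.toReal) = 0 := by
    intro i
    have := avg_prod_mul_elemSym {i} I 2
    simpa using this
  have h2 : ∀ i j : Fin d, avg (fun x : Cube d => x.toReal i * x.toReal j *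
      elemSym I 2 x.toReal) = if i ≠ j ∧ i ∈ I ∧ j ∈ I then 1 else 0 := by
    intro i j
    simp only [coord_mul_coord, avg_prod_mul_elemSym]
    congr 1
    by_cases h : i = j
    · simp [h]
    · simp [h, Finset.mem_powersetCard, Finset.insert_subset_iff, Finset.card_pair h]
  simp only [h0, h1, h2, mul_zero, Finset.sum_const_zero, zero_add, mul_ite, mul_one]
  rw [← Finset.sum_sub_distrib, ← Finset.sum_subset (Finset.subset_univ I)
    (fun i _ hi => by simp [hi])]
  refine Finset.sum_congr rfl fun i hi => ?_
  rw [← Finset.sum_subset (Finset.subset_univ I) (fun j _ hj => by simp [hj]),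
    ← Finset.add_sum_erase _ _ hi, ← Finset.add_sum_erase I _ hi]
  simp only [ne_eq, not_true_eq_false, false_and, if_false, zero_add, add_sub_cancel_left]
  refine Finset.sum_congr rfl fun j hj => ?_
  rw [if_pos ⟨(Finset.ne_of_mem_erase hj).symm, hi, Finset.mem_of_mem_erase hj⟩]

lemma avg_elemSym_two_sq (I : Finset (Fin d)) :
    avg (fun x : Cube d => elemSym I 2 x.toReal ^ 2) = I.card.choose 2 := by
  have h : ∀ x : Cube d, elemSym I 2 x.toReal ^ 2 = ∑ S ∈ I.powersetCard 2,
      (∏ a ∈ S, x.toReal a) * elemSym I 2 x.toReal := by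
    intro x
    rw [← Finset.sum_mul, sq]
    rfl
  simp only [h]
  rw [avg_sum]
  simp only [avg_prod_mul_elemSym, Finset.sum_ite_mem, Finset.inter_self, Finset.sum_const,
    Finset.card_powersetCard, nsmul_eq_mul, mul_one]

end Fourier

/-! ### The first layer -/

section

variable {d k m : ℕ} {I : Finset (Fin d)}

/-- The input `(√2, x)` of the first layer. -/
def inputVec (x : Cube d) : EuclideanSpace ℝ (Fin (d + 1)) :=
  WithLp.toLp 2 (Fin.cons (√2) x.toReal)

/-- The products of two coordinates of the input, and the coordinates of the target. -/
def momentVec (k : ℕ) (I : Finset (Fin d)) (x : Cube d) :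
    (Fin (d + 1) × Fin (d + 1)) ⊕ Fin (k / 2 + 1) → ℝ :=
  Sum.elim (fun p => (inputVec x).ofLp p.1 * (inputVec x).ofLp p.2) (target k I x.toReal)

/-- The empirical second moments of `momentVec` are `τ`-close to the true ones. -/
def HasGoodMoments (k : ℕ) (I : Finset (Fin d)) (s : Fin m → Cube d) (τ : ℝ) : Prop :=
  ∑ p, ∑ p', (empMean s (fun x => momentVec k I x p * momentVec k I x p') -
    avg (fun x => momentVec k I x p * momentVec k I x p')) ^ 2 ≤ τ ^ 2

/-- The deviation is a bilinear form in the coefficient vectors `Z` and `Z'`, whose matrix has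
Frobenius norm at most `τ`; Cauchy–Schwarz makes the bound uniform over all hypotheses of bounded
Frobenius norm. -/
lemma HasGoodMoments.abs_sub_le {s : Fin m → Cube d} {τ : ℝ} (hs : HasGoodMoments k I s τ)
    (hτ : 0 ≤ τ) {Z Z' : (Fin (d + 1) × Fin (d + 1)) ⊕ Fin (k / 2 + 1) → ℝ} {A : ℝ}
    (hZ : ∑ p, Z p ^ 2 ≤ A) (hZ' : ∑ p, Z' p ^ 2 ≤ A) :
    |empMean s (fun x => (∑ p, Z p * momentVec k I x p) * ∑ p, Z' p * momentVec k I x p) -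
      avg (fun x => (∑ p, Z p * momentVec k I x p) * ∑ p, Z' p * momentVec k I x p)| ≤ A * τ := by
  have hA : 0 ≤ A := (Finset.sum_nonneg fun _ _ => sq_nonneg _).trans hZ
  set Δ : _ → _ → ℝ := fun p p' => empMean s (fun x => momentVec k I x p * momentVec k I x p') -
    avg (fun x => momentVec k I x p * momentVec k I x p') with hΔ
  have hexp : (fun x : Cube d => (∑ p, Z p * momentVec k I x p) *
      ∑ p, Z' p * momentVec k I x p) = fun x => ∑ pp : ((Fin (d + 1) × Fin (d + 1)) ⊕
        Fin (k / 2 + 1)) × ((Fin (d + 1) × Fin (d + 1)) ⊕ Fin (k / 2 + 1)),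
        Z pp.1 * Z' pp.2 * (momentVec k I x pp.1 * momentVec k I x pp.2) := by
    ext x
    rw [Finset.sum_mul_sum, Fintype.sum_prod_type]
    exact Finset.sum_congr rfl fun p _ => Finset.sum_congr rfl fun p' _ => by ring
  rw [hexp, empMean_sum, avg_sum, ← Finset.sum_sub_distrib]
  simp only [empMean_const_mul, avg_const_mul, ← mul_sub]
  refine abs_le_of_sq_le_sq ?_ (by positivity)
  refine (Finset.sum_mul_sq_le_sq_mul_sq _ _ _).trans ?_
  rw [mul_pow, Fintype.sum_prod_type, Fintype.sum_prod_type]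
  refine mul_le_mul ?_ hs (Finset.sum_nonneg fun _ _ => Finset.sum_nonneg fun _ _ => sq_nonneg _)
    (by positivity)
  simp only [mul_pow]
  rw [← Finset.sum_mul_sum, sq]
  exact mul_le_mul hZ hZ' (Finset.sum_nonneg fun _ _ => sq_nonneg _) hA

lemma quadForm_eq_formBilin {n : ℕ} (V : Matrix (Fin n) (Fin (d + 1)) ℝ)
    (P : Matrix (Fin n) (Fin n) ℝ) (x : Cube d) :
    quadForm (Vᵀ * P * V) x.toReal =
      formBilin P (euclLin V (inputVec x)) (euclLin V (inputVec x)) := by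
  set u : Fin (d + 1) → ℝ := Fin.cons (√2) x.toReal with hu
  have h1 : quadForm (Vᵀ * P * V) x.toReal = u ⬝ᵥ ((Vᵀ * P * V) *ᵥ u) := by
    simp only [quadForm, dotProduct, Matrix.mulVec, Finset.mul_sum]
    exact Finset.sum_congr rfl fun a _ => Finset.sum_congr rfl fun b _ => by rw [← hu]; ring
  have h2 : formBilin P (euclLin V (inputVec x)) (euclLin V (inputVec x)) =
      (V *ᵥ u) ⬝ᵥ (P *ᵥ (V *ᵥ u)) := rfl
  rw [h1, h2, ← Matrix.mulVec_mulVec, ← Matrix.mulVec_mulVec, Matrix.dotProduct_mulVec,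
    Matrix.vecMul_transpose]

/-- The trace norm of the relevant part of the second target. -/
def traceBudget (k : ℕ) : ℝ := 1 / √(2 - 2 / (k : ℝ))

/-- With `D = √C(k, 2)` this says that the budget is `k / (2 D)`: the second target `(x(I)² - k) /
(2 D)` contains the form `x(I)² / (2 D)`, of rank one and trace norm `k / (2 D)`. -/
lemma traceBudget_mul (hk : 2 ≤ k) : traceBudget k * (2 * √(k.choose 2 : ℝ)) = k := by
  have hk2 : (2 : ℝ) ≤ k := by exact_mod_cast hk
  have hk0 : (0 : ℝ) < k := by linarith
  have h1 : (k.choose 2 : ℝ) = k * (k - 1) / 2 := Nat.cast_choose_two ℝ k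
  have h2 : (0 : ℝ) < 2 - 2 / (k : ℝ) := by
    rw [sub_pos, div_lt_iff₀ hk0]; linarith
  have h3 : 2 * √(k.choose 2 : ℝ) = k * √(2 - 2 / (k : ℝ)) := by
    nth_rewrite 1 [show (2 : ℝ) = √(2 ^ 2) by rw [Real.sqrt_sq (by norm_num)]]
    rw [show (k : ℝ) * √(2 - 2 / (k : ℝ)) = √((k : ℝ) ^ 2) * √(2 - 2 / (k : ℝ)) by
      rw [Real.sqrt_sq hk0.le], ← Real.sqrt_mul (by positivity), ← Real.sqrt_mul (by positivity),
      h1]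
    congr 1
    field_simp
  rw [h3, traceBudget]
  have := Real.sqrt_ne_zero'.2 h2
  rw [mul_comm (k : ℝ), ← mul_assoc, one_div_mul_cancel this, one_mul]

lemma traceBudget_nonneg (k : ℕ) : 0 ≤ traceBudget k := by
  unfold traceBudget; positivity

lemma traceBudget_le_one (hk : 2 ≤ k) : traceBudget k ≤ 1 := by
  have hk2 : (2 : ℝ) ≤ k := by exact_mod_cast hk
  have : 2 / (k : ℝ) ≤ 1 := by rw [div_le_one (by linarith)]; exact hk2
  rw [traceBudget, div_le_one (Real.sqrt_pos.2 (by linarith)), Real.one_le_sqrt]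
  linarith

/-- The right side is the correlation of the second target with the second elementary symmetric
function. It thus equals the largest value attainable with a multiple of `x(I)²` of trace norm
`traceBudget k`, which is why the width has no slack. -/
lemma traceBudget_mul_sub_one (hk : 2 ≤ k) :
    traceBudget k * ((k : ℝ) - 1) = √(k.choose 2 : ℝ) := by
  have h := traceBudget_mul hk
  have hpos : 0 < √(k.choose 2 : ℝ) := Real.sqrt_pos.2 (by exact_mod_cast Nat.choose_pos hk)
  have hsq : √(k.choose 2 : ℝ) ^ 2 = k * (k - 1) / 2 := by
    rw [Real.sq_sqrt (by positivity), Nat.cast_choose_two]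
  have : traceBudget k * ((k : ℝ) - 1) * √(k.choose 2 : ℝ) =
      √(k.choose 2 : ℝ) * √(k.choose 2 : ℝ) := by
    rw [← sq, hsq]
    linear_combination ((k : ℝ) - 1) / 2 * h
  exact mul_right_cancel₀ hpos.ne' this

lemma target_zero (x : Fin d → ℝ) : target k I x ⟨0, by omega⟩ = 1 := by
  simp [target, kravchuk]

lemma target_one (hI : I.card = k) (hk : 2 ≤ k) (x : Cube d) :
    target k I x.toReal ⟨1, by omega⟩ = (√(k.choose 2 : ℝ))⁻¹ * elemSym I 2 x.toReal :=
  target_eq_elemSym hI x ⟨1, by omega⟩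

lemma two_mul_elemSym_two (x : Cube d) :
    2 * elemSym I 2 x.toReal = (∑ i ∈ I, x.toReal i) ^ 2 - I.card := by
  have := elemSym_succ_succ I x 0
  simp only [elemSym_zero, elemSym_one, Nat.cast_zero, zero_add] at this
  rw [this]; ring

lemma spNorm_diagonal_le {n : ℕ} {v : Fin n → ℝ} (hv : ∀ i, |v i| ≤ 1) :
    spNorm (Matrix.diagonal v) ≤ 1 := by
  refine ContinuousLinearMap.opNorm_le_bound _ zero_le_one fun u => ?_
  rw [← WithLp.toLp_ofLp (p := 2) u, Matrix.toEuclideanCLM_toLp, one_mul]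
  refine (sq_le_sq₀ (norm_nonneg _) (norm_nonneg _)).1 ?_
  rw [norm_toLp_sq, norm_toLp_sq]
  refine Finset.sum_le_sum fun i _ => ?_
  rw [Matrix.mulVec_diagonal, mul_pow]
  have := (sq_le_one_iff_abs_le_one (v i)).2 (hv i)
  nlinarith [sq_nonneg (u.ofLp i)]

/-- The first layer can compute the first two targets. -/
lemma exists_first_competitor (hI : I.card = k) (hk : 2 ≤ k) :
    ∃ (V : Matrix (Fin 2) (Fin (d + 1)) ℝ) (P : Fin (k / 2 + 1) → Matrix (Fin 2) (Fin 2) ℝ),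
      frSq V ≤ 1 / 2 + traceBudget k ∧ (∀ j, spNorm (P j) ≤ 1) ∧
      (∀ j : Fin (k / 2 + 1), ¬ (j : ℕ) ≤ 1 → P j = 0) ∧
      ∀ (j : Fin (k / 2 + 1)), (j : ℕ) ≤ 1 → ∀ x : Cube d,
        reduce P (expand V (inputVec x).ofLp) j = target k I x.toReal j := by
  have hk0 : (0 : ℝ) < k := by exact_mod_cast (show 0 < k by omega)
  set κ := traceBudget k with hκ
  have hκ0 : 0 ≤ κ := traceBudget_nonneg k
  have hκ1 : κ ≤ 1 := traceBudget_le_one hk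
  set D := √(k.choose 2 : ℝ) with hD
  have hDpos : 0 < D := Real.sqrt_pos.2 (by exact_mod_cast Nat.choose_pos hk)
  have hκD : κ * (2 * D) = k := traceBudget_mul hk
  have hs2 : (√2)⁻¹ ^ 2 = (1 / 2 : ℝ) := by rw [inv_pow, Real.sq_sqrt (by norm_num)]; norm_num
  have hsκ : √(κ / k) ^ 2 = κ / k := Real.sq_sqrt (by positivity)
  -- The rows compute `1` and `√(κ / k) x(I)`, at a width of `1/2` and `κ`. The first target is the
  -- square of the former; the second is `(κ / k) x(I)² - κ`, because `κ / k = 1 / (2 D)`.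
  set V : Matrix (Fin 2) (Fin (d + 1)) ℝ :=
    Matrix.of ![Fin.cons (√2)⁻¹ 0, Fin.cons 0 fun i => if i ∈ I then √(κ / k) else 0] with hV
  have hg0 : ∀ x : Cube d, (euclLin V (inputVec x)).ofLp 0 = 1 := by
    intro x
    have : √(2 : ℝ) ≠ 0 := by simp
    simp [euclLin, inputVec, hV, dotProduct, Fin.sum_univ_succ, this]
  have hg1 : ∀ x : Cube d, (euclLin V (inputVec x)).ofLp 1 =
      √(κ / k) * ∑ i ∈ I, x.toReal i := by
    intro x
    simp [euclLin, inputVec, hV, dotProduct, Fin.sum_univ_succ, Finset.mul_sum]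
  refine ⟨V, fun j => if (j : ℕ) = 0 then Matrix.diagonal ![1, 0] else if (j : ℕ) = 1 then
    Matrix.diagonal ![-κ, 1] else 0, ?_, fun j => ?_, fun j hj => ?_, fun j hj x => ?_⟩
  · simp only [frSq, hV, Fin.sum_univ_two, Fin.sum_univ_succ (n := d), Matrix.of_apply,
      Matrix.cons_val_zero, Matrix.cons_val_one, Fin.cons_zero, Fin.cons_succ, hs2, ite_pow, hsκ]
    simp [hI]
    field_simp
    rfl
  · dsimp only
    split_ifs
    · exact spNorm_diagonal_le fun i => by fin_cases i <;> simp
    · exact spNorm_diagonal_le fun i => by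
        fin_cases i <;> simp [abs_of_nonneg hκ0, hκ1]
    · rw [spNorm_zero]; exact zero_le_one
  · simp only [if_neg (show ¬ (j : ℕ) = 0 by omega), if_neg (show ¬ (j : ℕ) = 1 by omega)]
  · rw [reduce_expand]
    simp only [formBilin, LinearMap.mk₂_apply, dotProduct, Fin.sum_univ_two]
    obtain ⟨j, hjk⟩ := j
    simp only at hj
    interval_cases j
    · rw [target_zero]
      simp [Matrix.mulVec_diagonal, hg0]
    · rw [target_one hI hk]
      simp only [if_neg one_ne_zero, if_true, Matrix.mulVec_diagonal, hg0, hg1,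
        Matrix.cons_val_zero, Matrix.cons_val_one]
      have h2 := two_mul_elemSym_two (I := I) x
      rw [hI] at h2
      set z := ∑ i ∈ I, x.toReal i
      have h3 : elemSym I 2 x.toReal = (z ^ 2 - k) / 2 := by linarith
      have h4 : κ = k / (2 * D) := by field_simp; linarith
      rw [h3, show 1 * (-κ * 1) + √(κ / k) * z * (1 * (√(κ / k) * z)) =
        -κ + √(κ / k) ^ 2 * z ^ 2 by ring, hsκ, h4, ← hD]
      field_simp
      ring

/-- The outputs of the trained first layer are close in mean square to the first two targets. -/
lemma first_layer_avg_le {n : ℕ} (hI : I.card = k) (hk : 2 ≤ k) {s : Fin m → Cube d} {τ lam : ℝ}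
    (hs : HasGoodMoments k I s τ) (hτ : 0 ≤ τ) (hlam : 0 ≤ lam)
    {V : Matrix (Fin n) (Fin (d + 1)) ℝ} {P : Fin (k / 2 + 1) → Matrix (Fin n) (Fin n) ℝ}
    (hmin : IsLayerMinimizer squareLoss (1 / 2 + traceBudget k) lam
      (fun i => ((inputVec (s i)).ofLp, target k I (s i).toReal)) V P) (hm : 2 ≤ m)
    (j : Fin (k / 2 + 1)) (hj : (j : ℕ) ≤ 1) :
    avg (fun x => (quadForm (Vᵀ * P j * V) x.toReal - target k I x.toReal j) ^ 2) ≤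
      12 * ((k / 2 + 1 : ℕ) + 1) * (lam + τ) := by
  classical
  obtain ⟨V', P', h1, h2, h3, h4⟩ := exists_first_competitor (d := d) hI hk
  set J : Finset (Fin (k / 2 + 1)) := Finset.univ.filter fun j => (j : ℕ) ≤ 1 with hJ
  have hcomp := hmin.empMean_le_of_eq_zero (d := d) (s := s) (Ψ := inputVec)
    (y := fun x => target k I x.toReal) hlam hm h1 h2 J (fun j hj => h3 j (by simpa [hJ] using hj))
  have hred : ∀ j (x : Cube d), reduce P (expand V (inputVec x).ofLp) j =
      quadForm (Vᵀ * P j * V) x.toReal := fun j x => by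
    rw [quadForm_eq_formBilin, reduce_expand]
  have hzero : ∑ j ∈ J, empMean s (fun x => (reduce P' (expand V' (inputVec x).ofLp) j -
      target k I x.toReal j) ^ 2) = 0 := by
    refine Finset.sum_eq_zero fun j hj => ?_
    have hj' : (j : ℕ) ≤ 1 := by simpa [hJ] using hj
    simp only [h4 j hj', sub_self]
    simp [empMean]
  rw [hzero, zero_add] at hcomp
  simp only [hred] at hcomp
  have hM : (1 / 2 + traceBudget k) ^ 2 ≤ 9 / 4 := by
    have a1 := traceBudget_le_one hk
    have a2 := traceBudget_nonneg k
    nlinarith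
  have hW : ∀ j, frSq (Vᵀ * P j * V) ≤ 9 / 4 := fun j =>
    (frSq_transpose_mul_mul_le hmin.1.width (hmin.1.spectral j)).trans hM
  -- the hypotheses and targets as linear combinations of the moments
  have hf : ∀ j (x : Cube d), quadForm (Vᵀ * P j * V) x.toReal =
      ∑ p, (Sum.elim (fun p : Fin (d + 1) × Fin (d + 1) => (Vᵀ * P j * V) p.1 p.2) 0 : _ → ℝ) p * momentVec k I x p := by
    intro j x
    simp only [Fintype.sum_sum_type, Sum.elim_inl, Sum.elim_inr, Pi.zero_apply, zero_mul,
      Finset.sum_const_zero, add_zero, momentVec, Fintype.sum_prod_type]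
    rfl
  have hh : ∀ (j : Fin (k / 2 + 1)) (x : Cube d), target k I x.toReal j =
      ∑ p, (Sum.elim 0 (Pi.single j 1) : _ → ℝ) p * momentVec k I x p := by
    intro j x
    simp [momentVec, Pi.single_apply]
  have hfh : ∀ j (x : Cube d), quadForm (Vᵀ * P j * V) x.toReal - target k I x.toReal j =
      ∑ p, (Sum.elim (fun p : Fin (d + 1) × Fin (d + 1) => (Vᵀ * P j * V) p.1 p.2) (-Pi.single j 1) : _ → ℝ) p *
        momentVec k I x p := by
    intro j x
    rw [hf, hh, ← Finset.sum_sub_distrib]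
    refine Finset.sum_congr rfl fun p _ => ?_
    rcases p with p | p <;> simp
  have n1 : ∀ j, ∑ p, (Sum.elim (fun p : Fin (d + 1) × Fin (d + 1) => (Vᵀ * P j * V) p.1 p.2)
      (0 : Fin (k / 2 + 1) → ℝ) : _ → ℝ) p ^ 2 ≤ 4 := by
    intro j
    have := hW j
    simp only [frSq] at this
    simp only [Fintype.sum_sum_type, Sum.elim_inl, Sum.elim_inr, Fintype.sum_prod_type]
    simp
    linarith
  have n2 : ∀ j : Fin (k / 2 + 1), ∑ p, (Sum.elim (0 : Fin (d + 1) × Fin (d + 1) → ℝ)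
      (Pi.single j 1) : _ → ℝ) p ^ 2 ≤ 4 := by
    intro j
    simp [Pi.single_apply]
  have n3 : ∀ j : Fin (k / 2 + 1), ∑ p, (Sum.elim (fun p : Fin (d + 1) × Fin (d + 1) => (Vᵀ * P j * V) p.1 p.2)
      (-Pi.single j 1) : _ → ℝ) p ^ 2 ≤ 4 := by
    intro j
    have := hW j
    simp only [frSq] at this
    simp only [Fintype.sum_sum_type, Sum.elim_inl, Sum.elim_inr, Fintype.sum_prod_type]
    simp [Pi.single_apply]
    linarith
  have hrest : ∑ j ∈ Jᶜ, empMean s (fun x => target k I x.toReal j *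
      quadForm (Vᵀ * P j * V) x.toReal) ≤ (k / 2 + 1 : ℕ) * (4 * τ) := by
    calc _ ≤ ∑ j ∈ Jᶜ, 4 * τ := by
          refine Finset.sum_le_sum fun j hj => ?_
          have hj' : ¬ (j : ℕ) ≤ 1 := by simpa [hJ] using hj
          have hdev := hs.abs_sub_le hτ (n2 j) (n1 j)
          simp only [← hf, ← hh] at hdev
          have hdeg : HasDegreeLE 2 fun x : Cube d => quadForm (Vᵀ * P j * V) x.toReal := by
            have hc : ∀ a : Fin (d + 1), HasDegreeLE 1 fun x : Cube d =>
                (Fin.cons (√2) x.toReal : Fin (d + 1) → ℝ) a := by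
              intro a
              refine Fin.cases ?_ (fun i => ?_) a
              · exact HasDegreeLE.const 1 _
              · simpa using HasDegreeLE.coord i
            exact HasDegreeLE.sum _ fun a _ => HasDegreeLE.sum _ fun b _ =>
              ((hc a).mul (hc b)).const_mul _
          rw [avg_target_mul_eq_zero hI j (by omega) hdeg, sub_zero] at hdev
          exact (abs_le.1 hdev).2
      _ = ((Jᶜ).card : ℝ) * (4 * τ) := by simp
      _ ≤ (k / 2 + 1 : ℕ) * (4 * τ) := by
          gcongr
          exact_mod_cast (Finset.card_le_univ Jᶜ).trans (by simp)
  have hemp : empMean s (fun x => (quadForm (Vᵀ * P j * V) x.toReal -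
      target k I x.toReal j) ^ 2) ≤ ∑ j ∈ J, empMean s (fun x =>
        (quadForm (Vᵀ * P j * V) x.toReal - target k I x.toReal j) ^ 2) :=
    Finset.single_le_sum (f := fun j => empMean s (fun x =>
        (quadForm (Vᵀ * P j * V) x.toReal - target k I x.toReal j) ^ 2))
      (fun j _ => empMean_nonneg s fun x => sq_nonneg _) (by simpa [hJ] using hj)
  have hdev := hs.abs_sub_le hτ (n3 j) (n3 j)
  simp only [← hfh, ← sq] at hdev
  have hdev' := (abs_le.1 hdev).1
  have hreg : lam * ((1 + (k / 2 + 1 : ℕ)) * (1 / 2 + traceBudget k) ^ 2) ≤ lam * ((1 + (k / 2 + 1 : ℕ)) * (9 / 4)) := by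
    gcongr
  have hq0 : (0 : ℝ) ≤ (k / 2 + 1 : ℕ) := by positivity
  -- With `q = k / 2 + 1`, the empirical loss is at most `(9/4) (1 + q) λ + 8 q τ`, and passing to
  -- the population adds `4 τ`.
  nlinarith [mul_nonneg hq0 hlam, mul_nonneg hq0 hτ]

end

/-! ### The expansion of the trained first layer -/

section

variable {d k m : ℕ} {I : Finset (Fin d)}

/-- The image of a basis vector under an extractor. -/
def colVec {n : ℕ} (V : Matrix (Fin n) (Fin (d + 1)) ℝ) (a : Fin (d + 1)) :
    EuclideanSpace ℝ (Fin n) :=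
  euclLin V (EuclideanSpace.single a 1)

lemma euclLin_inputVec {n : ℕ} (V : Matrix (Fin n) (Fin (d + 1)) ℝ) (x : Cube d) :
    euclLin V (inputVec x) = √2 • colVec V 0 + ∑ i : Fin d, x.toReal i • colVec V i.succ := by
  have h : inputVec x = √2 • EuclideanSpace.single 0 1 +
      ∑ i : Fin d, x.toReal i • EuclideanSpace.single i.succ 1 := by
    ext a
    refine Fin.cases ?_ (fun i => ?_) a
    · simp [inputVec, (Fin.succ_ne_zero _).symm]
    · simp [inputVec, Pi.single_apply, Fin.succ_ne_zero]
  rw [h, map_add, map_smul, map_sum]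
  simp only [map_smul]
  rfl

lemma abs_sum_toReal_le (hI : I.card = k) (x : Cube d) : |∑ i ∈ I, x.toReal i| ≤ k := by
  refine (Finset.abs_sum_le_sum_abs _ _).trans ?_
  simp [Cube.abs_toReal, hI]

/-- The zeroth order part of the first extractor. -/
def firstBase {n : ℕ} (k : ℕ) (I : Finset (Fin d)) (V : Matrix (Fin n) (Fin (d + 1)) ℝ)
    (x : Cube d) : EuclideanSpace ℝ (Fin n) :=
  √2 • colVec V 0 + ((k : ℝ)⁻¹ * ∑ i ∈ I, x.toReal i) • ∑ i ∈ I, colVec V i.succ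

lemma firstBase_dependsOnly {n : ℕ} (V : Matrix (Fin n) (Fin (d + 1)) ℝ) :
    DependsOnly I (firstBase k I V) := by
  intro x x' h
  have : ∑ i ∈ I, x.toReal i = ∑ i ∈ I, x'.toReal i :=
    Finset.sum_congr rfl fun i hi => by simp [Cube.toReal, h i hi]
  simp only [firstBase, this]

/-- The trained first extractor is close to a function of the sum of the relevant coordinates. -/
lemma first_layer_expansion {n : ℕ} (hI : I.card = k) (hk : 7 ≤ k) {s : Fin m → Cube d}
    {τ lam η : ℝ} (hs : HasGoodMoments k I s τ) (hτ : 0 ≤ τ) (hlam : 0 ≤ lam) (hη : 0 ≤ η)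
    (hbound : 12 * ((k / 2 + 1 : ℕ) + 1) * (lam + τ) ≤ η ^ 2)
    {V : Matrix (Fin n) (Fin (d + 1)) ℝ} {P : Fin (k / 2 + 1) → Matrix (Fin n) (Fin n) ℝ}
    (hmin : IsLayerMinimizer squareLoss (1 / 2 + traceBudget k) lam
      (fun i => ((inputVec (s i)).ofLp, target k I (s i).toReal)) V P) (hm : 2 ≤ m) :
    IsApprox I (fun x => euclLin V (inputVec x)) (firstBase k I V)
      (fun _ => deviation I fun i => colVec V i.succ) (2 * k) (9 * d * η) := by
  have hk2 : 2 ≤ k := by omega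
  have hkR : (7 : ℝ) ≤ k := by exact_mod_cast hk
  set κ := traceBudget k with hκ
  set D := √(k.choose 2 : ℝ) with hD
  have hDpos : 0 < D := Real.sqrt_pos.2 (by exact_mod_cast Nat.choose_pos hk2)
  have hDsq : D ^ 2 = k.choose 2 := Real.sq_sqrt (by positivity)
  have hDk : D ≤ k := by
    refine Real.sqrt_le_iff.2 ⟨by positivity, ?_⟩
    rw [Nat.cast_choose_two]
    nlinarith
  have hκ1 : κ ≤ 1 := traceBudget_le_one hk2
  have hpop : ∀ j : Fin (k / 2 + 1), (j : ℕ) ≤ 1 →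
      avg (fun x => (quadForm (Vᵀ * P j * V) x.toReal - target k I x.toReal j) ^ 2) ≤ η ^ 2 :=
    fun j hj => (first_layer_avg_le hI hk2 hs hτ hlam hmin hm j hj).trans hbound
  -- Cauchy–Schwarz turns mean square closeness into closeness of Fourier coefficients. The square
  -- root lost here takes the rate from `m ^ (-1/2)` to `m ^ (-1/4)`.
  have hcorr : ∀ (j : Fin (k / 2 + 1)), (j : ℕ) ≤ 1 → ∀ (φ : Cube d → ℝ) (b : ℝ), 0 ≤ b →
      avg (fun x => φ x ^ 2) ≤ b ^ 2 →
      |avg (fun x => quadForm (Vᵀ * P j * V) x.toReal * φ x) -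
        avg (fun x => target k I x.toReal j * φ x)| ≤ η * b := by
    intro j hj φ b hb hφ
    rw [← avg_sub]
    simp only [← sub_mul]
    refine abs_le_of_sq_le_sq ?_ (by positivity)
    refine (avg_mul_sq_le _ _).trans ?_
    rw [mul_pow]
    exact mul_le_mul (hpop j hj) hφ (avg_nonneg fun x => sq_nonneg _) (by positivity)
  have he2 : avg (fun x : Cube d => elemSym I 2 x.toReal ^ 2) ≤ D ^ 2 := by
    rw [avg_elemSym_two_sq, hDsq, hI]
  have he2z : avg (fun x : Cube d => elemSym I 2 x.toReal) = 0 := by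
    have := avg_prod_mul_elemSym ∅ I 2
    simpa using this
  set v : Fin d → EuclideanSpace ℝ (Fin n) := fun i => colVec V i.succ with hv
  have hcols : ‖colVec V 0‖ ^ 2 + ∑ i, ‖v i‖ ^ 2 ≤ 1 / 2 + κ := by
    have := sum_norm_euclLin_single V
    rw [Fin.sum_univ_succ] at this
    exact this.le.trans hmin.1.width
  have hW : ∀ j a b, (Vᵀ * P j * V) a b = formBilin (P j) (colVec V a) (colVec V b) :=
    fun j a b => transpose_mul_mul_apply V (P j) a b
  have hj0 : (⟨0, by omega⟩ : Fin (k / 2 + 1)).1 ≤ 1 := by simp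
  have hj1 : (⟨1, by omega⟩ : Fin (k / 2 + 1)).1 ≤ 1 := le_rfl
  have c1 := hcorr _ hj1 _ D hDpos.le he2
  have c2 := hcorr _ hj0 _ D hDpos.le he2
  have c3 := hcorr _ hj0 (fun _ => 1) 1 zero_le_one (by simp [avg_const])
  rw [avg_quadForm_mul_elemSym] at c1 c2
  simp only [mul_one, target_zero, one_mul, he2z, avg_const, avg_quadForm, sub_zero] at c2 c3
  have c1' : avg (fun x : Cube d => target k I x.toReal ⟨1, by omega⟩ *
      elemSym I 2 x.toReal) = D := by
    simp only [target_one hI hk2, mul_assoc, ← sq]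
    rw [avg_const_mul, avg_elemSym_two_sq, hI, ← hD, ← hDsq]
    field_simp
  rw [c1'] at c1
  simp only [hW] at c1 c2 c3
  have hηD : η * D ≤ k * η := by nlinarith
  have hdev := sum_norm_deviation_le (v := v) (v₀ := colVec V 0)
    (F₀ := formBilin (P ⟨0, by omega⟩)) (F₁ := formBilin (P ⟨1, by omega⟩)) hI hk
    (norm_formBilin_le (hmin.1.spectral _)) (norm_formBilin_le (hmin.1.spectral _)) hη hcols
    (by
      rw [hκ, traceBudget_mul_sub_one hk2, ← hD]
      linarith [(abs_le.1 c1).1])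
    (by linarith [(abs_le.1 c2).2])
    (by linarith [(abs_le.1 c3).1])
  have hvn : ∀ i, ‖v i‖ ≤ 5 / 4 := by
    intro i
    have h1 := Finset.single_le_sum (f := fun i => ‖v i‖ ^ 2) (fun i _ => sq_nonneg _)
      (Finset.mem_univ i)
    nlinarith [sq_nonneg ‖colVec V 0‖, norm_nonneg (v i)]
  refine ⟨firstBase_dependsOnly V, fun _ _ _ => rfl, fun x => ?_, fun x => ?_, fun x => ?_⟩
  · have h0 : ‖colVec V 0‖ ≤ 5 / 4 := by
      have := Finset.sum_nonneg (s := Finset.univ) fun i _ => sq_nonneg ‖v i‖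
      nlinarith [norm_nonneg (colVec V 0)]
    have h1 : ‖∑ i ∈ I, v i‖ ≤ k * (5 / 4) := by
      refine (norm_sum_le _ _).trans ((Finset.sum_le_sum fun i _ => hvn i).trans ?_)
      simp [hI]
    have h2 : |(k : ℝ)⁻¹ * ∑ i ∈ I, x.toReal i| ≤ 1 := by
      rw [abs_mul, abs_of_nonneg (by positivity), inv_mul_le_iff₀ (by linarith), mul_one]
      exact abs_sum_toReal_le hI x
    have h3 : √(2 : ℝ) ≤ 3 / 2 := Real.sqrt_le_iff.2 ⟨by norm_num, by norm_num⟩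
    calc ‖firstBase k I V x‖ ≤ √2 * ‖colVec V 0‖ +
          |(k : ℝ)⁻¹ * ∑ i ∈ I, x.toReal i| * ‖∑ i ∈ I, v i‖ := by
          refine (norm_add_le _ _).trans ?_
          rw [norm_smul, norm_smul, Real.norm_of_nonneg (Real.sqrt_nonneg _), Real.norm_eq_abs]
      _ ≤ 3 / 2 * (5 / 4) + 1 * (k * (5 / 4)) := by gcongr
      _ ≤ 2 * k := by linarith
  -- Cauchy–Schwarz over all coordinates costs a factor `d`; this is how the dimension enters the
  -- error `9 d η`.
  · calc (∑ i, ‖deviation I v i‖) ^ 2 ≤ (Finset.univ : Finset (Fin d)).card *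
          ∑ i, ‖deviation I v i‖ ^ 2 := sq_sum_le_card_mul_sum_sq
      _ ≤ d * (9 * η) := by
          rw [Finset.card_univ, Fintype.card_fin]
          gcongr
      _ = 9 * d * η := by ring
  -- At the first layer the expansion is exact: the extractor is linear in `x`, and the deviations
  -- are precisely what the zeroth order part omits.
  · have hsum : ∑ i, x.toReal i • deviation I v i = ∑ i, x.toReal i • v i -
        ((k : ℝ)⁻¹ * ∑ i ∈ I, x.toReal i) • ∑ i ∈ I, v i := by
      have h1 : ∀ i, x.toReal i • deviation I v i = x.toReal i • v i -
          if i ∈ I then x.toReal i • (k : ℝ)⁻¹ • ∑ j ∈ I, v j else 0 := by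
        intro i
        by_cases hi : i ∈ I <;> simp [deviation, hi, hI, smul_sub]
      simp only [h1]
      rw [Finset.sum_sub_distrib, Finset.sum_ite_mem, Finset.univ_inter, ← Finset.sum_smul,
        smul_smul, mul_comm]
    rw [hsum, euclLin_inputVec, firstBase]
    have h0 : √2 • colVec V 0 + ∑ i : Fin d, x.toReal i • colVec V i.succ -
        (√2 • colVec V 0 + ((k : ℝ)⁻¹ * ∑ i ∈ I, x.toReal i) • ∑ i ∈ I, colVec V i.succ) -
        (∑ i, x.toReal i • v i - ((k : ℝ)⁻¹ * ∑ i ∈ I, x.toReal i) • ∑ i ∈ I, v i) = 0 := by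
      simp only [hv]
      abel
    rw [h0, norm_zero]
    positivity

/-- The output forms of the trained first layer are close to the first two targets. -/
lemma first_layer_output {n : ℕ} (hI : I.card = k) (hk : 7 ≤ k) {s : Fin m → Cube d}
    {τ lam η : ℝ} (hs : HasGoodMoments k I s τ) (hτ : 0 ≤ τ) (hlam : 0 ≤ lam) (hη : 0 ≤ η)
    (hbound : 12 * ((k / 2 + 1 : ℕ) + 1) * (lam + τ) ≤ η ^ 2)
    {V : Matrix (Fin n) (Fin (d + 1)) ℝ} {P : Fin (k / 2 + 1) → Matrix (Fin n) (Fin n) ℝ}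
    (hmin : IsLayerMinimizer squareLoss (1 / 2 + traceBudget k) lam
      (fun i => ((inputVec (s i)).ofLp, target k I (s i).toReal)) V P) (hm : 2 ≤ m)
    (hsmall : 6 * (2 * (k : ℝ)) ^ 2 * (9 * d * η) ≤ 1)
    (j : Fin (k / 2 + 1)) (hj : (j : ℕ) ≤ 1) (x : Cube d) :
    (formBilin (P j) (firstBase k I V x) (firstBase k I V x) - target k I x.toReal j) ^ 2 ≤
      2 ^ k * (2 * η ^ 2 + 8 * (6 * (2 * (k : ℝ)) ^ 2 * (9 * d * η))) := by
  have happ := first_layer_expansion hI hk hs hτ hlam hη hbound hmin hm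
  have hkR : (7 : ℝ) ≤ k := by exact_mod_cast hk
  have hs1 := happ.nonneg
  have hle1 : 9 * d * η ≤ 1 := by nlinarith
  have hq := happ.quadratic hle1 (by linarith) (formBilin (P j)) le_rfl fun u v => by
    rw [one_mul]; exact norm_formBilin_le (hmin.1.spectral j) u v
  rw [one_pow, mul_one] at hq
  set s' := 6 * (2 * (k : ℝ)) ^ 2 * (9 * d * η) with hs'
  have hs'0 : 0 ≤ s' := hq.nonneg
  have hdep : DependsOnly I fun x => (formBilin (P j) (firstBase k I V x) (firstBase k I V x) -
      target k I x.toReal j) ^ 2 := by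
    intro x x' hx
    have h1 := firstBase_dependsOnly (k := k) V x x' hx
    have h2 : target k I x.toReal = target k I x'.toReal := target_dependsOnly x x' hx
    simp only [h1, h2]
  refine hdep.le_of_avg_le hI (fun x => sq_nonneg _) ?_ x
  have hpop := (first_layer_avg_le hI (by omega) hs hτ hlam hmin hm j hj).trans hbound
  simp only [quadForm_eq_formBilin] at hpop
  calc _ ≤ avg (fun x => 2 * (formBilin (P j) (euclLin V (inputVec x)) (euclLin V (inputVec x)) -
        target k I x.toReal j) ^ 2 + 8 * s') := by
        refine avg_mono fun x => ?_
        have h1 := hq.norm_sub_le hsmall x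
        have h2 : (formBilin (P j) (euclLin V (inputVec x)) (euclLin V (inputVec x)) -
            formBilin (P j) (firstBase k I V x) (firstBase k I V x)) ^ 2 ≤ 4 * s' := by
          rw [← sq_abs]
          calc _ ≤ (2 * √s') ^ 2 := pow_le_pow_left₀ (abs_nonneg _) h1 2
            _ = 4 * s' := by rw [mul_pow, Real.sq_sqrt hs'0]; norm_num
        nlinarith [sq_nonneg ((formBilin (P j) (euclLin V (inputVec x))
          (euclLin V (inputVec x)) - target k I x.toReal j) +
          (formBilin (P j) (euclLin V (inputVec x)) (euclLin V (inputVec x)) -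
            formBilin (P j) (firstBase k I V x) (firstBase k I V x)))]
    _ = 2 * avg (fun x => (formBilin (P j) (euclLin V (inputVec x)) (euclLin V (inputVec x)) -
        target k I x.toReal j) ^ 2) + 8 * s' := by
        rw [avg_add, avg_const_mul, avg_const]
    _ ≤ 2 * η ^ 2 + 8 * s' := by linarith

end

/-! ### Induction over the layers -/

section

variable {d k m : ℕ} {I : Finset (Fin d)}

lemma IsApprox.mono {E : Type} [NormedAddCommGroup E] [NormedSpace ℝ E] {Φ Φ₀ : Cube d → E}
    {Φ₁ : Cube d → Fin d → E} {r s r' s' : ℝ} (h : IsApprox I Φ Φ₀ Φ₁ r s) (hr : r ≤ r')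
    (hs : s ≤ s') : IsApprox I Φ Φ₀ Φ₁ r' s' where
  base := h.base
  linear := h.linear
  norm_base x := (h.norm_base x).trans hr
  norm_linear x := (h.norm_linear x).trans hs
  approx x := (h.approx x).trans hs

lemma IsApprox.euclLin {ι : Type} [Fintype ι] {n : ℕ} {Φ Φ₀ : Cube d → EuclideanSpace ℝ ι}
    {Φ₁ : Cube d → Fin d → EuclideanSpace ℝ ι} {r s M : ℝ} (h : IsApprox I Φ Φ₀ Φ₁ r s)
    {V : Matrix (Fin n) ι ℝ} (hV : frSq V ≤ M) (hM : 1 ≤ M) :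
    IsApprox I (fun x => euclLin V (Φ x)) (fun x => euclLin V (Φ₀ x))
      (fun x i => euclLin V (Φ₁ x i)) (√M * r) (M * s) where
  base := h.base.comp _
  linear x x' hx := by simp only [h.linear x x' hx]
  norm_base x := (norm_euclLin_le hV _).trans (by gcongr; exact h.norm_base x)
  norm_linear x := by
    calc (∑ i, ‖RedEx.euclLin V (Φ₁ x i)‖) ^ 2 ≤ (√M * ∑ i, ‖Φ₁ x i‖) ^ 2 := by
          rw [Finset.mul_sum]
          gcongr with i
          exact norm_euclLin_le hV _
      _ = M * (∑ i, ‖Φ₁ x i‖) ^ 2 := by rw [mul_pow, Real.sq_sqrt (by linarith)]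
      _ ≤ M * s := by gcongr; exact h.norm_linear x
  approx x := by
    have h1 : RedEx.euclLin V (Φ x) - RedEx.euclLin V (Φ₀ x) -
        ∑ i, x.toReal i • RedEx.euclLin V (Φ₁ x i) =
        RedEx.euclLin V (Φ x - Φ₀ x - ∑ i, x.toReal i • Φ₁ x i) := by
      simp [map_sub, map_sum]
    rw [h1]
    have hMM : √M ≤ M := Real.sqrt_le_iff.2 ⟨by linarith, by nlinarith⟩
    exact (norm_euclLin_le hV _).trans (mul_le_mul hMM (h.approx x) (norm_nonneg _) (by linarith))

/-- The extracted features `g` have low degree and a first-order expansion around functions of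
the relevant coordinates, and the forms `P j` applied to the zeroth order part are close to the
targets of index at most `N`. -/
structure IsGoodExtraction {n : ℕ} (k : ℕ) (I : Finset (Fin d)) (N : ℕ) (R e : ℝ)
    (g g₀ : Cube d → EuclideanSpace ℝ (Fin n)) (g₁ : Cube d → Fin d → EuclideanSpace ℝ (Fin n))
    (P : Fin (k / 2 + 1) → Matrix (Fin n) (Fin n) ℝ) (σ : ℝ) : Prop where
  approx : IsApprox I g g₀ g₁ (√R) σ
  error : 6 * R * σ ≤ e
  degree : ∀ a, HasDegreeLE N fun x => (g x).ofLp a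
  target : ∀ j : Fin (k / 2 + 1), (j : ℕ) ≤ N → ∀ x,
    (formBilin (P j) (g₀ x) (g₀ x) - target k I x.toReal j) ^ 2 ≤ e

lemma HasDegreeLE.euclLin {ι : Type} [Fintype ι] {n r : ℕ} {Ψ : Cube d → EuclideanSpace ℝ ι}
    (h : ∀ p, HasDegreeLE r fun x => (Ψ x).ofLp p) (V : Matrix (Fin n) ι ℝ) (a : Fin n) :
    HasDegreeLE r fun x => (RedEx.euclLin V (Ψ x)).ofLp a :=
  HasDegreeLE.sum Finset.univ fun p _ => (h p).const_mul (V a p)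

/-- Returns from the zeroth order part to the actual output: replacing `g₀` by `g` changes the form
by at most `2 √e`, and `(a + b)² ≤ 2 a² + 2 b²` gives `8 e + 2 e`. -/
lemma IsGoodExtraction.output_sq_le {n N : ℕ} {R e σ : ℝ}
    {g g₀ : Cube d → EuclideanSpace ℝ (Fin n)} {g₁ : Cube d → Fin d → EuclideanSpace ℝ (Fin n)}
    {P : Fin (k / 2 + 1) → Matrix (Fin n) (Fin n) ℝ} (h : IsGoodExtraction k I N R e g g₀ g₁ P σ)
    (hP : ∀ j, spNorm (P j) ≤ 1) (hR : 1 ≤ R) (he : e ≤ 1) (j : Fin (k / 2 + 1))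
    (hj : (j : ℕ) ≤ N) (x : Cube d) :
    (formBilin (P j) (g x) (g x) - RedEx.target k I x.toReal j) ^ 2 ≤ 10 * e := by
  have hσ := h.approx.nonneg
  have herr := h.error
  have hσ1 : σ ≤ 1 := by nlinarith
  have hq := h.approx.quadratic hσ1 (Real.one_le_sqrt.2 hR) (formBilin (P j)) le_rfl fun u v => by
    rw [one_mul]; exact norm_formBilin_le (hP j) u v
  rw [Real.sq_sqrt (by linarith), one_pow, mul_one] at hq
  have h1 := hq.norm_sub_le (herr.trans he) x
  have h2 : (formBilin (P j) (g x) (g x) - formBilin (P j) (g₀ x) (g₀ x)) ^ 2 ≤ 4 * e := by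
    rw [← sq_abs]
    calc _ ≤ (2 * √(6 * R * σ)) ^ 2 := pow_le_pow_left₀ (abs_nonneg _) h1 2
      _ = 4 * (6 * R * σ) := by rw [mul_pow, Real.sq_sqrt hq.nonneg]; norm_num
      _ ≤ 4 * e := by linarith
  have h3 := h.target j hj x
  nlinarith [sq_nonneg (formBilin (P j) (g x) (g x) - formBilin (P j) (g₀ x) (g₀ x) -
    (formBilin (P j) (g₀ x) (g₀ x) - RedEx.target k I x.toReal j))]

/-- Training one more layer on top of a good extraction gives a good extraction. -/
lemma IsGoodExtraction.step {n n' N : ℕ} (hI : I.card = k) {Q R e σ τ lam M : ℝ}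
    {g g₀ : Cube d → EuclideanSpace ℝ (Fin n)} {g₁ : Cube d → Fin d → EuclideanSpace ℝ (Fin n)}
    {P : Fin (k / 2 + 1) → Matrix (Fin n) (Fin n) ℝ} (h : IsGoodExtraction k I N R e g g₀ g₁ P σ)
    (hP : ∀ j, spNorm (P j) ≤ 1) {S : Fin m → Cube d} (hS : IsRepresentative I S τ)
    {V : Matrix (Fin n') (Fin n × Fin n) ℝ}
    {P' : Fin (k / 2 + 1) → Matrix (Fin n') (Fin n') ℝ}
    (hmin : IsLayerMinimizer squareLoss M lam
      (fun i => ((outerBilin n (g (S i)) (g (S i))).ofLp, RedEx.target k I (S i).toReal)) V P')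
    (hm : k / 2 + 1 ≤ m) (hR : 1 ≤ R) (hM : 1 ≤ M)
    (hMw : (2 * ((k : ℝ) + 1)) ^ k * ((k / 2 + 1 : ℕ) * (2 ^ k) ^ 2) ≤ M)
    (hlam : 0 ≤ lam) (hlams : lam ≤ e) (hτs : τ ≤ e) (hτ : τ ≤ ((2 : ℝ) ^ (k + 1))⁻¹)
    (hs' : 6 * M ^ 2 * R ^ 2 * e ≤ 1)
    (hQ1 : (2 : ℝ) ^ k ≤ Q) (hQ2 : (2 * ((k : ℝ) + 1)) ^ k ≤ Q) (hQ3 : M ≤ Q) (hQ4 : R ≤ Q)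
    (hQ5 : ((k / 2 + 1 : ℕ) : ℝ) ≤ Q) (hQ6 : 2000 ≤ Q) :
    ∃ g₀' g₁' σ', IsGoodExtraction k I (2 * N) (M * R ^ 2) (Q ^ 9 * e)
      (fun x => euclLin V (outerBilin n (g x) (g x))) g₀' g₁' P' σ' := by
  have hσ := h.approx.nonneg
  have herr := h.error
  have he0 : 0 ≤ e := le_trans (by positivity) herr
  have hMR : 1 ≤ M ^ 2 * R ^ 2 := by
    rw [← mul_pow]
    exact one_le_pow₀ (by nlinarith)
  have he1 : e ≤ 1 := by nlinarith
  have hσ1 : σ ≤ 1 := by nlinarith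
  have hΨ := h.approx.quadratic hσ1 (Real.one_le_sqrt.2 hR) (outerBilin n) le_rfl fun u v => by
    rw [one_mul, norm_outerBilin]
  rw [Real.sq_sqrt (by linarith), one_pow, mul_one, one_mul] at hΨ
  replace hΨ := hΨ.mono le_rfl herr
  have hdeg : ∀ p, HasDegreeLE (2 * N) fun x => (outerBilin n (g x) (g x)).ofLp p := fun p => by
    rw [two_mul]
    exact (h.degree p.1).mul (h.degree p.2)
  choose w hw hwt using fun a => exists_frobenius_representative hI h.approx.base (hP a)
  have hstep := layer_step hI hΨ hdeg hw (fun a ha x => by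
      rw [hwt]; exact h.target a ha x) hS hmin hm hR hM hMw hlam hlams hτs hτ hs' hQ1 hQ2 hQ3 hQ4
      hQ5 hQ6
  refine ⟨_, _, _, (hΨ.euclLin hmin.1.width hM).mono ?_ le_rfl, ?_, HasDegreeLE.euclLin hdeg V,
    hstep⟩
  · rw [Real.sqrt_mul (by linarith), Real.sqrt_sq (by linarith)]
  · have hQ0 : 1 ≤ Q := by linarith
    have h1 : M ^ 2 * R ^ 2 ≤ Q ^ 2 * Q ^ 2 := by gcongr
    have h2 : 6 * (Q ^ 2 * Q ^ 2) ≤ Q ^ 9 := by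
      calc 6 * (Q ^ 2 * Q ^ 2) ≤ Q * (Q ^ 2 * Q ^ 2) := by gcongr; linarith
        _ = Q ^ 5 := by ring
        _ ≤ Q ^ 9 := pow_le_pow_right₀ hQ0 (by norm_num)
    calc 6 * (M * R ^ 2) * (M * e) = 6 * (M ^ 2 * R ^ 2) * e := by ring
      _ ≤ 6 * (Q ^ 2 * Q ^ 2) * e := by gcongr
      _ ≤ Q ^ 9 * e := by gcongr

/-- A bound on all quantities in the analysis that depend on `k` only. -/
def budget (k : ℕ) : ℝ := (24 * (k : ℝ)) ^ (2 * k ^ 2)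

lemma pow_le_budget (hk : 2 ≤ k) {x : ℝ} {p : ℕ} (hx0 : 0 ≤ x) (hx : x ≤ 24 * k)
    (hp : p ≤ 2 * k ^ 2) : x ^ p ≤ budget k := by
  have hkR : (2 : ℝ) ≤ k := by exact_mod_cast hk
  exact (pow_le_pow_left₀ hx0 hx p).trans (pow_le_pow_right₀ (by linarith) hp)

/-- The bounds on the squared norms of the extracted features. -/
def normBound (k : ℕ) : ℕ → ℝ
  | 0 => (2 * (k : ℝ)) ^ 2
  | t + 1 => (24 * (k : ℝ)) ^ k * normBound k t ^ 2

lemma one_le_normBound (hk : 2 ≤ k) (t : ℕ) : 1 ≤ normBound k t := by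
  have hkR : (2 : ℝ) ≤ k := by exact_mod_cast hk
  induction t with
  | zero => exact one_le_pow₀ (by linarith)
  | succ t ih => exact one_le_mul_of_one_le_of_one_le (one_le_pow₀ (by linarith)) (one_le_pow₀ ih)

lemma normBound_le_budget (hk : 2 ≤ k) {t : ℕ} (ht : 2 ^ t ≤ k) : normBound k t ≤ budget k := by
  have hkR : (2 : ℝ) ≤ k := by exact_mod_cast hk
  -- Multiplied by `(24 k) ^ k`, the recursion becomes plain squaring. Since `2 ^ t ≤ k`, the
  -- exponent of `24 k` stays below `2 k * 2 ^ t ≤ 2 k²`, the exponent in `budget`.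
  have h1 : (24 * (k : ℝ)) ^ k * normBound k t = ((24 * (k : ℝ)) ^ k * (2 * (k : ℝ)) ^ 2) ^ 2 ^ t := by
    clear ht
    induction t with
    | zero => simp [normBound]
    | succ t ih => rw [normBound, pow_succ (2 : ℕ), pow_mul, ← ih]; ring
  have h2 : (1 : ℝ) ≤ (24 * (k : ℝ)) ^ k := one_le_pow₀ (by linarith)
  have h3 : (24 * (k : ℝ)) ^ k * (2 * (k : ℝ)) ^ 2 ≤ (24 * (k : ℝ)) ^ (2 * k) := by
    calc (24 * (k : ℝ)) ^ k * (2 * (k : ℝ)) ^ 2 ≤ (24 * (k : ℝ)) ^ k * (24 * (k : ℝ)) ^ 2 := by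
          gcongr; norm_num
      _ = (24 * (k : ℝ)) ^ (k + 2) := by rw [pow_add]
      _ ≤ _ := pow_le_pow_right₀ (by linarith) (by omega)
  calc normBound k t ≤ (24 * (k : ℝ)) ^ k * normBound k t :=
        le_mul_of_one_le_left (zero_le_one.trans (one_le_normBound hk t)) h2
    _ ≤ ((24 * (k : ℝ)) ^ (2 * k)) ^ 2 ^ t := by rw [h1]; gcongr
    _ ≤ budget k := by
        rw [← pow_mul]
        refine pow_le_pow_right₀ (by linarith) ?_
        calc 2 * k * 2 ^ t ≤ 2 * k * k := by gcongr
          _ = 2 * k ^ 2 := by ring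

lemma widths_succ {t : ℕ} (ht : t + 1 < numLayers k) :
    widths k ⟨t + 1, ht⟩ = (24 * (k : ℝ)) ^ k := by
  have : (2 : ℝ) ^ (3 * k) * (3 * (k : ℝ)) ^ k = (24 * (k : ℝ)) ^ k := by
    rw [pow_mul, ← mul_pow]
    norm_num
    ring
  simp [widths, this]

/-- The width needed by the competitor: coefficients of `ℓ¹` norm `(2 (k + 1)) ^ k` and at most `2 ^
k` functionals of norm `2 ^ k`. Together this is `(16 (k + 1)) ^ k`, which the prescribed `2 ^ (3 k)
(3 k) ^ k = (24 k) ^ k` accommodates. -/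
lemma mixing_le_width (hk : 2 ≤ k) :
    (2 * ((k : ℝ) + 1)) ^ k * ((k / 2 + 1 : ℕ) * (2 ^ k) ^ 2) ≤ (24 * (k : ℝ)) ^ k := by
  have hkR : (2 : ℝ) ≤ k := by exact_mod_cast hk
  have h1 : ((k / 2 + 1 : ℕ) : ℝ) ≤ 2 ^ k := by
    have : k / 2 + 1 ≤ 2 ^ k := (show k / 2 + 1 ≤ k by omega).trans Nat.lt_two_pow_self.le
    exact_mod_cast this
  calc (2 * ((k : ℝ) + 1)) ^ k * ((k / 2 + 1 : ℕ) * (2 ^ k) ^ 2)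
      ≤ (2 * ((k : ℝ) + 1)) ^ k * (2 ^ k * (2 ^ k) ^ 2) := by gcongr
    _ = (16 * ((k : ℝ) + 1)) ^ k := by
        rw [← pow_succ', ← pow_mul, mul_comm k, pow_mul, ← mul_pow]; norm_num; ring
    _ ≤ (24 * (k : ℝ)) ^ k := pow_le_pow_left₀ (by positivity) (by linarith) k

/-- The vector of extracted features of layer `t`. -/
def Net.extracted {q : ℕ} (N : Net d q) (t : ℕ) (x : Cube d) : EuclideanSpace ℝ (Fin (N.n t)) :=
  euclLin (N.V t) (WithLp.toLp 2 (N.features (√2) x.toReal t))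

/-- If the samples are good then all layers of the trained network extract good features. -/
theorem trained_isGoodExtraction (hI : I.card = k) (hk : 7 ≤ k) {τ η : ℝ}
    {S : Fin (numLayers k) → Fin m → Cube d} (hL : 0 < numLayers k)
    (hS₀ : HasGoodMoments k I (S ⟨0, hL⟩) τ) (hS : ∀ t, IsRepresentative I (S t) τ)
    (hτ0 : 0 ≤ τ) (hη : 0 ≤ η) (hd : 1 ≤ d)
    (hbound : 12 * ((k / 2 + 1 : ℕ) + 1) * (1 / √(m : ℝ) + τ) ≤ η ^ 2)
    (hm : k / 2 + 1 ≤ m) (hτ : τ ≤ ((2 : ℝ) ^ (k + 1))⁻¹)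
    (hsmall : budget k ^ (9 * numLayers k + 10) * (d * η) ≤ 1)
    {N : Net d (k / 2 + 1)} (hN : IsTrainedOn k I S N) (t : ℕ) (ht : t < numLayers k) :
    ∃ g₀ g₁ σ, IsGoodExtraction k I (2 ^ t) (normBound k t) ((budget k ^ 9) ^ t *
      (budget k * (d * η))) (N.extracted t) g₀ g₁ (N.P t) σ := by
  have hk2 : 2 ≤ k := by omega
  have hkR : (7 : ℝ) ≤ k := by exact_mod_cast hk
  have hdR : (1 : ℝ) ≤ d := by exact_mod_cast hd
  set Q := budget k with hQ
  have hQ2000 : 2000 ≤ Q := by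
    refine le_trans ?_ (pow_le_budget hk2 (p := 2) (by positivity) le_rfl (by nlinarith))
    nlinarith
  have hQ1 : 1 ≤ Q := by linarith
  have hdη : 0 ≤ d * η := by positivity
  have hQpow : ∀ p, p ≤ 9 * numLayers k + 10 → Q ^ p * (d * η) ≤ 1 := fun p hp =>
    (mul_le_mul_of_nonneg_right (pow_le_pow_right₀ hQ1 hp) hdη).trans hsmall
  have hη1 : η ≤ 1 := by
    have := hQpow 0 (by omega)
    nlinarith
  have hηd : η ≤ d * η := by nlinarith
  have hlam : 0 ≤ 1 / √(m : ℝ) := by positivity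
  have hlt : 1 / √(m : ℝ) + τ ≤ Q * (d * η) := by
    have h1 : 1 / √(m : ℝ) + τ ≤ η ^ 2 := by
      refine le_trans ?_ hbound
      have : (0 : ℝ) ≤ ((k / 2 + 1 : ℕ) : ℝ) := by positivity
      nlinarith
    nlinarith
  induction t with
  | zero =>
    have hmin := hN ⟨0, hL⟩
    have hw : widths k ⟨0, hL⟩ = 1 / 2 + traceBudget k := by simp [widths, traceBudget]
    rw [hw] at hmin
    have hmin' : IsLayerMinimizer squareLoss (1 / 2 + traceBudget k) (1 / √(m : ℝ))
      (fun i => ((inputVec (S ⟨0, hL⟩ i)).ofLp, target k I (S ⟨0, hL⟩ i).toReal))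
      (N.V 0 : Matrix (Fin (N.n 0)) (Fin (d + 1)) ℝ) (N.P 0) := hmin
    have hm2 : 2 ≤ m := by omega
    have h2k : 2 ^ k * 1730 * (k : ℝ) ^ 2 ≤ Q := by
      have h1 : (k : ℝ) ^ 2 * 1730 ≤ (24 * (k : ℝ)) ^ 3 := by nlinarith
      calc 2 ^ k * 1730 * (k : ℝ) ^ 2 = 2 ^ k * ((k : ℝ) ^ 2 * 1730) := by ring
        _ ≤ (24 * (k : ℝ)) ^ k * (24 * (k : ℝ)) ^ 3 := by gcongr; linarith
        _ = (24 * (k : ℝ)) ^ (k + 3) := by rw [pow_add]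
        _ ≤ Q := pow_le_budget hk2 (by positivity) le_rfl (by nlinarith)
    have h2k1 : (1 : ℝ) ≤ 2 ^ k := one_le_pow₀ (by norm_num)
    have hk2Q : 216 * (k : ℝ) ^ 2 ≤ Q := le_trans (by nlinarith) h2k
    have hsm : 6 * (2 * (k : ℝ)) ^ 2 * (9 * d * η) ≤ Q * (d * η) := by
      calc 6 * (2 * (k : ℝ)) ^ 2 * (9 * d * η) = 216 * (k : ℝ) ^ 2 * (d * η) := by ring
        _ ≤ _ := by gcongr
    have hsm1 : Q * (d * η) ≤ 1 := by simpa using hQpow 1 (by omega)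
    have happ := first_layer_expansion hI hk hS₀ hτ0 hlam hη hbound hmin' hm2
    refine ⟨_, _, _, happ.mono ?_ le_rfl, ?_, ?_, ?_⟩
    · rw [normBound, Real.sqrt_sq (by positivity)]
    · simpa [normBound] using hsm
    · refine fun a => HasDegreeLE.euclLin (fun p => ?_) _ a
      refine Fin.cases ?_ (fun i => ?_) p
      · exact HasDegreeLE.const _ _
      · exact HasDegreeLE.coord i
    · intro j hj x
      refine (first_layer_output hI hk hS₀ hτ0 hlam hη hbound hmin' hm2 (hsm.trans hsm1) j
        (by simpa using hj) x).trans ?_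
      have h1 : 2 * η ^ 2 ≤ 2 * (k : ℝ) ^ 2 * (d * η) := by
        have h2 : η ^ 2 ≤ d * η := by nlinarith
        have h3 : 1 ≤ (k : ℝ) ^ 2 := one_le_pow₀ (by linarith)
        nlinarith
      calc (2 : ℝ) ^ k * (2 * η ^ 2 + 8 * (6 * (2 * (k : ℝ)) ^ 2 * (9 * d * η)))
          ≤ 2 ^ k * (2 * (k : ℝ) ^ 2 * (d * η) + 8 * (6 * (2 * (k : ℝ)) ^ 2 * (9 * d * η))) := by
            gcongr
        _ = 2 ^ k * 1730 * (k : ℝ) ^ 2 * (d * η) := by ring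
        _ ≤ Q * (d * η) := by gcongr
        _ = _ := by simp
  | succ t ih =>
    have ht' : t < numLayers k := by omega
    obtain ⟨g₀, g₁, σ, hg⟩ := ih ht'
    have h2t : 2 ^ t ≤ k := by
      have := (Nat.lt_clog_iff_pow_lt (b := 2) (by norm_num)).1 ht'
      omega
    have hmin := hN ⟨t + 1, ht⟩
    rw [widths_succ] at hmin
    have hfe := (hN ⟨t, ht'⟩).1
    have hge : Q * (d * η) ≤ (Q ^ 9) ^ t * (Q * (d * η)) :=
      le_mul_of_one_le_left (by positivity) (one_le_pow₀ (one_le_pow₀ hQ1))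
    have hwid : (24 * (k : ℝ)) ^ k ≤ Q :=
      pow_le_budget hk2 (by positivity) le_rfl (by nlinarith)
    have hnb := normBound_le_budget hk2 h2t
    have hnb1 := one_le_normBound hk2 t
    obtain ⟨g₀', g₁', σ', h'⟩ := hg.step (N := 2 ^ t) hI hfe.spectral (hS ⟨t + 1, ht⟩) hmin hm hnb1
      (one_le_pow₀ (by linarith)) (mixing_le_width hk2) hlam (by linarith) (by linarith) hτ
      (by
        have h1 : ((24 * (k : ℝ)) ^ k) ^ 2 * normBound k t ^ 2 ≤ Q ^ 2 * Q ^ 2 := by gcongr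
        calc 6 * ((24 * (k : ℝ)) ^ k) ^ 2 * normBound k t ^ 2 * ((Q ^ 9) ^ t * (Q * (d * η)))
            = 6 * (((24 * (k : ℝ)) ^ k) ^ 2 * normBound k t ^ 2) * (Q ^ 9) ^ t * (Q * (d * η)) := by
              ring
          _ ≤ Q * (Q ^ 2 * Q ^ 2) * (Q ^ 9) ^ t * (Q * (d * η)) := by gcongr; linarith
          _ = Q ^ (9 * t + 6) * (d * η) := by ring
          _ ≤ 1 := hQpow _ (by omega))
      (pow_le_budget hk2 (by norm_num) (by linarith) (by nlinarith))
      (pow_le_budget hk2 (by positivity) (by linarith) (by nlinarith)) hwid hnb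
      (by
        have h1 : ((k / 2 + 1 : ℕ) : ℝ) ≤ k := by
          have : k / 2 + 1 ≤ k := by omega
          exact_mod_cast this
        have h2 := pow_le_budget hk2 (x := k) (p := 1) (by positivity) (by linarith) (by nlinarith)
        rw [pow_one] at h2
        exact h1.trans h2) hQ2000
    refine ⟨g₀', g₁', σ', ?_⟩
    rw [pow_succ' (2 : ℕ), normBound, pow_succ' (Q ^ 9), mul_assoc (Q ^ 9)]
    exact h'

/-- If the samples are good then the output of the trained network is close to the target. -/
theorem trained_output_sq_le (hI : I.card = k) (hk : 7 ≤ k) {τ η : ℝ}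
    {S : Fin (numLayers k) → Fin m → Cube d} (hL : 0 < numLayers k)
    (hS₀ : HasGoodMoments k I (S ⟨0, hL⟩) τ) (hS : ∀ t, IsRepresentative I (S t) τ)
    (hτ0 : 0 ≤ τ) (hη : 0 ≤ η) (hd : 1 ≤ d)
    (hbound : 12 * ((k / 2 + 1 : ℕ) + 1) * (1 / √(m : ℝ) + τ) ≤ η ^ 2)
    (hm : k / 2 + 1 ≤ m) (hτ : τ ≤ ((2 : ℝ) ^ (k + 1))⁻¹)
    (hsmall : budget k ^ (9 * numLayers k + 10) * (d * η) ≤ 1)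
    {N : Net d (k / 2 + 1)} (hN : IsTrainedOn k I S N) (x : Cube d) (j : Fin (k / 2 + 1)) :
    (N.output (√2) (numLayers k) x.toReal j - target k I x.toReal j) ^ 2 ≤
      budget k ^ (9 * numLayers k + 2) * (d * η) := by
  have hk2 : 2 ≤ k := by omega
  have hkR : (7 : ℝ) ≤ k := by exact_mod_cast hk
  set Q := budget k with hQ
  have hQ10 : 10 ≤ Q := by
    have := pow_le_budget hk2 (p := 1) (x := 10) (by positivity) (by linarith) (by nlinarith)
    simpa using this
  have hQ1 : 1 ≤ Q := by linarith
  have hdη : 0 ≤ d * η := by positivity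
  obtain ⟨t, ht⟩ : ∃ t, numLayers k = t + 1 := ⟨numLayers k - 1, by omega⟩
  have htL : t < numLayers k := by omega
  obtain ⟨g₀, g₁, σ, hg⟩ := trained_isGoodExtraction hI hk hL hS₀ hS hτ0 hη hd hbound hm hτ hsmall
    hN t htL
  -- All targets are reached: `k ≤ 2 ^ numLayers k = 2 * 2 ^ t`, and the indices do not exceed `k /
  -- 2`.
  have hjt : (j : ℕ) ≤ 2 ^ t := by
    have h1 : k ≤ 2 ^ numLayers k := Nat.le_pow_clog (by norm_num) k
    rw [ht, pow_succ] at h1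
    have := j.2
    omega
  have hpow : ∀ p, p ≤ 9 * numLayers k + 10 → Q ^ p * (d * η) ≤ 1 := fun p hp =>
    (mul_le_mul_of_nonneg_right (pow_le_pow_right₀ hQ1 hp) hdη).trans hsmall
  have he : (Q ^ 9) ^ t * (Q * (d * η)) = Q ^ (9 * t + 1) * (d * η) := by ring
  have h1 := hg.output_sq_le (hN ⟨t, htL⟩).1.spectral (one_le_normBound hk2 t)
    (by rw [he]; exact hpow _ (by omega)) j hjt x
  have hout : N.output (√2) (numLayers k) x.toReal j =
      formBilin (N.P t j) (N.extracted t x) (N.extracted t x) := by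
    rw [Net.output, ht]
    exact reduce_expand (N.P t) (N.V t) (WithLp.toLp 2 (N.features (√2) x.toReal t)) j
  rw [hout]
  refine h1.trans ?_
  rw [he, ← mul_assoc]
  refine mul_le_mul_of_nonneg_right ?_ hdη
  calc 10 * Q ^ (9 * t + 1) ≤ Q * Q ^ (9 * t + 1) := by gcongr
    _ = Q ^ (9 * t + 2) := by ring
    _ ≤ _ := pow_le_pow_right₀ hQ1 (by omega)

end

/-! ### Concentration of the samples -/

section

open MeasureTheory ProbabilityTheory

instance (d : ℕ) : IsProbabilityMeasure (cubeMeasure d) :=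
  isProbabilityMeasure_uniformOn Set.finite_univ Set.univ_nonempty

instance (d L m : ℕ) : IsProbabilityMeasure (sampleMeasure d L m) := by
  unfold sampleMeasure
  infer_instance

lemma integral_cubeMeasure {d : ℕ} (f : Cube d → ℝ) : ∫ x, f x ∂(cubeMeasure d) = avg f := by
  rw [integral_fintype (.of_finite), avg, Finset.mul_sum]
  refine Finset.sum_congr rfl fun x _ => ?_
  rw [Measure.real, cubeMeasure, uniformOn_univ, Measure.count_singleton, card_cube]
  simp

/-- The variance of an empirical mean. -/
lemma integral_empMean_sub_sq_le {d m : ℕ} (hm : m ≠ 0) {f : Cube d → ℝ} {B : ℝ}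
    (hB : ∀ x, |f x| ≤ B) :
    ∫ s : Fin m → Cube d, (empMean s f - avg f) ^ 2 ∂(Measure.pi fun _ => cubeMeasure d) ≤
      B ^ 2 / m := by
  have hmR : (0 : ℝ) < m := by positivity
  have hmem : MemLp f 2 (cubeMeasure d) := .of_discrete
  have h1 := variance_sum_pi (μ := fun _ : Fin m => cubeMeasure d) (X := fun _ => f) fun _ => hmem
  have hE : ∫ s : Fin m → Cube d, (∑ i, fun ω : Fin m → Cube d => f (ω i)) s
      ∂(Measure.pi fun _ => cubeMeasure d) = m * avg f := by
    simp only [Finset.sum_apply]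
    rw [integral_finsetSum _ fun i _ => .of_finite]
    have : ∀ i : Fin m, ∫ s : Fin m → Cube d, f (s i) ∂(Measure.pi fun _ => cubeMeasure d) =
        avg f := fun i => by
      rw [integral_comp_eval (μ := fun _ : Fin m => cubeMeasure d) (f := f)
        (by exact hmem.aestronglyMeasurable), integral_cubeMeasure]
    simp [this]
  rw [variance_eq_integral (by exact (measurable_of_finite _).aemeasurable), hE] at h1
  have h2 : Var[f; cubeMeasure d] ≤ B ^ 2 := by
    refine (variance_le_expectation_sq (by exact hmem.aestronglyMeasurable)).trans ?_
    have : ∫ x, (f ^ 2) x ∂(cubeMeasure d) = avg (fun x => f x ^ 2) := integral_cubeMeasure _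
    rw [this]
    exact avg_le_of_le fun x => by rw [← sq_abs]; exact pow_le_pow_left₀ (abs_nonneg _) (hB x) 2
  calc ∫ s : Fin m → Cube d, (empMean s f - avg f) ^ 2 ∂(Measure.pi fun _ => cubeMeasure d)
      = ∫ s : Fin m → Cube d, (1 / (m : ℝ)) ^ 2 *
          ((∑ i, fun ω : Fin m → Cube d => f (ω i)) s - m * avg f) ^ 2
            ∂(Measure.pi fun _ => cubeMeasure d) := by
        congr 1
        ext s
        rw [← mul_pow, empMean, Finset.sum_apply, mul_sub]
        congr 2
        field_simp
    _ = (1 / (m : ℝ)) ^ 2 * (m * Var[f; cubeMeasure d]) := by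
        rw [integral_const_mul, h1]
        simp
    _ ≤ (1 / (m : ℝ)) ^ 2 * (m * B ^ 2) := by gcongr
    _ = B ^ 2 / m := by field_simp

/-- With high probability, the empirical means of finitely many bounded functions are close to
their expectations on all samples. -/
lemma one_sub_le_measure_deviation {d L m : ℕ} (hm : m ≠ 0) {κ : Type} [Fintype κ]
    {F : κ → Cube d → ℝ} {B τ δ : ℝ} (hB : ∀ a x, |F a x| ≤ B) (hτ : 0 < τ)
    (h : L * (Fintype.card κ * B ^ 2) ≤ τ ^ 2 * (m * δ)) :
    1 - δ ≤ (sampleMeasure d L m).real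
      {S | ∀ t, ∑ a, (empMean (S t) (F a) - avg (F a)) ^ 2 ≤ τ ^ 2} := by
  have hmR : (0 : ℝ) < m := by positivity
  set Z : (Fin L → Fin m → Cube d) → ℝ :=
    fun S => ∑ t, ∑ a, (empMean (S t) (F a) - avg (F a)) ^ 2 with hZ
  have hZ0 : ∀ S, 0 ≤ Z S := fun S => Finset.sum_nonneg fun t _ => Finset.sum_nonneg fun a _ =>
    sq_nonneg _
  have hEZ : ∫ S, Z S ∂(sampleMeasure d L m) ≤ τ ^ 2 * δ := by
    rw [hZ, integral_finsetSum _ fun i _ => .of_finite]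
    have h1 : ∀ t : Fin L, ∫ S : Fin L → Fin m → Cube d,
        ∑ a, (empMean (S t) (F a) - avg (F a)) ^ 2 ∂(sampleMeasure d L m) ≤
          Fintype.card κ * (B ^ 2 / m) := by
      intro t
      rw [integral_finsetSum _ fun i _ => .of_finite]
      have h2 : ∀ a, ∫ S : Fin L → Fin m → Cube d, (empMean (S t) (F a) - avg (F a)) ^ 2
          ∂(sampleMeasure d L m) ≤ B ^ 2 / m := by
        intro a
        rw [sampleMeasure, integral_comp_eval (μ := fun _ : Fin L => Measure.pi fun _ : Fin m =>
          cubeMeasure d) (f := fun s => (empMean s (F a) - avg (F a)) ^ 2)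
          (by exact (measurable_of_finite _).aestronglyMeasurable)]
        exact integral_empMean_sub_sq_le hm (hB a)
      refine (Finset.sum_le_sum fun a _ => h2 a).trans ?_
      simp
    refine (Finset.sum_le_sum fun t _ => h1 t).trans ?_
    rw [Finset.sum_const, Finset.card_univ, Fintype.card_fin, nsmul_eq_mul]
    calc L * (Fintype.card κ * (B ^ 2 / m)) = L * (Fintype.card κ * B ^ 2) / m := by ring
      _ ≤ τ ^ 2 * (m * δ) / m := by gcongr
      _ = τ ^ 2 * δ := by field_simp
  have hmarkov := mul_meas_ge_le_integral_of_nonneg (μ := sampleMeasure d L m) (f := Z)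
    (Filter.Eventually.of_forall hZ0) .of_finite (τ ^ 2)
  have hbad : (sampleMeasure d L m).real {S | τ ^ 2 ≤ Z S} ≤ δ := by
    have h3 := hmarkov.trans hEZ
    have hτ2 : 0 < τ ^ 2 := by positivity
    exact le_of_mul_le_mul_left h3 hτ2
  have hcompl := probReal_compl_eq_one_sub (μ := sampleMeasure d L m)
    (s := {S | τ ^ 2 ≤ Z S}) (Set.toFinite _).measurableSet
  calc 1 - δ ≤ (sampleMeasure d L m).real {S | τ ^ 2 ≤ Z S}ᶜ := by rw [hcompl]; linarith
    _ ≤ _ := by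
      refine measureReal_mono fun S hS t => ?_
      have h4 : Z S < τ ^ 2 := not_le.1 hS
      refine le_trans ?_ h4.le
      exact Finset.single_le_sum
        (f := fun t => ∑ a, (empMean (S t) (F a) - avg (F a)) ^ 2)
        (fun t _ => Finset.sum_nonneg fun a _ => sq_nonneg _) (Finset.mem_univ t)

lemma abs_momentVec_le {d k : ℕ} {I : Finset (Fin d)} (hI : I.card = k) (hk : 1 ≤ k) (x : Cube d)
    (p : (Fin (d + 1) × Fin (d + 1)) ⊕ Fin (k / 2 + 1)) : |momentVec k I x p| ≤ 2 ^ k := by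
  have hin : ∀ a, |(inputVec x).ofLp a| ≤ √2 := by
    refine Fin.cases ?_ fun i => ?_
    · simp [inputVec, abs_of_nonneg (Real.sqrt_nonneg 2)]
    · simp [inputVec, Cube.abs_toReal]
  rcases p with p | j
  · simp only [momentVec, Sum.elim_inl, abs_mul]
    calc _ ≤ √2 * √2 := by gcongr <;> exact hin _
      _ = 2 ^ 1 := by rw [Real.mul_self_sqrt (by norm_num)]; norm_num
      _ ≤ 2 ^ k := pow_le_pow_right₀ (by norm_num) hk
  · exact target_abs_le hI x j

/-- With high probability, all samples are good. -/
theorem one_sub_le_measure_good {d k L m : ℕ} {I : Finset (Fin d)} (hI : I.card = k) (hk : 1 ≤ k)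
    (hm : m ≠ 0) {τ δ : ℝ} (hτ : 0 < τ)
    (h : L * ((((((d : ℝ) + 1) ^ 2 + (k / 2 + 1 : ℕ)) ^ 2 + 2 ^ k * (d + 1))) * (2 ^ k) ^ 4) ≤
      τ ^ 2 * (m * δ)) :
    1 - δ ≤ (sampleMeasure d L m).real
      {S | ∀ t, HasGoodMoments k I (S t) τ ∧ IsRepresentative I (S t) τ} := by
  have h2k : (1 : ℝ) ≤ 2 ^ k := one_le_pow₀ (by norm_num)
  set F : (((Fin (d + 1) × Fin (d + 1)) ⊕ Fin (k / 2 + 1)) ×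
      ((Fin (d + 1) × Fin (d + 1)) ⊕ Fin (k / 2 + 1))) ⊕ ((I → ℤˣ) × Option (Fin d)) →
      Cube d → ℝ := Sum.elim (fun p x => momentVec k I x p.1 * momentVec k I x p.2)
        (fun p x => restrInd I p.1 x * affineCoord p.2 x) with hF
  have hB : ∀ a x, |F a x| ≤ (2 ^ k) ^ 2 := by
    rintro (p | p) x
    · simp only [hF, Sum.elim_inl, abs_mul]
      rw [sq]
      exact mul_le_mul (abs_momentVec_le hI hk x _) (abs_momentVec_le hI hk x _) (abs_nonneg _)
        (by positivity)
    · simp only [hF, Sum.elim_inr, abs_mul]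
      have h1 : |restrInd I p.1 x| ≤ 1 := by
        unfold restrInd
        split_ifs <;> simp
      have h2 : |affineCoord p.2 x| ≤ 1 := by
        rcases p.2 with _ | i <;> simp [affineCoord, Cube.abs_toReal]
      calc _ ≤ (1 : ℝ) * 1 := mul_le_mul h1 h2 (abs_nonneg _) zero_le_one
        _ ≤ (2 ^ k) ^ 2 := by rw [one_mul]; exact one_le_pow₀ h2k
  refine (one_sub_le_measure_deviation hm hB hτ (L := L) ?_).trans
    (measureReal_mono fun S hS t => ?_)
  · refine le_trans (le_of_eq ?_) h
    simp only [Fintype.card_sum, Fintype.card_prod, Fintype.card_option, Fintype.card_fin,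
      card_restr hI]
    push_cast
    ring
  · have hSt := hS t
    rw [Fintype.sum_sum_type] at hSt
    have h1 : 0 ≤ ∑ p, (empMean (S t) (F (.inl p)) - avg (F (.inl p))) ^ 2 :=
      Finset.sum_nonneg fun _ _ => sq_nonneg _
    have h2 : 0 ≤ ∑ p, (empMean (S t) (F (.inr p)) - avg (F (.inr p))) ^ 2 :=
      Finset.sum_nonneg fun _ _ => sq_nonneg _
    refine ⟨?_, fun y o => ?_⟩
    · rw [HasGoodMoments, ← Fintype.sum_prod_type']
      exact (le_add_of_nonneg_right h2).trans hSt
    · refine abs_le_of_sq_le_sq ?_ hτ.le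
      have h3 := Finset.single_le_sum
        (f := fun p => (empMean (S t) (F (.inr p)) - avg (F (.inr p))) ^ 2)
        (fun _ _ => sq_nonneg _) (Finset.mem_univ (y, o))
      exact h3.trans (by linarith)

end

/-! ### A bound on the loss of all feasible networks -/

section

variable {d k m : ℕ} {I : Finset (Fin d)}

/-- The coordinates are independent, and `cosh v ≤ exp (v² / 2)` for each of them. -/
lemma avg_exp_le (v : Fin d → ℝ) :
    avg (fun x : Cube d => Real.exp (∑ i, v i * x.toReal i)) ≤ Real.exp ((∑ i, v i ^ 2) / 2) := by
  have h1 : ∑ x : Cube d, Real.exp (∑ i, v i * x.toReal i) = ∏ i, (2 * Real.cosh (v i)) := by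
    simp only [Real.exp_sum]
    have h2 : ∀ i, 2 * Real.cosh (v i) = ∑ u : ℤˣ, Real.exp (v i * ((u : ℤ) : ℝ)) := by
      intro i
      rw [Real.cosh_eq, UnitsInt.univ]
      simp
      ring
    simp only [h2]
    rw [Finset.prod_univ_sum, Fintype.piFinset_univ]
    rfl
  rw [avg, h1, Finset.prod_mul_distrib, Finset.prod_const, Finset.card_univ, Fintype.card_fin,
    inv_mul_cancel_left₀ (by positivity), Finset.sum_div, Real.exp_sum]
  exact Finset.prod_le_prod (fun i _ => (Real.cosh_pos _).le) fun i _ => Real.cosh_le_exp_half_sq _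

/-- One term of the exponential series of `|t|`, together with `exp |t| ≤ exp t + exp (-t)`. It
converts exponential moments into polynomial ones. -/
lemma pow_two_mul_le_factorial_mul (t : ℝ) (p : ℕ) :
    t ^ (2 * p) ≤ (2 * p).factorial * (Real.exp t + Real.exp (-t)) := by
  have h1 := Real.pow_div_factorial_le_exp |t| (abs_nonneg t) (2 * p)
  rw [div_le_iff₀ (by positivity), (even_two_mul p).pow_abs] at h1
  refine h1.trans ?_
  rw [mul_comm]
  gcongr
  rcases abs_choice t with h | h <;> rw [h] <;> linarith [Real.exp_pos t, Real.exp_pos (-t)]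

/-- Linear forms on the cube have bounded moments. -/
lemma avg_dotProduct_pow_le {u : Fin (d + 1) → ℝ} (hu : ∑ a, u a ^ 2 ≤ 1) (p : ℕ) :
    avg (fun x : Cube d => (u ⬝ᵥ (inputVec x).ofLp) ^ (2 * p)) ≤ (2 * p).factorial * 18 := by
  rw [Fin.sum_univ_succ] at hu
  have htail : 0 ≤ ∑ i : Fin d, u i.succ ^ 2 := Finset.sum_nonneg fun _ _ => sq_nonneg _
  have hdot : ∀ x : Cube d, u ⬝ᵥ (inputVec x).ofLp = u 0 * √2 + ∑ i, u i.succ * x.toReal i :=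
    fun x => Fin.sum_univ_succ _
  have h0 : |u 0 * √2| ≤ 3 / 2 := by
    have h3 : √(2 : ℝ) ≤ 3 / 2 := Real.sqrt_le_iff.2 ⟨by norm_num, by norm_num⟩
    have h4 : |u 0| ≤ 1 := abs_le_of_sq_le_sq (by linarith) zero_le_one
    rw [abs_mul, abs_of_nonneg (Real.sqrt_nonneg 2)]
    calc |u 0| * √2 ≤ 1 * (3 / 2) := by gcongr
      _ = 3 / 2 := one_mul _
  have he : ∀ c : ℝ, |c| ≤ 3 / 2 → ∀ v : Fin d → ℝ, ∑ i, v i ^ 2 ≤ 1 →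
      avg (fun x : Cube d => Real.exp (c + ∑ i, v i * x.toReal i)) ≤ 9 := by
    intro c hc v hv
    simp only [Real.exp_add]
    rw [avg_const_mul]
    calc Real.exp c * avg (fun x : Cube d => Real.exp (∑ i, v i * x.toReal i))
        ≤ Real.exp (3 / 2) * Real.exp (1 / 2) := by
          gcongr
          · exact avg_nonneg fun x => (Real.exp_pos _).le
          · exact (le_abs_self c).trans hc
          · exact (avg_exp_le v).trans (Real.exp_le_exp.2 (by linarith))
      _ = Real.exp 1 ^ 2 := by rw [← Real.exp_add, ← Real.exp_nat_mul]; norm_num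
      _ ≤ 9 := by nlinarith [Real.exp_one_lt_d9, Real.exp_pos 1]
  calc avg (fun x : Cube d => (u ⬝ᵥ (inputVec x).ofLp) ^ (2 * p))
      ≤ avg (fun x : Cube d => (2 * p).factorial * (Real.exp (u 0 * √2 +
          ∑ i, u i.succ * x.toReal i) + Real.exp (-(u 0 * √2) +
            ∑ i, -u i.succ * x.toReal i))) := by
        refine avg_mono fun x => (pow_two_mul_le_factorial_mul _ p).trans (le_of_eq ?_)
        rw [hdot, neg_add]
        simp only [neg_mul, Finset.sum_neg_distrib]
    _ ≤ (2 * p).factorial * (9 + 9) := by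
        rw [avg_const_mul, avg_add]
        gcongr
        · exact he _ h0 _ (by linarith [sq_nonneg (u 0)])
        · exact he _ (by rwa [abs_neg]) _ (by simp only [neg_sq]; linarith [sq_nonneg (u 0)])
    _ = _ := by norm_num

/-- A weighted power mean inequality. -/
lemma sum_mul_pow_le {κ : Type} (s : Finset κ) {c z : κ → ℝ} (hc : ∀ a ∈ s, 0 ≤ c a)
    (hz : ∀ a ∈ s, 0 ≤ z a) {p : ℕ} (hp : p ≠ 0) :
    (∑ a ∈ s, c a * z a) ^ p ≤ (∑ a ∈ s, c a) ^ (p - 1) * ∑ a ∈ s, c a * z a ^ p := by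
  obtain ⟨p, rfl⟩ := Nat.exists_eq_succ_of_ne_zero hp
  set A := ∑ a ∈ s, c a with hA
  rcases (Finset.sum_nonneg hc).eq_or_lt with h0 | hpos
  · have hc0 : ∀ a ∈ s, c a = 0 := (Finset.sum_eq_zero_iff_of_nonneg hc).1 h0.symm
    have h1 : ∀ y : κ → ℝ, ∑ a ∈ s, c a * y a = 0 := fun y =>
      Finset.sum_eq_zero fun a ha => by rw [hc0 a ha, zero_mul]
    rw [h1, h1 fun a => z a ^ (p + 1)]
    simp
  · have hApos : 0 < A := hpos
    have h := Real.pow_arith_mean_le_arith_mean_pow s (fun a => c a / A) z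
      (fun a ha => div_nonneg (hc a ha) hApos.le)
      (by rw [← Finset.sum_div, div_self hApos.ne']) hz (p + 1)
    have h1 : ∀ y : κ → ℝ, ∑ a ∈ s, c a / A * y a = (∑ a ∈ s, c a * y a) / A := fun y => by
      rw [Finset.sum_div]
      exact Finset.sum_congr rfl fun a _ => by ring
    rw [h1, h1, div_pow, div_le_div_iff₀ (by positivity) hApos, pow_succ A, ← mul_assoc] at h
    have := le_of_mul_le_mul_right h hApos
    simpa [mul_comm] using this

/-- The squared norm of the first extracted features has bounded moments. -/
lemma avg_norm_euclLin_inputVec_pow_le {n : ℕ} {V : Matrix (Fin n) (Fin (d + 1)) ℝ} {M : ℝ}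
    (hV : frSq V ≤ M) {p : ℕ} (hp : p ≠ 0) :
    avg (fun x : Cube d => (‖euclLin V (inputVec x)‖ ^ 2) ^ p) ≤
      M ^ p * ((2 * p).factorial * 18) := by
  set c : Fin n → ℝ := fun a => ∑ b, V a b ^ 2 with hc
  have hc0 : ∀ a, 0 ≤ c a := fun a => Finset.sum_nonneg fun _ _ => sq_nonneg _
  have hM : 0 ≤ M := (frSq_nonneg V).trans hV
  -- The normalized rows; for a zero row the inverse is zero by convention, and the identities below
  -- persist. The squared norm is then a weighted sum of squares of unit linear forms with total
  -- weight at most `M`, so the bound does not involve the number of rows.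
  set u : Fin n → Fin (d + 1) → ℝ := fun a => (√(c a))⁻¹ • V a with hu
  have hu1 : ∀ a, ∑ b, u a b ^ 2 ≤ 1 := by
    intro a
    simp only [hu, Pi.smul_apply, smul_eq_mul, mul_pow, ← Finset.mul_sum, inv_pow,
      Real.sq_sqrt (hc0 a)]
    exact inv_mul_le_one
  have hsq : ∀ a (y : Fin (d + 1) → ℝ), (V a ⬝ᵥ y) ^ 2 = c a * (u a ⬝ᵥ y) ^ 2 := by
    intro a y
    rcases (hc0 a).eq_or_lt with h0 | hpos
    · have hz : ∀ b, V a b = 0 := fun b => by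
        have := (Finset.sum_eq_zero_iff_of_nonneg fun b _ => sq_nonneg (V a b)).1 h0.symm b
          (Finset.mem_univ b)
        exact pow_eq_zero_iff two_ne_zero |>.1 this
      have : V a ⬝ᵥ y = 0 := Finset.sum_eq_zero fun b _ => by rw [hz, zero_mul]
      rw [this, ← h0]
      norm_num
    · rw [hu, smul_dotProduct, smul_eq_mul, mul_pow, inv_pow, Real.sq_sqrt (hc0 a),
        mul_inv_cancel_left₀ hpos.ne']
  have hnorm : ∀ x : Cube d, ‖euclLin V (inputVec x)‖ ^ 2 =
      ∑ a, c a * (u a ⬝ᵥ (inputVec x).ofLp) ^ 2 := fun x => by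
    simp only [← hsq]
    exact norm_toLp_sq _
  calc avg (fun x : Cube d => (‖euclLin V (inputVec x)‖ ^ 2) ^ p)
      ≤ avg (fun x : Cube d => (∑ a, c a) ^ (p - 1) *
          ∑ a, c a * ((u a ⬝ᵥ (inputVec x).ofLp) ^ 2) ^ p) := avg_mono fun x => by
        rw [hnorm]
        exact sum_mul_pow_le _ (fun a _ => hc0 a) (fun a _ => sq_nonneg _) hp
    _ = (∑ a, c a) ^ (p - 1) *
          ∑ a, c a * avg (fun x : Cube d => (u a ⬝ᵥ (inputVec x).ofLp) ^ (2 * p)) := by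
        rw [avg_const_mul, avg_sum]
        simp only [avg_const_mul, ← pow_mul]
    _ ≤ (∑ a, c a) ^ (p - 1) * ∑ a, c a * ((2 * p).factorial * 18) := by
        have := Finset.sum_nonneg fun a (_ : a ∈ Finset.univ) => hc0 a
        gcongr with a
        exact avg_dotProduct_pow_le (hu1 a) p
    _ = (∑ a, c a) ^ p * ((2 * p).factorial * 18) := by
        rw [← Finset.sum_mul, ← mul_assoc, ← pow_succ, Nat.sub_add_cancel (by omega)]
    _ ≤ M ^ p * ((2 * p).factorial * 18) := by
        have := Finset.sum_nonneg fun a (_ : a ∈ Finset.univ) => hc0 a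
        gcongr
        exact hV

/-- With `M = (24 k) ^ k`, a layer satisfies `‖g_{t+1}‖² ≤ M ‖g_t‖⁴`, so `M ‖g_t‖²` is at most
squared at each layer. -/
lemma norm_extracted_le (hk : 2 ≤ k) {S : Fin (numLayers k) → Fin m → Cube d}
    {N : Net d (k / 2 + 1)} (hN : IsTrainedOn k I S N) (x : Cube d) (t : ℕ)
    (ht : t < numLayers k) :
    (24 * (k : ℝ)) ^ k * ‖N.extracted t x‖ ^ 2 ≤
      ((24 * (k : ℝ)) ^ k * ‖N.extracted 0 x‖ ^ 2) ^ 2 ^ t := by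
  induction t with
  | zero => simp
  | succ t ih =>
    have h1 := ih (by omega)
    have hw := (hN ⟨t + 1, ht⟩).1.width
    rw [widths_succ] at hw
    have h2 : ‖N.extracted (t + 1) x‖ ^ 2 ≤
        (24 * (k : ℝ)) ^ k * (‖N.extracted t x‖ * ‖N.extracted t x‖) ^ 2 := by
      rw [← norm_outerBilin]
      exact (norm_toLp_mulVec_sq_le (N.V (t + 1)) _).trans
        (mul_le_mul_of_nonneg_right hw (sq_nonneg _))
    calc (24 * (k : ℝ)) ^ k * ‖N.extracted (t + 1) x‖ ^ 2
        ≤ (24 * (k : ℝ)) ^ k * ((24 * (k : ℝ)) ^ k *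
            (‖N.extracted t x‖ * ‖N.extracted t x‖) ^ 2) := by gcongr
      _ = ((24 * (k : ℝ)) ^ k * ‖N.extracted t x‖ ^ 2) ^ 2 := by ring
      _ ≤ (((24 * (k : ℝ)) ^ k * ‖N.extracted 0 x‖ ^ 2) ^ 2 ^ t) ^ 2 := by gcongr
      _ = _ := by rw [← pow_mul, ← pow_succ]

/-- The loss of every feasible network is bounded in terms of `k`. -/
theorem trained_populationLoss_le (hI : I.card = k) (hk : 2 ≤ k)
    {S : Fin (numLayers k) → Fin m → Cube d} {N : Net d (k / 2 + 1)}
    (hN : IsTrainedOn k I S N) :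
    populationLoss k I (N.output (√2) (numLayers k)) ≤ budget k ^ 5 := by
  have hkR : (2 : ℝ) ≤ k := by exact_mod_cast hk
  have hL : 0 < numLayers k := Nat.clog_pos (by norm_num) hk
  obtain ⟨t, ht⟩ : ∃ t, numLayers k = t + 1 := ⟨numLayers k - 1, by omega⟩
  set M := (24 * (k : ℝ)) ^ k with hM
  have hM1 : 1 ≤ M := one_le_pow₀ (by linarith)
  -- The last output form is at most `(M ‖g_0‖²) ^ (2 ^ t)`, and its square brings the exponent to
  -- `2 ^ (t + 1)`. This is at most `2 k`, so only moments of order `O(k)` of the first features are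
  -- needed, and `d` does not enter.
  set p := 2 ^ (t + 1) with hp
  have hpk : p ≤ 2 * k := by
    have h1 : 2 ^ t < k := (Nat.lt_clog_iff_pow_lt (by norm_num)).1 (show t < numLayers k by omega)
    rw [hp, pow_succ]
    omega
  have hp0 : p ≠ 0 := by positivity
  have hout : ∀ x j, (N.output (√2) (numLayers k) x.toReal j) ^ 2 ≤
      M ^ p * (‖N.extracted 0 x‖ ^ 2) ^ p := by
    intro x j
    have h1 : N.output (√2) (numLayers k) x.toReal j =
        formBilin (N.P t j) (N.extracted t x) (N.extracted t x) := by
      rw [Net.output, ht]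
      exact reduce_expand (N.P t) (N.V t) (WithLp.toLp 2 (N.features (√2) x.toReal t)) j
    have h2 := norm_formBilin_le ((hN ⟨t, by omega⟩).1.spectral j) (N.extracted t x)
      (N.extracted t x)
    have h3 := norm_extracted_le hk hN x t (by omega)
    rw [h1, ← sq_abs, ← mul_pow]
    calc |formBilin (N.P t j) (N.extracted t x) (N.extracted t x)| ^ 2
        ≤ (M * ‖N.extracted t x‖ ^ 2) ^ 2 := by
          refine pow_le_pow_left₀ (abs_nonneg _) (h2.trans ?_) 2
          rw [← sq]
          exact le_mul_of_one_le_left (sq_nonneg _) hM1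
      _ ≤ ((M * ‖N.extracted 0 x‖ ^ 2) ^ 2 ^ t) ^ 2 := by gcongr
      _ = _ := by rw [← pow_mul, ← pow_succ]
  have hw := (hN ⟨0, hL⟩).1.width
  have hw2 : widths k ⟨0, hL⟩ ≤ 2 := by
    have : widths k ⟨0, hL⟩ = 1 / 2 + traceBudget k := by simp [widths, traceBudget]
    rw [this]
    linarith [traceBudget_le_one hk]
  have hmom : avg (fun x : Cube d => (‖N.extracted 0 x‖ ^ 2) ^ p) ≤
      2 ^ p * ((2 * p).factorial * 18) :=
    avg_norm_euclLin_inputVec_pow_le (V := (N.V 0 : Matrix (Fin (N.n 0)) (Fin (d + 1)) ℝ))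
      (hw.trans hw2) hp0
  set Q := budget k with hQ
  have hk2 : k * 2 ≤ k * k := by gcongr
  have q1 : M ^ p ≤ Q := by
    rw [hM, ← pow_mul]
    exact pow_le_budget hk (by positivity) le_rfl (by nlinarith)
  have q2 : (2 : ℝ) ^ p ≤ Q := pow_le_budget hk (by norm_num) (by linarith) (by nlinarith)
  have q3 : ((2 * p).factorial : ℝ) ≤ Q := by
    have h1 : ((2 * p).factorial : ℝ) ≤ ((2 * p : ℕ) : ℝ) ^ (2 * p) := by
      exact_mod_cast Nat.factorial_le_pow _
    have h2 : ((2 * p : ℕ) : ℝ) ≤ 24 * k := by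
      have : (p : ℝ) ≤ 2 * k := by exact_mod_cast hpk
      push_cast
      linarith
    exact h1.trans (pow_le_budget hk (by positivity) h2 (by nlinarith))
  have q4 : (k : ℝ) * 100 ≤ Q := by
    refine le_trans ?_ (pow_le_budget hk (p := 2) (by positivity) le_rfl (by nlinarith))
    nlinarith
  have q5 : ((2 : ℝ) ^ k) ^ 2 ≤ Q := by
    rw [← pow_mul]
    exact pow_le_budget hk (by norm_num) (by linarith) (by nlinarith)
  have hQ1 : 1 ≤ Q := by linarith
  have hj : ∀ j, avg (fun x : Cube d => (N.output (√2) (numLayers k) x.toReal j -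
      target k I x.toReal j) ^ 2) ≤ 100 * Q ^ 4 / 2 := by
    intro j
    calc _ ≤ avg (fun x : Cube d => 2 * (M ^ p * (‖N.extracted 0 x‖ ^ 2) ^ p) +
          2 * (2 ^ k) ^ 2) := by
          refine avg_mono fun x => ?_
          have h1 := hout x j
          have h2 : target k I x.toReal j ^ 2 ≤ (2 ^ k) ^ 2 := by
            rw [← sq_abs]
            exact pow_le_pow_left₀ (abs_nonneg _) (target_abs_le hI x j) 2
          nlinarith [sq_nonneg (N.output (√2) (numLayers k) x.toReal j + target k I x.toReal j)]
      _ ≤ 2 * (Q * (Q * (Q * 18))) + 2 * Q := by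
          rw [avg_add, avg_const_mul, avg_const_mul, avg_const]
          have h3 : avg (fun x : Cube d => (‖N.extracted 0 x‖ ^ 2) ^ p) ≤ Q * (Q * 18) :=
            hmom.trans (by gcongr)
          have h4 : 0 ≤ avg (fun x : Cube d => (‖N.extracted 0 x‖ ^ 2) ^ p) :=
            avg_nonneg fun x => by positivity
          gcongr
      _ = 36 * Q ^ 3 + 2 * Q ^ 1 := by ring
      _ ≤ 36 * Q ^ 4 + 2 * Q ^ 4 := by gcongr <;> first | exact hQ1 | norm_num
      _ ≤ _ := by
          have : 0 ≤ Q ^ 4 := by positivity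
          linarith
  unfold populationLoss squareLoss
  rw [integral_cubeMeasure, avg_sum]
  calc _ ≤ ∑ _j : Fin (k / 2 + 1), 100 * Q ^ 4 / 2 := Finset.sum_le_sum fun j _ => hj j
    _ = ((k / 2 + 1 : ℕ) : ℝ) * (100 * Q ^ 4 / 2) := by simp
    _ ≤ k * (100 * Q ^ 4 / 2) := by
        have : ((k / 2 + 1 : ℕ) : ℝ) ≤ k := by
          have : k / 2 + 1 ≤ k := by omega
          exact_mod_cast this
        gcongr
    _ ≤ k * 100 * Q ^ 4 := by
        have : 0 ≤ (k : ℝ) * Q ^ 4 := by positivity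
        linarith
    _ ≤ Q * Q ^ 4 := by gcongr
    _ = Q ^ 5 := by ring

end

/-! ### The guarantee in terms of the budget -/

section

open MeasureTheory

variable {d k m : ℕ} {I : Finset (Fin d)}

/-- Bounds the number of empirical means to be controlled, times the squared bound on the functions.
The factor `d ^ 4` comes from pairs of products of two input coordinates. -/
lemma card_family_le (hk : 7 ≤ k) (hkd : (k : ℝ) ≤ d) :
    (numLayers k : ℝ) * ((((((d : ℝ) + 1) ^ 2 + (k / 2 + 1 : ℕ)) ^ 2 +
      2 ^ k * (d + 1))) * (2 ^ k) ^ 4) ≤ (d : ℝ) ^ 4 * budget k ^ 2 := by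
  have hk2 : 2 ≤ k := by omega
  have hkR : (7 : ℝ) ≤ k := by exact_mod_cast hk
  have h1 : (numLayers k : ℝ) ≤ k := by
    have : numLayers k ≤ k := Nat.clog_le_of_le_pow Nat.lt_two_pow_self.le
    exact_mod_cast this
  have hd1 : (1 : ℝ) ≤ d := by linarith
  have hd2 : (d : ℝ) ≤ (d : ℝ) ^ 2 := by nlinarith
  have hd4 : (d : ℝ) ≤ (d : ℝ) ^ 4 := by
    simpa using pow_le_pow_right₀ hd1 (show 1 ≤ 4 by norm_num)
  have hkh : ((k / 2 + 1 : ℕ) : ℝ) ≤ k := by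
    have : k / 2 + 1 ≤ k := by omega
    exact_mod_cast this
  have h2 : ((d : ℝ) + 1) ^ 2 + (k / 2 + 1 : ℕ) ≤ 5 * (d : ℝ) ^ 2 := by
    have : (1 : ℝ) ≤ (d : ℝ) ^ 2 := one_le_pow₀ hd1
    calc ((d : ℝ) + 1) ^ 2 + (k / 2 + 1 : ℕ) ≤ ((d : ℝ) + 1) ^ 2 + d := by linarith
      _ = (d : ℝ) ^ 2 + 3 * d + 1 := by ring
      _ ≤ 5 * (d : ℝ) ^ 2 := by linarith
  have h3 : (1 : ℝ) ≤ 2 ^ k := one_le_pow₀ (by norm_num)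
  have h4 : (2 : ℝ) ^ (5 * k) ≤ budget k :=
    pow_le_budget hk2 (by norm_num) (by linarith) (by nlinarith)
  have h5 : 27 * (k : ℝ) ≤ budget k := by
    refine le_trans ?_ (pow_le_budget hk2 (p := 2) (by positivity) le_rfl (by nlinarith))
    nlinarith
  have hQ0 : 0 ≤ budget k := le_trans (by positivity) h4
  calc (numLayers k : ℝ) * ((((((d : ℝ) + 1) ^ 2 + (k / 2 + 1 : ℕ)) ^ 2 +
        2 ^ k * (d + 1))) * (2 ^ k) ^ 4)
      ≤ k * (((5 * (d : ℝ) ^ 2) ^ 2 + 2 ^ k * (d + d)) * (2 ^ k) ^ 4) := by gcongr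
    _ ≤ k * ((2 ^ k * (25 * (d : ℝ) ^ 4) + 2 ^ k * ((d : ℝ) ^ 4 + (d : ℝ) ^ 4)) * (2 ^ k) ^ 4) := by
        gcongr
        calc (5 * (d : ℝ) ^ 2) ^ 2 = 1 * (25 * (d : ℝ) ^ 4) := by ring
          _ ≤ 2 ^ k * (25 * (d : ℝ) ^ 4) := by gcongr
    _ = (d : ℝ) ^ 4 * ((27 * k) * 2 ^ (5 * k)) := by ring
    _ ≤ (d : ℝ) ^ 4 * (budget k * budget k) := by gcongr
    _ = (d : ℝ) ^ 4 * budget k ^ 2 := by rw [sq]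

/-- If `d` is large in terms of `k` then training succeeds with high probability. -/
theorem one_sub_le_measure_loss_le (hI : I.card = k) (hk : 7 ≤ k)
    (hd : budget k ^ (9 * numLayers k + 20) ≤ d) (hm : 1 ≤ m) {δ : ℝ} (hδ0 : 0 < δ)
    (hδ1 : δ < 1) :
    1 - δ ≤ (sampleMeasure d (numLayers k) m).real
      {S | ∀ N : Net d (k / 2 + 1), IsTrainedOn k I S N →
        populationLoss k I (N.output (√2) (numLayers k)) ≤
          (d : ℝ) ^ 4 / (δ * (m : ℝ) ^ (1 / 4 : ℝ))} := by
  have hk2 : 2 ≤ k := by omega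
  have hkR : (7 : ℝ) ≤ k := by exact_mod_cast hk
  have hL : 0 < numLayers k := Nat.clog_pos (by norm_num) hk2
  set Q := budget k with hQ
  have q1 : 1000 * (k : ℝ) ≤ Q := by
    refine le_trans ?_ (pow_le_budget hk2 (p := 2) (by positivity) le_rfl (by nlinarith))
    nlinarith
  have hQ1 : 1 ≤ Q := by linarith
  have hQd : ∀ p, p ≤ 9 * numLayers k + 20 → Q ^ p ≤ d := fun p hp =>
    (pow_le_pow_right₀ hQ1 hp).trans hd
  have hkd : (k : ℝ) ≤ d := by
    have := hQd 1 (by omega)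
    rw [pow_one] at this
    linarith
  have hd1 : (1 : ℝ) ≤ d := by linarith
  set μ := (m : ℝ) ^ (1 / 4 : ℝ) with hμ
  have hmR : (1 : ℝ) ≤ m := by exact_mod_cast hm
  have hμ1 : 1 ≤ μ := Real.one_le_rpow hmR (by norm_num)
  have hμ4 : μ ^ 4 = m := by
    rw [hμ, ← Real.rpow_natCast, ← Real.rpow_mul (by linarith)]
    norm_num
  have hsqrt : √(m : ℝ) = μ ^ 2 := by
    rw [← hμ4, show μ ^ 4 = (μ ^ 2) ^ 2 by ring, Real.sqrt_sq (by positivity)]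
  set T := δ * μ with hT
  have hT0 : 0 < T := by positivity
  -- If `T < d ^ 3`, the claimed bound exceeds `d`, hence exceeds the loss of any feasible network,
  -- and nothing has to be learned.
  rcases lt_or_ge T ((d : ℝ) ^ 3) with hA | hB
  · have huniv : {S : Fin (numLayers k) → Fin m → Cube d | ∀ N : Net d (k / 2 + 1),
        IsTrainedOn k I S N → populationLoss k I (N.output (√2) (numLayers k)) ≤
          (d : ℝ) ^ 4 / T} = Set.univ := by
      refine Set.eq_univ_of_forall fun S N hN => ?_
      refine (trained_populationLoss_le hI hk2 hN).trans ((hQd 5 (by omega)).trans ?_)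
      rw [le_div_iff₀ hT0]
      nlinarith
    rw [huniv, probReal_univ]
    linarith
  · have hTμ : T ≤ μ := mul_le_of_le_one_left (by linarith) hδ1.le
    have hd3 : (d : ℝ) ≤ d ^ 3 := by
      calc (d : ℝ) = d ^ 1 := (pow_one _).symm
        _ ≤ d ^ 3 := pow_le_pow_right₀ hd1 (by norm_num)
    -- The choice of `τ` gives `τ² m δ = d ^ 4 Q² / δ`, enough for the concentration bound. As `τ ≤
    -- d² Q / T²`, taking `η = Q d / T` makes `24 k τ ≤ η²`.
    set τ := (d : ℝ) ^ 2 * Q / (δ * μ ^ 2) with hτ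
    set η := Q * d / T with hη
    have hτ0 : 0 < τ := by positivity
    have hη0 : 0 ≤ η := by positivity
    have hT2 : T ^ 2 ≤ δ * μ ^ 2 := by
      rw [hT, mul_pow]
      gcongr
      nlinarith
    have hτT : τ ≤ d ^ 2 * Q / T ^ 2 := by
      rw [hτ]
      gcongr
    have hlamτ : 1 / √(m : ℝ) ≤ τ := by
      rw [hsqrt, hτ, div_le_div_iff₀ (by positivity) (by positivity)]
      have h1 : 1 ≤ (d : ℝ) ^ 2 * Q := one_le_mul_of_one_le_of_one_le (one_le_pow₀ hd1) hQ1
      exact mul_le_mul h1 (mul_le_of_le_one_left (by positivity) hδ1.le) (by positivity)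
        (by positivity)
    have hk21 : ((k / 2 + 1 : ℕ) : ℝ) + 1 ≤ k := by
      have : k / 2 + 1 + 1 ≤ k := by omega
      exact_mod_cast this
    have hbound : 12 * ((k / 2 + 1 : ℕ) + 1) * (1 / √(m : ℝ) + τ) ≤ η ^ 2 := by
      calc 12 * (((k / 2 + 1 : ℕ) : ℝ) + 1) * (1 / √(m : ℝ) + τ) ≤ 12 * k * (τ + τ) := by gcongr
        _ = 24 * k * τ := by ring
        _ ≤ Q * (d ^ 2 * Q / T ^ 2) := by gcongr; linarith
        _ = η ^ 2 := by rw [hη]; ring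
    have hmk : k / 2 + 1 ≤ m := by
      have h1 : (k : ℝ) ≤ m := by
        calc (k : ℝ) ≤ d := hkd
          _ ≤ μ := by linarith
          _ = μ ^ 1 := (pow_one _).symm
          _ ≤ μ ^ 4 := pow_le_pow_right₀ hμ1 (by norm_num)
          _ = m := hμ4
      have h2 : k ≤ m := by exact_mod_cast h1
      omega
    have h2kQ : ∀ p, p ≤ 5 * k → (2 : ℝ) ^ p ≤ Q := fun p hp =>
      pow_le_budget hk2 (by norm_num) (by linarith) (by nlinarith)
    have hτs : τ ≤ ((2 : ℝ) ^ (k + 1))⁻¹ := by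
      have h1 : Q * 2 ^ (k + 1) ≤ d := by
        calc Q * 2 ^ (k + 1) ≤ Q * Q := by gcongr; exact h2kQ _ (by omega)
          _ = Q ^ 2 := by ring
          _ ≤ d := hQd 2 (by omega)
      refine hτT.trans ?_
      rw [← one_div, div_le_div_iff₀ (by positivity) (by positivity), one_mul]
      calc (d : ℝ) ^ 2 * Q * 2 ^ (k + 1) = (d : ℝ) ^ 2 * (Q * 2 ^ (k + 1)) := by ring
        _ ≤ (d : ℝ) ^ 2 * d := by gcongr
        _ = (d : ℝ) ^ 3 * 1 := by ring
        _ ≤ T * T := mul_le_mul hB (hd1.trans (hd3.trans hB)) zero_le_one hT0.le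
        _ = T ^ 2 := by ring
    have hsmall : Q ^ (9 * numLayers k + 10) * (d * η) ≤ 1 := by
      calc Q ^ (9 * numLayers k + 10) * (d * η) = Q ^ (9 * numLayers k + 11) * d ^ 2 / T := by
            rw [hη]; ring
        _ ≤ d * d ^ 2 / T := by gcongr; exact hQd _ (by omega)
        _ ≤ 1 := by rw [div_le_one hT0]; linarith
    have hsample : (numLayers k : ℝ) * ((((((d : ℝ) + 1) ^ 2 + (k / 2 + 1 : ℕ)) ^ 2 +
        2 ^ k * (d + 1))) * (2 ^ k) ^ 4) ≤ τ ^ 2 * (m * δ) := by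
      calc _ ≤ (d : ℝ) ^ 4 * Q ^ 2 := card_family_le hk hkd
        _ ≤ (d : ℝ) ^ 4 * Q ^ 2 / δ := by
            rw [le_div_iff₀ hδ0]
            exact mul_le_of_le_one_right (by positivity) hδ1.le
        _ = τ ^ 2 * (m * δ) := by
            rw [hτ, ← hμ4]
            field_simp
    refine (one_sub_le_measure_good hI (by omega) (by omega) hτ0 hsample).trans
      (measureReal_mono fun S hS N hN => ?_)
    have hout := trained_output_sq_le hI hk hL (hS _).1 (fun t => (hS t).2) hτ0.le hη0
      (by exact_mod_cast hd1) hbound hmk hτs hsmall hN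
    unfold populationLoss squareLoss
    rw [integral_cubeMeasure]
    refine avg_le_of_le fun x => (Finset.sum_le_sum fun j _ => hout x j).trans ?_
    rw [Finset.sum_const, Finset.card_univ, Fintype.card_fin, nsmul_eq_mul]
    calc ((k / 2 + 1 : ℕ) : ℝ) * (Q ^ (9 * numLayers k + 2) * (d * η))
        ≤ Q * (Q ^ (9 * numLayers k + 2) * (d * η)) := by gcongr; linarith
      _ = Q ^ (9 * numLayers k + 4) * d ^ 2 / T := by rw [hη]; ring
      _ ≤ d * d ^ 2 / T := by gcongr; exact hQd _ (by omega)
      _ ≤ (d : ℝ) ^ 4 / T := by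
          gcongr
          calc (d : ℝ) * (d : ℝ) ^ 2 = (d : ℝ) ^ 3 := by ring
            _ ≤ (d : ℝ) ^ 4 := pow_le_pow_right₀ hd1 (by norm_num)

end

/-! ### Growth rates -/

section

open Filter

/-- The logarithm is `2 k² (9 L + 20) log (24 k)` with `L ≤ 2 log k + 1`. For `k ≥ 24` one has `9 L
+ 20 ≤ 28 log k` and `log (24 k) ≤ 2 log k`, whence 112. -/
lemma budget_pow_le_exp {k : ℕ} (hk : 24 ≤ k) :
    budget k ^ (9 * numLayers k + 20) ≤ Real.exp (112 * ((k : ℝ) * Real.log k) ^ 2) := by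
  have hkR : (24 : ℝ) ≤ k := by exact_mod_cast hk
  have hlog3 : 3 ≤ Real.log k := by
    rw [Real.le_log_iff_exp_le (by linarith)]
    calc Real.exp 3 = Real.exp 1 ^ 3 := by rw [← Real.exp_nat_mul]; norm_num
      _ ≤ 2.72 ^ 3 := by gcongr; linarith [Real.exp_one_lt_d9]
      _ ≤ k := by norm_num; linarith
  have hL : (numLayers k : ℝ) ≤ 2 * Real.log k + 1 := by
    have h1 : 2 ^ (numLayers k - 1) ≤ k := (Nat.pow_pred_clog_lt_self (by norm_num) (by omega)).le
    have h2 : ((numLayers k - 1 : ℕ) : ℝ) * Real.log 2 ≤ Real.log k := by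
      rw [← Real.log_pow]
      exact Real.log_le_log (by positivity) (by exact_mod_cast h1)
    have h3 : (numLayers k : ℝ) ≤ ((numLayers k - 1 : ℕ) : ℝ) + 1 := by
      exact_mod_cast (show numLayers k ≤ numLayers k - 1 + 1 by omega)
    have h4 : (0 : ℝ) ≤ ((numLayers k - 1 : ℕ) : ℝ) := by positivity
    nlinarith [Real.log_two_gt_d9]
  have h24 : Real.log (24 * k) ≤ 2 * Real.log k := by
    rw [Real.log_mul (by norm_num) (by linarith)]
    linarith [Real.log_le_log (by norm_num) hkR]
  have h24' : 0 ≤ Real.log (24 * k) := Real.log_nonneg (by linarith)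
  rw [budget, ← pow_mul, ← Real.log_le_iff_le_exp (by positivity), Real.log_pow]
  push_cast
  calc 2 * (k : ℝ) ^ 2 * (9 * numLayers k + 20) * Real.log (24 * k)
      ≤ 2 * (k : ℝ) ^ 2 * (28 * Real.log k) * (2 * Real.log k) := by
        gcongr
        linarith
    _ = 112 * ((k : ℝ) * Real.log k) ^ 2 := by ring

/-- The exponent on the left is `(k log k)² / log 2` in base `e`, far below 112 times the square; so
the constant 1 already serves in the final bound. -/
lemma two_rpow_le_exp {k : ℕ} :
    (2 : ℝ) ^ (1 * (k : ℝ) ^ 2 * Real.logb 2 k ^ 2) ≤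
      Real.exp (112 * ((k : ℝ) * Real.log k) ^ 2) := by
  have h2 := Real.log_two_gt_d9
  rw [Real.rpow_def_of_pos (by norm_num), Real.exp_le_exp, Real.logb]
  have h3 : Real.log 2 * (1 * (k : ℝ) ^ 2 * (Real.log k / Real.log 2) ^ 2) =
      ((k : ℝ) * Real.log k) ^ 2 / Real.log 2 := by
    field_simp
  rw [h3, div_le_iff₀ (by linarith)]
  nlinarith [sq_nonneg ((k : ℝ) * Real.log k)]

/-- In the sparsity regime of the theorem, `k` is large and `exp O(k² log² k)` is at most `d`. -/
lemma eventually_sparsity {a b : ℝ} (ha : 0 < a) (hab : a ≤ b) :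
    ∀ᶠ d : ℕ in atTop, ∀ k : ℕ, a * sparsityScale d ≤ k → (k : ℝ) ≤ b * sparsityScale d →
      24 ≤ k ∧ Real.exp (112 * ((k : ℝ) * Real.log k) ^ 2) ≤ d := by
  have hb : 0 < b := ha.trans_le hab
  have hlog : Tendsto (fun d : ℕ => Real.log d) atTop atTop :=
    Real.tendsto_log_atTop.comp tendsto_natCast_atTop_atTop
  have e1 : ∀ᶠ l : ℝ in atTop, 24 / a * Real.log l ^ 2 ≤ √l := by
    have h1 := (Real.isLittleO_pow_log_id_atTop (n := 2)).comp_tendsto Real.tendsto_sqrt_atTop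
    filter_upwards [h1.bound (show (0 : ℝ) < a / 96 by positivity), eventually_ge_atTop 1]
      with l hl hl1
    simp only [Function.comp, id, Real.norm_eq_abs, abs_pow, sq_abs] at hl
    rw [Real.log_sqrt (by linarith), abs_of_nonneg (Real.sqrt_nonneg l), div_pow] at hl
    rw [div_mul_eq_mul_div, div_le_iff₀ ha]
    linarith
  -- With `log log d ≥ 11 b` one gets `k log k ≤ √(log d) / 11`, and `112 ≤ 11²` yields the
  -- exponential bound.
  have e2 : ∀ᶠ l : ℝ in atTop, max 1 (11 * b) ≤ Real.log l :=
    Real.tendsto_log_atTop.eventually_ge_atTop _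
  have e3 : ∀ᶠ l : ℝ in atTop, b ≤ √l := Real.tendsto_sqrt_atTop.eventually_ge_atTop _
  filter_upwards [hlog.eventually e1, hlog.eventually e2, hlog.eventually e3,
    hlog.eventually (eventually_ge_atTop 1), eventually_ge_atTop 1] with d h1 h2 h3 h4 h5 k hak hkb
  rw [sparsityScale] at hak hkb
  set l := Real.log d with hl
  set s := Real.log l with hs
  have hs1 : 1 ≤ s := (le_max_left _ _).trans h2
  have hsb : 11 * b ≤ s := (le_max_right _ _).trans h2
  have hk24 : (24 : ℝ) ≤ k := by
    refine le_trans ?_ hak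
    rw [mul_div_assoc', le_div_iff₀ (by positivity)]
    rw [div_mul_eq_mul_div, div_le_iff₀ ha] at h1
    linarith
  have hsq : √l * √l = l := Real.mul_self_sqrt (by linarith)
  have hk0 : (0 : ℝ) < k := by linarith
  have hkl : (k : ℝ) ≤ l := by
    refine hkb.trans ?_
    have : √l / s ^ 2 ≤ √l := div_le_self (Real.sqrt_nonneg l) (one_le_pow₀ hs1)
    calc b * (√l / s ^ 2) ≤ √l * √l := by gcongr
      _ = l := hsq
  have hlogk : Real.log k ≤ s := Real.log_le_log hk0 hkl
  have hlogk0 : 0 ≤ Real.log k := Real.log_nonneg (by linarith)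
  refine ⟨by exact_mod_cast hk24, ?_⟩
  have hd0 : (0 : ℝ) < d := by exact_mod_cast h5
  rw [← Real.le_log_iff_exp_le hd0, ← hl]
  have h6 : (k : ℝ) * Real.log k ≤ √l / 11 := by
    calc (k : ℝ) * Real.log k ≤ b * (√l / s ^ 2) * s := by gcongr
      _ = b / s * √l := by field_simp
      _ ≤ 1 / 11 * √l := by
          refine mul_le_mul_of_nonneg_right ?_ (Real.sqrt_nonneg l)
          rw [div_le_div_iff₀ (by linarith) (by norm_num)]
          linarith
      _ = √l / 11 := by ring
  calc 112 * ((k : ℝ) * Real.log k) ^ 2 ≤ 112 * (√l / 11) ^ 2 := by gcongr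
    _ = 112 / 121 * l := by rw [div_pow, sq (√l), hsq]; ring
    _ ≤ l := by linarith

end

end RedEx

end

theorem mainTheorem1 :
    ∃ C : ℝ, 0 < C ∧ ∀ a b : ℝ, 0 < a → a ≤ b → ∃ C' : ℝ, 0 < C' ∧ ∃ d₀ : ℕ,
      ∀ d k : ℕ, d₀ ≤ d → Even k →
        a * RedEx.sparsityScale d ≤ (k : ℝ) → (k : ℝ) ≤ b * RedEx.sparsityScale d →
        ∀ I : Finset (Fin d), I.card = k → ∀ m : ℕ, 1 ≤ m →
          (∀ S : Fin (RedEx.numLayers k) → Fin m → RedEx.Cube d,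
            ∃ N : RedEx.Net d (k / 2 + 1), RedEx.IsTrainedOn k I S N) ∧
          ∀ δ : ℝ, 0 < δ → δ < 1 →
            1 - δ ≤ (RedEx.sampleMeasure d (RedEx.numLayers k) m).real
              {S | ∀ N : RedEx.Net d (k / 2 + 1), RedEx.IsTrainedOn k I S N →
                RedEx.populationLoss k I (N.output (√2) (RedEx.numLayers k)) ≤
                  RedEx.lossBound C d k m δ} ∧
            RedEx.lossBound C d k m δ ≤ C' * (d : ℝ) ^ 5 / (δ * (m : ℝ) ^ (1 / 4 : ℝ)) := by
  -- Both constants can be 1: in this range of `k` the losses depending on `k` are already absorbed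
  -- by a power of `d`, and the factor `2 ^ (k² log² k)` is used only through being at least 1 and
  -- at most `d`.
  refine ⟨1, one_pos, fun a b ha hab => ⟨1, one_pos, ?_⟩⟩
  obtain ⟨d₀, hd₀⟩ := Filter.eventually_atTop.1 (RedEx.eventually_sparsity ha hab)
  refine ⟨d₀, fun d k hd _ hak hkb I hI m hm => ?_⟩
  obtain ⟨hk, hexp⟩ := hd₀ d hd k hak hkb
  refine ⟨fun S => ?_, fun δ hδ0 hδ1 => ⟨?_, ?_⟩⟩
  · refine RedEx.exists_isTrained RedEx.continuous_squareLoss (fun t => ?_) _ _ _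
    unfold RedEx.widths
    split_ifs <;> positivity
  · have hone : (1 : ℝ) ≤ 2 ^ (1 * (k : ℝ) ^ 2 * Real.logb 2 k ^ 2) :=
      Real.one_le_rpow (by norm_num) (by positivity)
    refine (RedEx.one_sub_le_measure_loss_le hI (by omega)
      ((RedEx.budget_pow_le_exp hk).trans hexp) hm hδ0 hδ1).trans
      (MeasureTheory.measureReal_mono fun S hS N hN => (hS N hN).trans ?_)
    unfold RedEx.lossBound
    gcongr
    exact le_mul_of_one_le_right (by positivity) hone
  · unfold RedEx.lossBound
    refine div_le_div_of_nonneg_right ?_ (by positivity)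
    calc (d : ℝ) ^ 4 * 2 ^ (1 * (k : ℝ) ^ 2 * Real.logb 2 k ^ 2) ≤ (d : ℝ) ^ 4 * d := by
          gcongr
          exact RedEx.two_rpow_le_exp.trans hexp
      _ = 1 * (d : ℝ) ^ 5 := by ring
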